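/- Let $k\in\mathbb N$, $T>0$, $\mathbb T^k=\mathbb R^k/\mathbb Z^k$. Functions on $\mathbb T^k$ are identified with $\mathbb Z^k$-periodic functions on $\mathbb R^k$, and subsets of $T^*\mathbb T^k=\mathbb T^k\times\mathbb R^k$ with their preimages in $\mathbb R^{2k}$. Let $H\in C^2([0,T]\times T^*\mathbb T^k)$ be of the form $$H(t,x,p)=\tfrac12\langle Ap,p\rangle+V(t,x,p),\qquad A^{t}=A,\ \det A\neq0,$$ where $V$ is compactly supported in $p$: there is $R$ with $V(t,x,p)=0$ for all $(t,x)\in[0,T]\times\mathbb T^k$ and $|p|>R$. Assume $(\star)$ for all $t\in[0,T]$ and $x$, the map $p\mapsto D_pH(t,x,p)$ is a $C^1$ diffeomorphism of $\mathbb R^k$ onto itself which is Lipschitz together with its inverse, with a constant independent of $(t,x)$. Then Hamilton's equations of $H$ have, for every initial time $s\in[0,T]$ and every initial point of $\mathbb R^{2k}$, exactly one solution on $[0,T]$; let $\phi_H^{t,s}$, $s,t\in[0,T]$, denote the flow. Moreover there is $N_0\in\mathbb N$ such that for all $N\ge N_0$ and all $t\in(0,T]$ the following holds, with $\varepsilon=t/(N+1)$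 and $t_j=j\varepsilon$, $0\le j\le N+1$. 1. For $0\le j\le N$ the map $(X,P)\mapsto(X,x)$, where $(x,p)=\phi_H^{t_{j+1},t_j}(X,P)$, is a $C^1$ diffeomorphism of $\mathbb R^{2k}$. Hence for all $X,Y\in\mathbb R^k$ there is exactly one trajectory $(x(\tau),p(\tau))$ with $x(t_j)=X$, $x(t_{j+1})=Y$; put $$S_{t_j}^{t_{j+1}}(X,Y)=\int_{t_j}^{t_{j+1}}\Big(\langle p(\tau),\dot x(\tau)\rangle-H(\tau,x(\tau),p(\tau))\Big)\,d\tau .$$ 2. For $U=(X_1,\dots,X_N)\in\mathbb R^{Nk}$, $X_0=X$, $X_{N+1}=x$, the function $S^t_0(X,x;U)=\sum_{j=0}^N S_{t_j}^{t_{j+1}}(X_j,X_{j+1})$ generates $\phi_H^{t,0}$: one has $\phi^{t,0}_H(X,P)=(x,p)$ if and only if there is $U$ with $\partial_US^t_0=0$, $P=-\partial_XS^t_0$, $p=\partial_xS^t_0$ at $(X,x;U)$. 3. For every $\sigma\in C^1(\mathbb T^k)$ the broken-geodesic function $S^t(x;\xi,U)=\sigma(\xi)+S^t_0(\xi,x;U)$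 is of class $C^1$ and generates the wavefront $\phi_H^{t,0}(\operatorname{Im}d\sigma)$: $$\phi_H^{t,0}(\operatorname{Im}d\sigma)=\{(x,\partial_xS^t(x;\xi,U)):\ \partial_{(\xi,U)}S^t(x;\xi,U)=0\}.$$ If $\sigma$ is of class $C^2$, then so is $S^t$, and $0$ is a regular value of $(x;\xi,U)\mapsto\partial_{(\xi,U)}S^t$. 4. $S^t$ is quadratic at infinity, with the nondegenerate quadratic form of the $(N+1)k\times(N+1)k$ block-diagonal matrix $\mathbf A=\operatorname{diag}(A,\dots,A)$, in the following sense. Use, in place of $(\xi,U)=(X_0,\dots,X_N)$, the variables $\eta=(\eta_0,\dots,\eta_N)\in\mathbb R^{(N+1)k}$ with $\eta_j=A^{-1}(X_{j+1}-X_j)$, $X_{N+1}=x$, and write $\tilde S(x;\eta)=S^t(x;\xi,U)$. Then $\tilde S$ is $\mathbb Z^k$-periodic in $x$, and there is a fibered $C^1$ diffeomorphism $(x,\eta)\mapsto(x,\Psi(x,\eta))$ of $\mathbb T^k\times\mathbb R^{(N+1)k}$ ($\Psi$ is of class $C^1$, and each $\Psi(x,\cdot)$ is a $C^1$ diffeomorphism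 of $\mathbb R^{(N+1)k}$), with $\Psi(x,\eta)-\eta$ bounded, such that the function $(x,\eta)\mapsto\tilde S(x;\Psi(x,\eta))$ is of class $C^1$, $\mathbb Z^k$-periodic in $x$, still generates $\phi_H^{t,0}(\operatorname{Im}d\sigma)$, and for some $C>0$ satisfies $$\tilde S(x;\Psi(x,\eta))=\frac1{2\varepsilon}\langle\mathbf A\eta,\eta\rangle\qquad\text{for all }x\text{ and all }|\eta|>C .$$ -/

import Mathlib

open Set

/-- The Euclidean space `ℝ^k`. The torus is `𝕋^k = ℝ^k / ℤ^k`; functions on `𝕋^k` are treated as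
`ℤ^k`-periodic functions on `ℝ^k`, and subsets of `T^*𝕋^k = 𝕋^k × ℝ^k` through their full
preimages in `ℝ^k × ℝ^k`. -/
abbrev EucSp (k : ℕ) : Type := EuclideanSpace ℝ (Fin k)

/-- The vector of `ℝ^k` with integer coordinates `m`. -/
noncomputable def intVec {k : ℕ} (m : Fin k → ℤ) : EucSp k :=
  WithLp.toLp 2 (fun i => (m i : ℝ))

/-- `ℤ^k`-periodicity, for functions with values in an arbitrary type. -/
def ZPeriodic {k : ℕ} {α : Type*} (f : EucSp k → α) : Prop :=
  ∀ (m : Fin k → ℤ) (x : EucSp k), f (x + intVec m) = f x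

/-- `f` is a global `C^1` diffeomorphism from `F` onto `G`. -/
def IsC1Diffeo {F G : Type*} [NormedAddCommGroup F] [NormedSpace ℝ F]
    [NormedAddCommGroup G] [NormedSpace ℝ G] (f : F → G) : Prop :=
  ∃ e : F ≃ G, (∀ z, e z = f z) ∧ ContDiff ℝ 1 e ∧ ContDiff ℝ 1 e.symm

/-- Condition `(⋆)`: each map `p ↦ D_p H(t,x,p)`, `t ∈ [0,T]`, is a global diffeomorphism of `ℝ^k`
which is Lipschitz together with its inverse, with a constant independent of `(t,x)`. -/
def StarCondition {k : ℕ} (H : ℝ → EucSp k → EucSp k → ℝ) (T : ℝ) : Prop :=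
  ∃ K : NNReal, ∀ t ∈ Icc 0 T, ∀ x : EucSp k, ∃ e : EucSp k ≃ EucSp k,
    (∀ p, e p = gradient (H t x) p) ∧ ContDiff ℝ 1 e ∧ ContDiff ℝ 1 e.symm ∧
      LipschitzWith K e ∧ LipschitzWith K e.symm

/-- `γ = (x,p)` solves Hamilton's equations `x' = D_p H`, `p' = - D_x H` on `[0,T]`
(one-sided derivatives at the end points). -/
def IsHamTrajectory {k : ℕ} (H : ℝ → EucSp k → EucSp k → ℝ) (T : ℝ)
    (γ : ℝ → EucSp k × EucSp k) : Prop :=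
  ∀ τ ∈ Icc 0 T, HasDerivWithinAt γ
    (gradient (fun p => H τ (γ τ).1 p) (γ τ).2, - gradient (fun x => H τ x (γ τ).2) (γ τ).1)
    (Icc 0 T) τ

/-- The Hamiltonian vector field of `H` is complete on `[0,T]`: through each point at each time
there is exactly one trajectory on `[0,T]`. -/
def HamComplete {k : ℕ} (H : ℝ → EucSp k → EucSp k → ℝ) (T : ℝ) : Prop :=
  ∀ s ∈ Icc 0 T, ∀ z : EucSp k × EucSp k,
    (∃ γ, IsHamTrajectory H T γ ∧ γ s = z) ∧
      ∀ γ₁ γ₂, IsHamTrajectory H T γ₁ → IsHamTrajectory H T γ₂ → γ₁ s = z → γ₂ s = z →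
        EqOn γ₁ γ₂ (Icc 0 T)

open Classical in
/-- The Hamiltonian flow `φ_H^{t,s}`, for `s, t ∈ [0,T]`: the value at time `t` of the trajectory
which passes through `z` at time `s`. -/
noncomputable def hamFlow {k : ℕ} (H : ℝ → EucSp k → EucSp k → ℝ) (T t s : ℝ)
    (z : EucSp k × EucSp k) : EucSp k × EucSp k :=
  if h : ∃ γ, IsHamTrajectory H T γ ∧ γ s = z then h.choose t else z

/-- The map `(X,P) ↦ (X, x_s^t)`, where `x_s^t` is the position component of `φ_H^{t,s}(X,P)`. -/
noncomputable def twistMap {k : ℕ} (H : ℝ → EucSp k → EucSp k → ℝ) (T t s : ℝ)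
    (z : EucSp k × EucSp k) : EucSp k × EucSp k :=
  (z.1, (hamFlow H T t s z).1)

/-- The initial momentum `P` at time `s` such that the trajectory from `(X,P)` is over `Y` at
time `t` (meaningful when `twistMap` is bijective). -/
noncomputable def startMomentum {k : ℕ} (H : ℝ → EucSp k → EucSp k → ℝ) (T t s : ℝ)
    (X Y : EucSp k) : EucSp k :=
  Function.invFun (fun P => (hamFlow H T t s (X, P)).1) Y

/-- The elementary generating function `S_s^t(X,Y)`: the action `∫ (p · dx/dτ - H) dτ` along the
trajectory which goes from position `X` at time `s` to position `Y` at time `t`. -/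
noncomputable def segmentAction {k : ℕ} (H : ℝ → EucSp k → EucSp k → ℝ) (T t s : ℝ)
    (X Y : EucSp k) : ℝ :=
  ∫ τ in s..t,
    (inner ℝ (hamFlow H T τ s (X, startMomentum H T t s X Y)).2
        (deriv (fun r => (hamFlow H T r s (X, startMomentum H T t s X Y)).1) τ)
      - H τ (hamFlow H T τ s (X, startMomentum H T t s X Y)).1
          (hamFlow H T τ s (X, startMomentum H T t s X Y)).2)

/-- The nodes `t_j = j t / (N+1)` of the subdivision of `[0,t]` into `N+1` equal intervals. -/
noncomputable def node (t : ℝ) (N j : ℕ) : ℝ := (j : ℝ) * (t / ((N : ℝ) + 1))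

/-- The vertices `X_0 = X, X_1 = U_0, …, X_N = U_{N-1}, X_{N+1} = x` of a broken geodesic. -/
def brokenPath {k N : ℕ} (X : EucSp k) (U : Fin N → EucSp k) (x : EucSp k) :
    Fin (N + 2) → EucSp k :=
  Fin.cons (α := fun _ => EucSp k) X (Fin.snoc (α := fun _ => EucSp k) U x)

/-- `S^t_0(X,x;U) = ∑_j S_{t_j}^{t_{j+1}}(X_j, X_{j+1})`. -/
noncomputable def brokenAction {k : ℕ} (H : ℝ → EucSp k → EucSp k → ℝ) (T t : ℝ) {N : ℕ}
    (X x : EucSp k) (U : Fin N → EucSp k) : ℝ :=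
  ∑ j : Fin (N + 1), segmentAction H T (node t N (j + 1)) (node t N j)
    (brokenPath X U x j.castSucc) (brokenPath X U x j.succ)

/-- The broken-geodesic function `S^t(x; ξ, U) = σ(ξ) + S^t_0(ξ, x; U)`. -/
noncomputable def brokenGF {k : ℕ} (H : ℝ → EucSp k → EucSp k → ℝ) (T t : ℝ) (N : ℕ)
    (σ : EucSp k → ℝ) (x : EucSp k) (q : EucSp k × (Fin N → EucSp k)) : ℝ :=
  σ q.1 + brokenAction H T t q.1 x q.2

/-- `S(X,x;U)` generates the canonical transformation `φ`: the graph of `φ` is the set of points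
`((X, -∂S/∂X), (x, ∂S/∂x))` with `∂S/∂U = 0`. -/
def GeneratesMap {k : ℕ} {F : Type*} [NormedAddCommGroup F] [NormedSpace ℝ F]
    (S : EucSp k → EucSp k → F → ℝ) (φ : EucSp k × EucSp k → EucSp k × EucSp k) : Prop :=
  ∀ X P x p : EucSp k, φ (X, P) = (x, p) ↔
    ∃ U : F, fderiv ℝ (S X x) U = 0 ∧ P = - gradient (fun X' => S X' x U) X ∧
      p = gradient (fun x' => S X x' U) x

/-- `S(x;ξ)` generates `L`: `L = {(x, ∂S/∂x) : ∂S/∂ξ = 0}`. -/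
def GeneratesSet {k : ℕ} {F : Type*} [NormedAddCommGroup F] [NormedSpace ℝ F]
    (S : EucSp k → F → ℝ) (L : Set (EucSp k × EucSp k)) : Prop :=
  L = {z | ∃ ξ : F, fderiv ℝ (S z.1) ξ = 0 ∧ z.2 = gradient (fun x => S x ξ) z.1}

/-- `0` is a regular value of `(x,ξ) ↦ ∂S/∂ξ (x,ξ)` (for `S` of class `C^2`). -/
def ZeroIsRegularValue {k : ℕ} {F : Type*} [NormedAddCommGroup F] [NormedSpace ℝ F]
    (S : EucSp k → F → ℝ) : Prop :=
  ∀ z : EucSp k × F, fderiv ℝ (S z.1) z.2 = 0 →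
    Function.Surjective (fderiv ℝ (fun w : EucSp k × F => fderiv ℝ (S w.1) w.2) z)

/-- `Q` is a nondegenerate quadratic form and `S(x;ξ) = Q(ξ)` for all `x` and all `|ξ| > C`. -/
def IsQuadraticAtInfinity {k : ℕ} {F : Type*} [NormedAddCommGroup F] [NormedSpace ℝ F]
    (S : EucSp k → F → ℝ) (Q : QuadraticForm ℝ F) : Prop :=
  (QuadraticMap.polarBilin Q).Nondegenerate ∧
    ∃ C : ℝ, 0 < C ∧ ∀ (x : EucSp k) (ξ : F), C < ‖ξ‖ → S x ξ = Q ξ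

/-- `S` is (the lift of) a `C^1` function on `𝕋^k × F` which generates `L` and is quadratic at
infinity with quadratic form `Q`. -/
def IsGFQI {k : ℕ} {F : Type*} [NormedAddCommGroup F] [NormedSpace ℝ F]
    (S : EucSp k → F → ℝ) (Q : QuadraticForm ℝ F) (L : Set (EucSp k × EucSp k)) : Prop :=
  ZPeriodic S ∧ ContDiff ℝ 1 (fun w : EucSp k × F => S w.1 w.2) ∧ GeneratesSet S L ∧
    IsQuadraticAtInfinity S Q

/-- `(x,η) ↦ (x, Ψ(x,η))` is (the lift of) a fibered `C^1` diffeomorphism of `𝕋^k × F`. -/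
def IsFiberedDiffeo {k : ℕ} {F : Type*} [NormedAddCommGroup F] [NormedSpace ℝ F]
    (Ψ : EucSp k → F → F) : Prop :=
  ZPeriodic Ψ ∧ ContDiff ℝ 1 (fun w : EucSp k × F => Ψ w.1 w.2) ∧ ∀ x, IsC1Diffeo (Ψ x)

/-- The Lagrangian wavefront `φ_H^{t,0}(Im dσ)` (lifted to `ℝ^k × ℝ^k`). -/
noncomputable def wavefront {k : ℕ} (H : ℝ → EucSp k → EucSp k → ℝ) (T t : ℝ)
    (σ : EucSp k → ℝ) : Set (EucSp k × EucSp k) :=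
  hamFlow H T t 0 '' range (fun ξ : EucSp k => (ξ, gradient σ ξ))

/-- The space `ℝ^{(N+1)k}` of the variables `(η_0, …, η_N)`, `η_j = (η (i,j))_i ∈ ℝ^k`. -/
abbrev IncrSp (k N : ℕ) : Type := Fin k × Fin (N + 1) → ℝ

/-- The vertex `X_j = x - ∑_{i ≥ j} A η_i`, `0 ≤ j ≤ N`. -/
noncomputable def vertexOf {k N : ℕ} (A : Matrix (Fin k) (Fin k) ℝ) (x : EucSp k)
    (η : IncrSp k N) (j : Fin (N + 1)) : EucSp k :=
  x - ∑ i ∈ Finset.Ici j, WithLp.toLp 2 (A.mulVec (fun l => η (l, i)))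

/-- The parameters `(ξ,U) = (X_0, (X_1, …, X_N))` as a function of `x = X_{N+1}` and of the
variables `η_j = A⁻¹ (X_{j+1} - X_j)`. -/
noncomputable def incrToParam {k N : ℕ} (A : Matrix (Fin k) (Fin k) ℝ) (x : EucSp k)
    (η : IncrSp k N) : EucSp k × (Fin N → EucSp k) :=
  (vertexOf A x η 0, fun l => vertexOf A x η l.succ)

/-- The quadratic form `η ↦ (1 / 2ε) ⟨diag(A,…,A) η, η⟩` on `ℝ^{(N+1)k}`. -/
noncomputable def blockForm {k : ℕ} (A : Matrix (Fin k) (Fin k) ℝ) (N : ℕ) (ε : ℝ) :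
    QuadraticForm ℝ (IncrSp k N) :=
  (1 / (2 * ε)) • (Matrix.blockDiagonal (fun _ : Fin (N + 1) => A)).toQuadraticForm'

/-! ### Global existence, uniqueness and Grönwall estimates for Lipschitz ODEs -/

section ODE

variable {E : Type*} [NormedAddCommGroup E] [NormedSpace ℝ E]

/-! The Hamiltonian vector field is a linear kinetic part `(x,p) ↦ (A p, 0)` plus a field `b` coming
from `V`. Since `V` is periodic in `x` and vanishes for `|p| > R`, compactness modulo translations
makes `b` and its space derivative bounded and uniformly continuous. The field is thus globally
Lipschitz, which gives a complete flow, and a Grönwall comparison with the variational equation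
shows that the flow is `C^1`. Outside the support of `V` the motion is free: `p` is constant and `x`
moves on a straight line.

Twist. Uniformly in `z`, the differential of the flow is `1 + (t - s)` times the differential of the
field, up to `o(t - s)`. Hence `P ↦ (x - X)/(t - s)` differs from `P ↦ D_pH(s,X,P)` by a map with
small Lipschitz constant. By `(⋆)` the latter map has a Lipschitz inverse, with uniform constant, so
the former is bijective and expanding for short times (`StarCondition.exists_twist_equiv`). How
short does not depend on the starting time, hence one `N₀` for all `t`.

Generation. The first variation formula (`hasFDerivAt_flowAction`) says that a segment action
satisfies `dS = p dY - P dX`, with `C^1` coefficients, so `S` is `C^2`. In the sum over the edges of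
a broken geodesic, the derivative at an inner vertex is the jump of the momentum; critical points
are therefore exactly the unbroken trajectories. With `σ` added, the derivative in `ξ` is `dσ(ξ) -
P`. Regularity of the value `0` follows by deliberately giving the trajectory small impulses at the
vertices: every covector is then the velocity of the parameter derivative along some curve of broken
geodesics.

Quadratic at infinity. Each segment action minus the free action `(1/2ε)⟨A⁻¹(Y - X), Y - X⟩` is
periodic under simultaneous translation and vanishes on trajectories with `|P| > R`, hence is
bounded; its differential is bounded because momenta drift by a bounded amount
(`exists_bound_segmentAction_sub`). In the variables `η` the broken action is thus `Q + f` with `f`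
bounded, Lipschitz and `C^1`. Such a perturbation of a nondegenerate form is removed outside a ball
(`exists_fibered_normal_form`): a displacement `d` of size `O(1/|ζ|)` in the direction of the
inverse form applied to `ζ` solves `Q(ζ + d) = Q(ζ) + f(ζ)` explicitly, and a cutoff at large scale
makes `d` Lipschitz with constant `1/2`, so that `ζ ↦ ζ + d` is a diffeomorphism, whose inverse is
`Ψ`. Fibered changes of variables preserve the generated set, since at a fibre-critical point the
`x`-derivative does not see how the fibre coordinate depends on `x` (`GeneratesSet.comp_fibered`).
-/

theorem gronwallBound_le_mul_exp {δ K ε x : ℝ} (hK : 0 ≤ K) (hε : 0 ≤ ε) (_hx : 0 ≤ x) :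
    gronwallBound δ K ε x ≤ (δ + ε * x) * Real.exp (K * x) := by
  rcases hK.eq_or_lt with rfl | hK
  · simp [gronwallBound_K0]
  · rw [gronwallBound_of_K_ne_0 hK.ne']
    -- The inequality `e^y - 1 ≤ y e^y` removes the division by `K`, so the bound has one form for
    -- `K = 0` and `K > 0`.
    have h1 : Real.exp (K * x) - 1 ≤ K * x * Real.exp (K * x) := by
      have := Real.add_one_le_exp (-(K * x))
      have h2 : Real.exp (K * x) * Real.exp (-(K * x)) = 1 := by
        rw [← Real.exp_add]; simp
      nlinarith [Real.exp_pos (K * x)]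
    have h3 : ε / K * (Real.exp (K * x) - 1) ≤ ε / K * (K * x * Real.exp (K * x)) := by gcongr
    have h4 : ε / K * (K * x * Real.exp (K * x)) = ε * x * Real.exp (K * x) := by field_simp
    rw [h4] at h3
    linarith

theorem norm_le_of_hasDerivWithinAt_Icc {u u' : ℝ → E} {a b K ε δ : ℝ} (hK : 0 ≤ K) (hε : 0 ≤ ε)
    (hu : ∀ τ ∈ Icc a b, HasDerivWithinAt u (u' τ) (Icc a b) τ) (h0 : ‖u a‖ ≤ δ)
    (hb : ∀ τ ∈ Icc a b, ‖u' τ‖ ≤ K * ‖u τ‖ + ε) :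
    ∀ τ ∈ Icc a b, ‖u τ‖ ≤ (δ + ε * (b - a)) * Real.exp (K * (b - a)) := by
  intro τ hτ
  have h1 := norm_le_gronwallBound_of_norm_deriv_right_le
    (fun x hx => (hu x hx).continuousWithinAt)
    (fun x hx => (hu x (Ico_subset_Icc_self hx)).mono_of_mem_nhdsWithin
      (Icc_mem_nhdsGE_of_mem hx)) h0 (fun x hx => hb x (Ico_subset_Icc_self hx)) τ hτ
  have h2 := gronwallBound_mono ((norm_nonneg _).trans h0) hε hK (sub_le_sub_right hτ.2 a)
  exact h1.trans (h2.trans (gronwallBound_le_mul_exp hK hε (by linarith [hτ.1, hτ.2])))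

theorem IsIntegralCurveOn.eqOn_Icc_of_lipschitz {f : ℝ → E → E} {K : NNReal} {a b s : ℝ}
    (hf : ∀ t ∈ Icc a b, LipschitzWith K (f t)) (hs : s ∈ Icc a b) {γ₁ γ₂ : ℝ → E}
    (h₁ : IsIntegralCurveOn γ₁ f (Icc a b)) (h₂ : IsIntegralCurveOn γ₂ f (Icc a b))
    (h : γ₁ s = γ₂ s) : EqOn γ₁ γ₂ (Icc a b) := by
  rw [← Icc_union_Icc_eq_Icc hs.1 hs.2]
  have hL : Icc a s ⊆ Icc a b := Icc_subset_Icc_right hs.2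
  have hR : Icc s b ⊆ Icc a b := Icc_subset_Icc_left hs.1
  apply EqOn.union
  · exact ODE_solution_unique_of_mem_Icc_left (s := fun _ => univ)
      (fun t ht => (hf t (hL (Ioc_subset_Icc_self ht))).lipschitzOnWith)
      (h₁.mono hL).continuousOn
      (fun t ht => ((h₁.mono hL) t (Ioc_subset_Icc_self ht)).mono_of_mem_nhdsWithin
        (Icc_mem_nhdsLE_of_mem ht)) (fun _ _ => mem_univ _)
      (h₂.mono hL).continuousOn
      (fun t ht => ((h₂.mono hL) t (Ioc_subset_Icc_self ht)).mono_of_mem_nhdsWithin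
        (Icc_mem_nhdsLE_of_mem ht)) (fun _ _ => mem_univ _) h
  · exact ODE_solution_unique_of_mem_Icc_right (s := fun _ => univ)
      (fun t ht => (hf t (hR (Ico_subset_Icc_self ht))).lipschitzOnWith)
      (h₁.mono hR).continuousOn
      (fun t ht => ((h₁.mono hR) t (Ico_subset_Icc_self ht)).mono_of_mem_nhdsWithin
        (Icc_mem_nhdsGE_of_mem ht)) (fun _ _ => mem_univ _)
      (h₂.mono hR).continuousOn
      (fun t ht => ((h₂.mono hR) t (Ico_subset_Icc_self ht)).mono_of_mem_nhdsWithin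
        (Icc_mem_nhdsGE_of_mem ht)) (fun _ _ => mem_univ _) h

theorem IsIntegralCurveOn.glue {f : ℝ → E → E} {a b c : ℝ} (hac : a ≤ c) (hcb : c ≤ b)
    {γ₁ γ₂ : ℝ → E} (h₁ : IsIntegralCurveOn γ₁ f (Icc a c)) (h₂ : IsIntegralCurveOn γ₂ f (Icc c b))
    (h : γ₁ c = γ₂ c) :
    IsIntegralCurveOn (fun τ => if τ ≤ c then γ₁ τ else γ₂ τ) f (Icc a b) := by
  set γ : ℝ → E := fun τ => if τ ≤ c then γ₁ τ else γ₂ τ with hγ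
  have e₁ : EqOn γ γ₁ (Icc a c) := fun τ hτ => by simp [hγ, hτ.2]
  have e₂ : EqOn γ γ₂ (Icc c b) := fun τ hτ => by
    rcases hτ.1.eq_or_lt with rfl | hlt
    · simp [hγ, h]
    · simp [hγ, not_le.2 hlt]
  intro τ hτ
  rw [← Icc_union_Icc_eq_Icc hac hcb]
  refine HasDerivWithinAt.union ?_ ?_
  · by_cases hc : τ ∈ Icc a c
    · rw [e₁ hc]; exact (h₁ τ hc).congr e₁ (e₁ hc)
    -- A point outside the closed piece is not in its closure, so the derivative within that piece
    -- is unconstrained there.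
    · exact HasFDerivWithinAt.of_notMem_closure (by rwa [closure_Icc])
  · by_cases hc : τ ∈ Icc c b
    · rw [e₂ hc]; exact (h₂ τ hc).congr e₂ (e₂ hc)
    · exact HasFDerivWithinAt.of_notMem_closure (by rwa [closure_Icc])

variable [CompleteSpace E]

/-- The Lipschitz bound is global, so the radius in Picard–Lindelöf is free. On a ball of radius `r
= 2C(b - a)` the field is at most `C + K r`, and `K(b - a) ≤ 1/2` gives `(C + K r)(b - a) ≤ r`. -/
theorem exists_isIntegralCurveOn_Icc_of_short {f : ℝ → E → E} {K : NNReal} {a b : ℝ}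
    (hf : ∀ t ∈ Icc a b, LipschitzWith K (f t))
    (hc : ∀ x, ContinuousOn (fun t => f t x) (Icc a b)) (hlen : K * (b - a) ≤ 1 / 2)
    {s : ℝ} (hs : s ∈ Icc a b) (z : E) :
    ∃ γ, IsIntegralCurveOn γ f (Icc a b) ∧ γ s = z := by
  obtain ⟨C, hC⟩ := isCompact_Icc.exists_bound_of_continuousOn (hc z)
  have hC0 : 0 ≤ C := (norm_nonneg _).trans (hC s hs)
  have hab : 0 ≤ b - a := by linarith [hs.1, hs.2]
  let r : NNReal := ⟨2 * C * (b - a), by positivity⟩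
  let M : NNReal := ⟨C, hC0⟩ + K * r
  have hP : IsPicardLindelof f (⟨s, hs⟩ : Icc a b) z r 0 M K :=
    { lipschitzOnWith := fun t ht => (hf t ht).lipschitzOnWith
      continuousOn := fun x _ => hc x
      norm_le := fun t ht x hx => by
        have h1 : ‖f t x‖ ≤ ‖f t z‖ + ‖f t x - f t z‖ := by
          simpa using norm_add_le (f t z) (f t x - f t z)
        have h2 := (hf t ht).norm_sub_le x z
        have h3 : ‖x - z‖ ≤ r := by simpa [dist_eq_norm] using hx
        have h4 : (K : ℝ) * ‖x - z‖ ≤ K * r := by gcongr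
        have : (M : ℝ) = C + K * r := rfl
        rw [this]
        linarith [hC t ht]
      mul_max_le := by
        have h1 : max (b - s) (s - a) ≤ b - a :=
          max_le (by linarith [hs.1]) (by linarith [hs.2])
        have h2 : (M : ℝ) = C + K * (2 * C * (b - a)) := rfl
        have h3 : (r : ℝ) = 2 * C * (b - a) := rfl
        have h4 : (M : ℝ) * max (b - s) (s - a) ≤ M * (b - a) := by gcongr
        have h5 : (M : ℝ) * (b - a) ≤ r := by
          rw [h2, h3]
          nlinarith [mul_nonneg hC0 hab, mul_le_mul_of_nonneg_left hlen (mul_nonneg hC0 hab)]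
        simpa using h4.trans h5 }
  obtain ⟨γ, h1, h2⟩ := hP.exists_eq_forall_mem_Icc_hasDerivWithinAt₀
  exact ⟨γ, h2, h1⟩

/-- Bisection: halving the interval halves `2K(b - a)`, so after `n` halvings the short-time case
applies, and the two solutions are glued at the midpoint, starting from the half that contains `s`.
-/
theorem exists_isIntegralCurveOn_Icc {f : ℝ → E → E} {K : NNReal} {a b : ℝ}
    (hf : ∀ t ∈ Icc a b, LipschitzWith K (f t))
    (hc : ∀ x, ContinuousOn (fun t => f t x) (Icc a b))
    {s : ℝ} (hs : s ∈ Icc a b) (z : E) :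
    ∃ γ, IsIntegralCurveOn γ f (Icc a b) ∧ γ s = z := by
  obtain ⟨n, hn⟩ : ∃ n : ℕ, 2 * K * (b - a) ≤ 2 ^ n :=
    pow_unbounded_of_one_lt _ (by norm_num : (1 : ℝ) < 2) |>.imp fun n h => h.le
  induction n generalizing a b s z with
  | zero => exact exists_isIntegralCurveOn_Icc_of_short hf hc (by rw [pow_zero] at hn; linarith) hs z
  | succ n ih =>
    have hab : a ≤ b := hs.1.trans hs.2
    set c := (a + b) / 2 with hcdef
    have hac : a ≤ c := by linarith
    have hcb : c ≤ b := by linarith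
    have hL : Icc a c ⊆ Icc a b := Icc_subset_Icc_right hcb
    have hR : Icc c b ⊆ Icc a b := Icc_subset_Icc_left hac
    have hnL : 2 * K * (c - a) ≤ 2 ^ n := by
      rw [pow_succ] at hn; rw [hcdef]; linarith
    have hnR : 2 * K * (b - c) ≤ 2 ^ n := by
      rw [pow_succ] at hn; rw [hcdef]; linarith
    have ihL := fun {s} hs z => ih (s := s) (fun t ht => hf t (hL ht)) (fun x => (hc x).mono hL)
      hs z hnL
    have ihR := fun {s} hs z => ih (s := s) (fun t ht => hf t (hR ht)) (fun x => (hc x).mono hR)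
      hs z hnR
    rcases le_total s c with hsc | hsc
    · obtain ⟨γ₁, h₁, e₁⟩ := ihL ⟨hs.1, hsc⟩ z
      obtain ⟨γ₂, h₂, e₂⟩ := ihR ⟨le_rfl, hcb⟩ (γ₁ c)
      exact ⟨_, h₁.glue hac hcb h₂ e₂.symm, by simp [hsc, e₁]⟩
    · obtain ⟨γ₂, h₂, e₂⟩ := ihR ⟨hsc, hs.2⟩ z
      obtain ⟨γ₁, h₁, e₁⟩ := ihL ⟨hac, le_rfl⟩ (γ₂ c)
      refine ⟨_, h₁.glue hac hcb h₂ e₁, ?_⟩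
      rcases hsc.eq_or_lt with rfl | hlt
      · simp [e₁, e₂]
      · simp [not_le.2 hlt, e₂]

end ODE

/-! ### Differentiability of the flow in the initial condition -/

section FlowC1

variable {E : Type*} [NormedAddCommGroup E] [NormedSpace ℝ E]

/-- A time-dependent vector field on `[0,T] × E` which is `C^1` in the space variable, with a
bounded and uniformly continuous derivative. -/
structure IsC1Field (f : ℝ → E → E) (f' : ℝ → E → E →L[ℝ] E) (T M : ℝ) : Prop where
  nonneg : 0 ≤ M
  hasFDerivAt : ∀ t ∈ Icc 0 T, ∀ z, HasFDerivAt (f t) (f' t z) z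
  bound : ∀ t ∈ Icc 0 T, ∀ z, ‖f' t z‖ ≤ M
  cont : ContinuousOn (fun q : ℝ × E => f q.1 q.2) (Icc 0 T ×ˢ univ)
  cont' : ContinuousOn (fun q : ℝ × E => f' q.1 q.2) (Icc 0 T ×ˢ univ)
  unif : ∀ ε > 0, ∃ δ > 0, ∀ t ∈ Icc 0 T, ∀ t' ∈ Icc 0 T, |t - t'| < δ → ∀ z w, ‖z - w‖ < δ →
    ‖f' t z - f' t' w‖ ≤ ε

/-- `φ t s z` is the value at time `t` of an integral curve of `f` which is at `z` at time `s`. -/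
structure IsFlowOn (φ : ℝ → ℝ → E → E) (f : ℝ → E → E) (T : ℝ) : Prop where
  curve : ∀ s ∈ Icc 0 T, ∀ z, IsIntegralCurveOn (fun t => φ t s z) f (Icc 0 T)
  self : ∀ s ∈ Icc 0 T, ∀ z, φ s s z = z

namespace IsC1Field

variable {f : ℝ → E → E} {f' : ℝ → E → E →L[ℝ] E} {T M : ℝ} (h : IsC1Field f f' T M)
include h

theorem norm_sub_le {t : ℝ} (ht : t ∈ Icc 0 T) (z w : E) : ‖f t w - f t z‖ ≤ M * ‖w - z‖ :=
  convex_univ.norm_image_sub_le_of_norm_hasFDerivWithin_le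
    (fun x _ => (h.hasFDerivAt t ht x).hasFDerivWithinAt) (fun x _ => h.bound t ht x)
    (mem_univ z) (mem_univ w)

theorem lipschitzWith {t : ℝ} (ht : t ∈ Icc 0 T) : LipschitzWith ⟨M, h.nonneg⟩ (f t) :=
  LipschitzWith.of_dist_le_mul fun x y => by
    rw [dist_eq_norm, dist_eq_norm]; exact h.norm_sub_le ht y x

theorem continuousOn_time (z : E) : ContinuousOn (fun t => f t z) (Icc 0 T) :=
  h.cont.comp (f := fun t : ℝ => (t, z)) (by fun_prop) fun _ ht => ⟨ht, mem_univ _⟩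

theorem eqOn {γ₁ γ₂ : ℝ → E} {s : ℝ} (hs : s ∈ Icc 0 T)
    (h₁ : IsIntegralCurveOn γ₁ f (Icc 0 T)) (h₂ : IsIntegralCurveOn γ₂ f (Icc 0 T))
    (e : γ₁ s = γ₂ s) : EqOn γ₁ γ₂ (Icc 0 T) :=
  IsIntegralCurveOn.eqOn_Icc_of_lipschitz (fun _ ht => h.lipschitzWith ht) hs h₁ h₂ e

theorem exists_curve [CompleteSpace E] {s : ℝ} (hs : s ∈ Icc 0 T) (z : E) :
    ∃ γ, IsIntegralCurveOn γ f (Icc 0 T) ∧ γ s = z :=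
  exists_isIntegralCurveOn_Icc (fun _ ht => h.lipschitzWith ht) h.continuousOn_time hs z

end IsC1Field

variable {f : ℝ → E → E} {f' : ℝ → E → E →L[ℝ] E} {T M : ℝ} {φ : ℝ → ℝ → E → E}

theorem IsFlowOn.comp_apply (hφ : IsFlowOn φ f T) (h : IsC1Field f f' T M) {s r t : ℝ}
    (hs : s ∈ Icc 0 T) (hr : r ∈ Icc 0 T) (ht : t ∈ Icc 0 T) (z : E) :
    φ t r (φ r s z) = φ t s z :=
  h.eqOn hr (hφ.curve r hr _) (hφ.curve s hs z) (hφ.self r hr _) ht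

theorem IsFlowOn.norm_sub_le (hφ : IsFlowOn φ f T) (h : IsC1Field f f' T M) {s t : ℝ}
    (hs : s ∈ Icc 0 T) (ht : t ∈ Icc s T) (z w : E) :
    ‖φ t s w - φ t s z‖ ≤ ‖w - z‖ * Real.exp (M * T) := by
  have hsub : Icc s T ⊆ Icc 0 T := Icc_subset_Icc_left hs.1
  have := norm_le_of_hasDerivWithinAt_Icc (u := fun τ => φ τ s w - φ τ s z)
    (u' := fun τ => f τ (φ τ s w) - f τ (φ τ s z)) (δ := ‖w - z‖) h.nonneg le_rfl
    (fun τ hτ => (((hφ.curve s hs w).mono hsub) τ hτ).sub (((hφ.curve s hs z).mono hsub) τ hτ))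
    (by simp [hφ.self s hs])
    (fun τ hτ => by simpa using h.norm_sub_le (hsub hτ) (φ τ s z) (φ τ s w)) t ht
  have hM := h.nonneg
  refine this.trans ?_
  rw [zero_mul, add_zero]
  gcongr
  linarith [hs.1]

/-- `D t s z` solves the linearization of `f` along the trajectory of `φ` through `z` at time
`s`. -/
structure IsLinearizedFlow (D : ℝ → ℝ → E → E →L[ℝ] E) (φ : ℝ → ℝ → E → E)
    (f' : ℝ → E → E →L[ℝ] E) (T : ℝ) : Prop where
  deriv : ∀ s ∈ Icc 0 T, ∀ z, ∀ t ∈ Icc 0 T,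
    HasDerivWithinAt (fun t => D t s z) ((f' t (φ t s z)).comp (D t s z)) (Icc 0 T) t
  self : ∀ s ∈ Icc 0 T, ∀ z, D s s z = ContinuousLinearMap.id ℝ E

theorem IsFlowOn.continuousOn_deriv (hφ : IsFlowOn φ f T) (h : IsC1Field f f' T M) {s : ℝ}
    (hs : s ∈ Icc 0 T) (z : E) : ContinuousOn (fun t => f' t (φ t s z)) (Icc 0 T) :=
  h.cont'.comp (f := fun t : ℝ => (t, φ t s z))
    (continuousOn_id.prodMk (hφ.curve s hs z).continuousOn) fun _ ht => ⟨ht, mem_univ _⟩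

/-- The variational equation is a linear ODE in `E →L[ℝ] E`; composition on the left with `f'` is
Lipschitz with constant `M`, so the global existence theorem applies. -/
theorem IsFlowOn.exists_linearized [CompleteSpace E] (hφ : IsFlowOn φ f T)
    (h : IsC1Field f f' T M) : ∃ D, IsLinearizedFlow D φ f' T := by
  have key : ∀ s z, ∃ γ : ℝ → E →L[ℝ] E, s ∈ Icc 0 T → IsIntegralCurveOn γ
      (fun t L => (f' t (φ t s z)).comp L) (Icc 0 T) ∧ γ s = ContinuousLinearMap.id ℝ E := by
    intro s z
    by_cases hs : s ∈ Icc 0 T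
    · obtain ⟨γ, hγ⟩ := exists_isIntegralCurveOn_Icc (K := ⟨M, h.nonneg⟩) (a := 0) (b := T)
        (f := fun t (L : E →L[ℝ] E) => (f' t (φ t s z)).comp L)
        (fun t ht => LipschitzWith.of_dist_le_mul fun L L' => by
          rw [dist_eq_norm, dist_eq_norm, ← ContinuousLinearMap.comp_sub]
          refine (ContinuousLinearMap.opNorm_comp_le _ _).trans ?_
          gcongr
          exact h.bound t ht _)
        (fun L => (hφ.continuousOn_deriv h hs z).clm_comp continuousOn_const) hs
        (ContinuousLinearMap.id ℝ E)
      exact ⟨γ, fun _ => hγ⟩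
    -- A junk curve for `s` outside `[0,T]`, so that the choice below is total in `s`.
    · exact ⟨0, fun hs' => absurd hs' hs⟩
  choose D hD using key
  exact ⟨fun t s z => D s z t, ⟨fun s hs z => (hD s z hs).1, fun s hs z => (hD s z hs).2⟩⟩

namespace IsLinearizedFlow

variable {D : ℝ → ℝ → E → E →L[ℝ] E} (hD : IsLinearizedFlow D φ f' T) (hφ : IsFlowOn φ f T)
  (h : IsC1Field f f' T M)
include hD h

theorem norm_le {s t : ℝ} (hs : s ∈ Icc 0 T) (ht : t ∈ Icc s T) (z : E) :
    ‖D t s z‖ ≤ Real.exp (M * T) := by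
  have hsub : Icc s T ⊆ Icc 0 T := Icc_subset_Icc_left hs.1
  have := norm_le_of_hasDerivWithinAt_Icc (u := fun τ => D τ s z)
    (u' := fun τ => (f' τ (φ τ s z)).comp (D τ s z)) (δ := 1) h.nonneg le_rfl
    (fun τ hτ => (hD.deriv s hs z τ (hsub hτ)).mono hsub)
    (by rw [hD.self s hs]; exact ContinuousLinearMap.norm_id_le)
    (fun τ hτ => by
      rw [add_zero]
      refine (ContinuousLinearMap.opNorm_comp_le _ _).trans ?_
      gcongr
      exact h.bound τ (hsub hτ) _) t ht
  have hM := h.nonneg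
  refine this.trans ?_
  rw [zero_mul, add_zero, one_mul]
  gcongr
  linarith [hs.1]

include hφ

/-- Grönwall for the remainder `φ(w) - φ(z) - D(w - z)`: it vanishes at time `s` and satisfies the
linearized equation up to the first-order Taylor error of `f`, which uniform continuity of `f'`
makes small compared with `‖w - z‖`. -/
theorem hasFDerivAt {s t : ℝ} (hs : s ∈ Icc 0 T) (ht : t ∈ Icc s T) (z : E) :
    HasFDerivAt (φ t s) (D t s z) z := by
  have hsub : Icc s T ⊆ Icc 0 T := Icc_subset_Icc_left hs.1
  have hT : 0 ≤ T := hs.1.trans hs.2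
  have hM := h.nonneg
  set C := Real.exp (M * T) with hC
  have hC0 : 0 < C := Real.exp_pos _
  rw [hasFDerivAt_iff_isLittleO, Asymptotics.isLittleO_iff]
  intro c hc
  -- Chosen so that the final Grönwall bound is `c * ‖w - z‖`; `T + 1` replaces `T` to keep the
  -- denominator positive.
  set e := c / ((T + 1) * C * C) with he
  have he0 : 0 < e := by positivity
  obtain ⟨δ, hδ, hmod⟩ := h.unif e he0
  -- Trajectories separate by a factor of at most `C`, so starting within `δ / C` keeps them within
  -- `δ` up to time `T`.
  filter_upwards [Metric.ball_mem_nhds z (div_pos hδ hC0)] with w hw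
  rw [Metric.mem_ball, dist_eq_norm, lt_div_iff₀ hC0] at hw
  have key := norm_le_of_hasDerivWithinAt_Icc
    (u := fun τ => φ τ s w - φ τ s z - D τ s z (w - z))
    (u' := fun τ => f τ (φ τ s w) - f τ (φ τ s z) - (f' τ (φ τ s z)).comp (D τ s z) (w - z))
    (δ := 0) (ε := e * (‖w - z‖ * C)) h.nonneg (by positivity)
    (fun τ hτ => ((((hφ.curve s hs w).mono hsub) τ hτ).sub (((hφ.curve s hs z).mono hsub) τ hτ)).sub
      (((hD.deriv s hs z τ (hsub hτ)).mono hsub).clm_apply (hasDerivWithinAt_const _ _ _) |>.congr_deriv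
        (by simp)))
    (by simp [hφ.self s hs, hD.self s hs])
    (fun τ hτ => by
      have hd := hφ.norm_sub_le h hs hτ z w
      have h1 : ‖f τ (φ τ s w) - f τ (φ τ s z) - f' τ (φ τ s z) (φ τ s w - φ τ s z)‖
          ≤ e * ‖φ τ s w - φ τ s z‖ := by
        refine (convex_ball (φ τ s z) δ).norm_image_sub_le_of_norm_hasFDerivWithin_le'
          (fun x _ => (h.hasFDerivAt τ (hsub hτ) x).hasFDerivWithinAt) (fun x hx => ?_)
          (Metric.mem_ball_self hδ) ?_
        · exact hmod τ (hsub hτ) τ (hsub hτ) (by simpa using hδ) _ _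
            (by simpa [dist_eq_norm] using hx)
        · rw [Metric.mem_ball, dist_eq_norm]; exact hd.trans_lt hw
      have h2 : f τ (φ τ s w) - f τ (φ τ s z) - (f' τ (φ τ s z)).comp (D τ s z) (w - z)
          = f' τ (φ τ s z) (φ τ s w - φ τ s z - D τ s z (w - z)) +
            (f τ (φ τ s w) - f τ (φ τ s z) - f' τ (φ τ s z) (φ τ s w - φ τ s z)) := by
        simp only [map_sub, ContinuousLinearMap.comp_apply]; abel
      rw [h2]
      refine (norm_add_le _ _).trans (add_le_add ?_ (h1.trans ?_))
      · exact (f' τ (φ τ s z)).le_of_opNorm_le (h.bound τ (hsub hτ) _) _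
      · gcongr) t ht
  refine key.trans ?_
  have h3 : Real.exp (M * (T - s)) ≤ C := by
    rw [hC]; gcongr; linarith [hs.1]
  have h4 : (T - s) ≤ T + 1 := by linarith [hs.1]
  have h5 : 0 ≤ T - s := by linarith [hs.2]
  calc (0 + e * (‖w - z‖ * C) * (T - s)) * Real.exp (M * (T - s))
      ≤ (0 + e * (‖w - z‖ * C) * (T + 1)) * C := by gcongr
    _ = c * ‖w - z‖ := by rw [he]; field_simp; ring

/-- The same Grönwall argument for the difference of two solutions of the variational equation; the
forcing term is the variation of `f'` between the two trajectories. -/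
theorem continuous {s t : ℝ} (hs : s ∈ Icc 0 T) (ht : t ∈ Icc s T) : Continuous (D t s) := by
  have hsub : Icc s T ⊆ Icc 0 T := Icc_subset_Icc_left hs.1
  have hT : 0 ≤ T := hs.1.trans hs.2
  have hM := h.nonneg
  set C := Real.exp (M * T) with hC
  have hC0 : 0 < C := Real.exp_pos _
  rw [Metric.continuous_iff']
  intro z c hc
  set e := c / 2 / ((T + 1) * C * C) with he
  have he0 : 0 < e := by positivity
  obtain ⟨δ, hδ, hmod⟩ := h.unif e he0
  filter_upwards [Metric.ball_mem_nhds z (div_pos hδ hC0)] with w hw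
  rw [Metric.mem_ball, dist_eq_norm, lt_div_iff₀ hC0] at hw
  have key := norm_le_of_hasDerivWithinAt_Icc
    (u := fun τ => D τ s w - D τ s z)
    (u' := fun τ => (f' τ (φ τ s w)).comp (D τ s w) - (f' τ (φ τ s z)).comp (D τ s z))
    (δ := 0) (ε := e * C) h.nonneg (by positivity)
    (fun τ hτ => ((hD.deriv s hs w τ (hsub hτ)).mono hsub).sub
      ((hD.deriv s hs z τ (hsub hτ)).mono hsub))
    (by simp [hD.self s hs])
    (fun τ hτ => by
      have h2 : (f' τ (φ τ s w)).comp (D τ s w) - (f' τ (φ τ s z)).comp (D τ s z) =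
          (f' τ (φ τ s z)).comp (D τ s w - D τ s z) +
            (f' τ (φ τ s w) - f' τ (φ τ s z)).comp (D τ s w) := by
        simp only [ContinuousLinearMap.comp_sub, ContinuousLinearMap.sub_comp]; abel
      rw [h2]
      refine (norm_add_le _ _).trans (add_le_add ?_ ?_)
      · refine (ContinuousLinearMap.opNorm_comp_le _ _).trans ?_
        gcongr
        exact h.bound τ (hsub hτ) _
      · refine (ContinuousLinearMap.opNorm_comp_le _ _).trans ?_
        gcongr
        · exact hmod τ (hsub hτ) τ (hsub hτ) (by simpa using hδ) _ _
            ((hφ.norm_sub_le h hs hτ z w).trans_lt hw)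
        · exact hD.norm_le h hs hτ w) t ht
  rw [dist_eq_norm]
  refine key.trans_lt ?_
  have h3 : Real.exp (M * (T - s)) ≤ C := by
    rw [hC]; gcongr; linarith [hs.1]
  have h4 : (T - s) ≤ T + 1 := by linarith [hs.1]
  have h5 : 0 ≤ T - s := by linarith [hs.2]
  calc (0 + e * C * (T - s)) * Real.exp (M * (T - s))
      ≤ (0 + e * C * (T + 1)) * C := by gcongr
    _ = c / 2 := by rw [he]; field_simp; ring
    _ < c := by linarith

theorem contDiff {s t : ℝ} (hs : s ∈ Icc 0 T) (ht : t ∈ Icc s T) : ContDiff ℝ 1 (φ t s) :=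
  contDiff_one_iff_hasFDerivAt.2 ⟨D t s, hD.continuous hφ h hs ht, hD.hasFDerivAt hφ h hs ht⟩

end IsLinearizedFlow

end FlowC1

/-! ### Compactness modulo translations, and slices of functions on `[0,T] × E` -/

section Regularity

/-- Subtracting integer parts moves any point into the unit cube, which lies in the ball of radius
`√k`. -/
theorem exists_norm_add_intVec_le (k : ℕ) :
    ∃ ρ : ℝ, 0 ≤ ρ ∧ ∀ x : EucSp k, ∃ m : Fin k → ℤ, ‖x + intVec m‖ ≤ ρ := by
  refine ⟨Real.sqrt k, Real.sqrt_nonneg _, fun x => ⟨fun i => -⌊x i⌋, ?_⟩⟩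
  rw [EuclideanSpace.norm_eq]
  apply Real.sqrt_le_sqrt
  have h : ∀ i ∈ Finset.univ, ‖(x + intVec fun i => -⌊x i⌋ : EucSp k) i‖ ^ 2 ≤ (1 : ℝ) := by
    intro i _
    have h1 : (x + intVec fun i => -⌊x i⌋ : EucSp k) i = Int.fract (x i) := by
      simp [intVec, Int.fract, sub_eq_add_neg]
    rw [h1, Real.norm_eq_abs, sq_abs]
    nlinarith [Int.fract_nonneg (x i), Int.fract_lt_one (x i)]
  simpa using Finset.sum_le_sum h

variable {k : ℕ} {G : Type*} [NormedAddCommGroup G]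

theorem exists_bound_of_periodic {g : ℝ → EucSp k × EucSp k → G} {T R : ℝ}
    (hg : ContinuousOn (fun q : ℝ × EucSp k × EucSp k => g q.1 q.2) (Icc 0 T ×ˢ univ))
    (hper : ∀ t ∈ Icc 0 T, ∀ m z, g t (z + (intVec m, 0)) = g t z)
    (hR : ∀ t ∈ Icc 0 T, ∀ z : EucSp k × EucSp k, R < ‖z.2‖ → g t z = 0) :
    ∃ M, 0 ≤ M ∧ ∀ t ∈ Icc 0 T, ∀ z, ‖g t z‖ ≤ M := by
  obtain ⟨ρ, hρ, hm⟩ := exists_norm_add_intVec_le k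
  obtain ⟨C, hC⟩ := (isCompact_Icc.prod (isCompact_closedBall (0 : EucSp k × EucSp k)
    (max ρ R))).exists_bound_of_continuousOn (hg.mono (prod_mono_right (subset_univ _)))
  refine ⟨max C 0, le_max_right _ _, fun t ht z => ?_⟩
  rcases lt_or_ge R ‖z.2‖ with h | h
  · simp [hR t ht z h]
  · obtain ⟨m, hm⟩ := hm z.1
    rw [← hper t ht m z]
    refine (hC (t, z + (intVec m, 0)) ⟨ht, ?_⟩).trans (le_max_left _ _)
    rw [mem_closedBall_zero_iff, Prod.norm_def]
    exact max_le_max hm (by simpa using h)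

/-- Both points are translated by the same integer vector, so their difference is unchanged, and
Heine–Cantor is applied on a ball. Outside it both values vanish: the margin `1` in `R + 1` and in
the radius covers the distance between the two points. -/
theorem uniform_of_periodic {g : ℝ → EucSp k × EucSp k → G} {T R : ℝ}
    (hg : ContinuousOn (fun q : ℝ × EucSp k × EucSp k => g q.1 q.2) (Icc 0 T ×ˢ univ))
    (hper : ∀ t ∈ Icc 0 T, ∀ m z, g t (z + (intVec m, 0)) = g t z)
    (hR : ∀ t ∈ Icc 0 T, ∀ z : EucSp k × EucSp k, R < ‖z.2‖ → g t z = 0) :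
    ∀ ε > 0, ∃ δ > 0, ∀ t ∈ Icc 0 T, ∀ t' ∈ Icc 0 T, |t - t'| < δ → ∀ z w, ‖z - w‖ < δ →
      ‖g t z - g t' w‖ ≤ ε := by
  intro ε hε
  obtain ⟨ρ, hρ, hm⟩ := exists_norm_add_intVec_le k
  have hu := (isCompact_Icc.prod (isCompact_closedBall (0 : EucSp k × EucSp k)
    (max ρ (R + 1) + 1))).uniformContinuousOn_of_continuous
      (hg.mono (prod_mono_right (subset_univ _)))
  obtain ⟨δ, hδ, hu⟩ := Metric.uniformContinuousOn_iff.1 hu ε hε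
  refine ⟨min δ 1, by positivity, fun t ht t' ht' htt z w hzw => ?_⟩
  have hzw1 : ‖z - w‖ < 1 := hzw.trans_le (min_le_right _ _)
  have h2 : ‖z.2 - w.2‖ ≤ ‖z - w‖ := norm_snd_le (z - w)
  rcases lt_or_ge (R + 1) ‖z.2‖ with h | h
  · have h3 := norm_sub_norm_le z.2 w.2
    rw [hR t ht z (by linarith), hR t' ht' w (by linarith)]
    simpa using hε.le
  · obtain ⟨m, hm⟩ := hm z.1
    rw [← hper t ht m z, ← hper t' ht' m w, ← dist_eq_norm]
    have hz : ‖z + (intVec m, 0)‖ ≤ max ρ (R + 1) := by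
      rw [Prod.norm_def]
      exact max_le_max hm (by simpa using h)
    have he : z + (intVec m, (0 : EucSp k)) - (w + (intVec m, 0)) = z - w := by abel
    refine (hu (t, z + (intVec m, 0)) ⟨ht, ?_⟩ (t', w + (intVec m, 0)) ⟨ht', ?_⟩ ?_).le
    · rw [mem_closedBall_zero_iff]; linarith
    · rw [mem_closedBall_zero_iff]
      have := norm_sub_norm_le (w + (intVec m, (0 : EucSp k))) (z + (intVec m, 0))
      rw [norm_sub_rev, he] at this
      change ‖w + (intVec m, (0 : EucSp k))‖ ≤ _
      linarith
    · rw [Prod.dist_eq, max_lt_iff]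
      refine ⟨(by simpa [Real.dist_eq] using htt.trans_le (min_le_left _ _)), ?_⟩
      change dist (z + (intVec m, (0 : EucSp k))) (w + (intVec m, 0)) < δ
      rw [dist_eq_norm, he]
      exact hzw.trans_le (min_le_left _ _)

/-- At `t = 0` and `t = T` the regularity in `t` is one-sided only. The space direction is open in
the domain, so the restriction of `fderivWithin` to it is a genuine derivative of the slice. -/
theorem ContDiffOn.fderiv_slice {E F : Type*} [NormedAddCommGroup E] [NormedSpace ℝ E]
    [NormedAddCommGroup F] [NormedSpace ℝ F] {g : ℝ → E → F} {T : ℝ} (hT : 0 < T) {n : WithTop ℕ∞}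
    (hg : ContDiffOn ℝ (n + 1) (fun q : ℝ × E => g q.1 q.2) (Icc 0 T ×ˢ univ)) :
    (∀ t ∈ Icc 0 T, Differentiable ℝ (g t)) ∧
      ContDiffOn ℝ n (fun q : ℝ × E => fderiv ℝ (g q.1) q.2) (Icc 0 T ×ˢ univ) := by
  have hU : UniqueDiffOn ℝ (Icc 0 T ×ˢ (univ : Set E)) :=
    (uniqueDiffOn_Icc hT).prod uniqueDiffOn_univ
  have key : ∀ t ∈ Icc 0 T, ∀ z : E, HasFDerivAt (g t)
      ((fderivWithin ℝ (fun q : ℝ × E => g q.1 q.2) (Icc 0 T ×ˢ univ) (t, z)).comp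
        (ContinuousLinearMap.inr ℝ ℝ E)) z := by
    intro t ht z
    have h1 := (hg.differentiableOn (by simp) (t, z) ⟨ht, mem_univ _⟩).hasFDerivWithinAt
    have h2 : HasFDerivWithinAt (fun w : E => (t, w)) (ContinuousLinearMap.inr ℝ ℝ E) univ z :=
      (hasFDerivAt_prodMk_right t z).hasFDerivWithinAt
    exact (h1.comp z h2 (fun w _ => ⟨ht, mem_univ _⟩)).hasFDerivAt_of_univ
  refine ⟨fun t ht z => (key t ht z).differentiableAt, ?_⟩
  have h3 : ContDiffOn ℝ n (fun q => (fderivWithin ℝ (fun q : ℝ × E => g q.1 q.2)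
      (Icc 0 T ×ˢ univ) q).comp (ContinuousLinearMap.inr ℝ ℝ E)) (Icc 0 T ×ˢ univ) :=
    (hg.fderivWithin hU le_rfl).clm_comp contDiffOn_const
  exact h3.congr fun q hq => (key q.1 hq.1 q.2).fderiv

end Regularity

/-! ### The Hamiltonian field as a kinetic part plus a bounded perturbation -/

section HamField

variable {k : ℕ}

/-- The Hamiltonian vector field of `H`. -/
noncomputable def hamField (H : ℝ → EucSp k → EucSp k → ℝ) (t : ℝ) (z : EucSp k × EucSp k) :
    EucSp k × EucSp k :=
  (gradient (fun p => H t z.1 p) z.2, - gradient (fun x => H t x z.2) z.1)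

/-- The vector `(X₁, X₂)` with `D = ⟨X₁, dp⟩ - ⟨X₂, dx⟩`. -/
noncomputable def sympGrad : (EucSp k × EucSp k →L[ℝ] ℝ) →L[ℝ] EucSp k × EucSp k :=
  LinearMap.toContinuousLinearMap
    { toFun := fun D =>
        ((InnerProductSpace.toDual ℝ _).symm (D.comp (ContinuousLinearMap.inr ℝ _ _)),
          - (InnerProductSpace.toDual ℝ _).symm (D.comp (ContinuousLinearMap.inl ℝ _ _)))
      map_add' := fun D D' => by
        simp [ContinuousLinearMap.add_comp, add_comm]
      map_smul' := fun c D => by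
        simp [ContinuousLinearMap.smul_comp] }

theorem sympGrad_apply (D : EucSp k × EucSp k →L[ℝ] ℝ) :
    sympGrad D = ((InnerProductSpace.toDual ℝ _).symm (D.comp (ContinuousLinearMap.inr ℝ _ _)),
          - (InnerProductSpace.toDual ℝ _).symm (D.comp (ContinuousLinearMap.inl ℝ _ _))) := rfl

/-- The linear form `h ↦ ⟨X₁, h₂⟩ - ⟨X₂, h₁⟩`. -/
noncomputable def sympForm (X : EucSp k × EucSp k) : EucSp k × EucSp k →L[ℝ] ℝ :=
  (innerSL ℝ X.1).comp (ContinuousLinearMap.snd ℝ _ _) -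
    (innerSL ℝ X.2).comp (ContinuousLinearMap.fst ℝ _ _)

theorem sympForm_apply (X h : EucSp k × EucSp k) :
    sympForm X h = inner ℝ X.1 h.2 - inner ℝ X.2 h.1 := rfl

theorem sympForm_sympGrad (D : EucSp k × EucSp k →L[ℝ] ℝ) : sympForm (sympGrad D) = D := by
  refine ContinuousLinearMap.ext fun h => ?_
  rw [sympForm_apply, sympGrad_apply]
  simp only [InnerProductSpace.toDual_symm_apply, inner_neg_left, sub_neg_eq_add]
  simp only [ContinuousLinearMap.comp_apply, ContinuousLinearMap.inl_apply,
    ContinuousLinearMap.inr_apply]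
  rw [← map_add]
  simp

theorem sympGrad_sympForm (X : EucSp k × EucSp k) : sympGrad (sympForm X) = X := by
  refine Prod.ext (ext_inner_right ℝ fun v => ?_) (ext_inner_right ℝ fun v => ?_)
  · rw [sympGrad_apply]; simp [sympForm_apply]
  · rw [sympGrad_apply]; simp [sympForm_apply]

theorem hamField_eq_sympGrad {H : ℝ → EucSp k → EucSp k → ℝ} {t : ℝ} {z : EucSp k × EucSp k}
    {D : EucSp k × EucSp k →L[ℝ] ℝ}
    (h : HasFDerivAt (fun z : EucSp k × EucSp k => H t z.1 z.2) D z) :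
    hamField H t z = sympGrad D := by
  have h1 : HasFDerivAt (fun p => H t z.1 p) (D.comp (ContinuousLinearMap.inr ℝ _ _)) z.2 :=
    HasFDerivAt.comp (f := fun p => (z.1, p)) z.2 h (hasFDerivAt_prodMk_right z.1 z.2)
  have h2 : HasFDerivAt (fun x => H t x z.2) (D.comp (ContinuousLinearMap.inl ℝ _ _)) z.1 :=
    HasFDerivAt.comp (f := fun x => (x, z.2)) z.1 h (hasFDerivAt_prodMk_left z.1 z.2)
  rw [hamField, sympGrad_apply, gradient, gradient, h1.fderiv, h2.fderiv]

/-- The field `(x,p) ↦ (L p, 0)` of the kinetic energy `½⟨L p, p⟩`. -/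
noncomputable def kinField (L : EucSp k →L[ℝ] EucSp k) :
    EucSp k × EucSp k →L[ℝ] EucSp k × EucSp k :=
  (ContinuousLinearMap.inl ℝ _ _).comp (L.comp (ContinuousLinearMap.snd ℝ _ _))

theorem kinField_apply (L : EucSp k →L[ℝ] EucSp k) (z : EucSp k × EucSp k) :
    kinField L z = (L z.2, 0) := rfl

/-- `H = ½⟨L p, p⟩ + V` with `V` periodic in `x` and vanishing for `R < |p|`; `b` is the
Hamiltonian vector field of `V`. -/
structure IsKineticHam (L : EucSp k →L[ℝ] EucSp k) (H : ℝ → EucSp k → EucSp k → ℝ)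
    (b : ℝ → EucSp k × EucSp k → EucSp k × EucSp k)
    (b' : ℝ → EucSp k × EucSp k → EucSp k × EucSp k →L[ℝ] EucSp k × EucSp k)
    (T R M : ℝ) : Prop where
  pos : 0 < T
  symm : ∀ x y, inner ℝ (L x) y = inner ℝ x (L y)
  hasFDerivAt : ∀ t ∈ Icc 0 T, ∀ z, HasFDerivAt (fun z : EucSp k × EucSp k => H t z.1 z.2)
    (sympForm (kinField L z + b t z)) z
  cont : ContinuousOn (fun q : ℝ × EucSp k × EucSp k => H q.1 q.2.1 q.2.2) (Icc 0 T ×ˢ univ)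
  field : IsC1Field b b' T M
  bound : ∀ t ∈ Icc 0 T, ∀ z, ‖b t z‖ ≤ M
  zero : ∀ t ∈ Icc 0 T, ∀ z : EucSp k × EucSp k, R < ‖z.2‖ → b t z = 0
  zero' : ∀ t ∈ Icc 0 T, ∀ z : EucSp k × EucSp k, R < ‖z.2‖ → b' t z = 0
  value : ∀ t ∈ Icc 0 T, ∀ x p : EucSp k, R < ‖p‖ → H t x p = 1 / 2 * inner ℝ (L p) p
  periodic : ∀ t ∈ Icc 0 T, ∀ m x p, H t (x + intVec m) p = H t x p
  periodic' : ∀ t ∈ Icc 0 T, ∀ m z, b t (z + (intVec m, 0)) = b t z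

/-- Subtracting the kinetic energy shows that `V` itself is `C^2`. Its first and second space
derivatives inherit the periodicity and the vanishing for `|p| > R`, hence are bounded, and the
second one is uniformly continuous; `b` and `b'` are these derivatives rotated by `sympGrad`. -/
theorem exists_isKineticHam {L : EucSp k →L[ℝ] EucSp k} (hL : ∀ x y, inner ℝ (L x) y = inner ℝ x (L y))
    {T : ℝ} (hT : 0 < T) {H V : ℝ → EucSp k → EucSp k → ℝ}
    (hreg : ContDiffOn ℝ 2 (fun q : ℝ × EucSp k × EucSp k => H q.1 q.2.1 q.2.2)
      (Icc 0 T ×ˢ univ))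
    (hform : ∀ t ∈ Icc 0 T, ∀ x p : EucSp k, H t x p = 1 / 2 * inner ℝ (L p) p + V t x p)
    (hper : ∀ t ∈ Icc 0 T, ZPeriodic (V t)) {R : ℝ}
    (hsupp : ∀ t ∈ Icc 0 T, ∀ x p : EucSp k, R < ‖p‖ → V t x p = 0) :
    ∃ b b' M, IsKineticHam L H b b' T R M := by
  let g : ℝ → EucSp k × EucSp k → ℝ := fun t z => V t z.1 z.2
  have hg : ContDiffOn ℝ (1 + 1) (fun q : ℝ × EucSp k × EucSp k => g q.1 q.2)
      (Icc 0 T ×ˢ univ) := by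
    have h1 : ContDiffOn ℝ 2 (fun q : ℝ × EucSp k × EucSp k => H q.1 q.2.1 q.2.2 -
        1 / 2 * inner ℝ (L q.2.2) q.2.2) (Icc 0 T ×ˢ univ) := by
      refine hreg.sub (ContDiff.contDiffOn ?_)
      exact contDiff_const.mul ((L.contDiff.comp (contDiff_snd.comp contDiff_snd)).inner ℝ
        (contDiff_snd.comp contDiff_snd))
    exact h1.congr fun q hq => by simp [g, hform q.1 hq.1]
  obtain ⟨hd1, hg1⟩ := hg.fderiv_slice hT
  -- Only continuity is left after the second derivative, hence `n := 0`.
  obtain ⟨hd2, hg2⟩ := ContDiffOn.fderiv_slice (n := 0) (g := fun t => fderiv ℝ (g t)) hT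
    (by simpa using hg1)
  have hper0 : ∀ t ∈ Icc 0 T, ∀ m, (fun z => g t (z + (intVec m, 0))) = g t := fun t ht m => by
    funext z
    exact (congrFun (hper t ht m z.1) (z.2 + 0)).trans (by simp [g])
  have hper1 : ∀ t ∈ Icc 0 T, ∀ m z, fderiv ℝ (g t) (z + (intVec m, 0)) = fderiv ℝ (g t) z :=
    fun t ht m z => by rw [← fderiv_comp_add_right, hper0 t ht m]
  have hper2 : ∀ t ∈ Icc 0 T, ∀ m z,
      fderiv ℝ (fderiv ℝ (g t)) (z + (intVec m, 0)) = fderiv ℝ (fderiv ℝ (g t)) z :=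
    fun t ht m z => by
      rw [← fderiv_comp_add_right]; congr 1; funext w; exact hper1 t ht m w
  have hopen : IsOpen {z : EucSp k × EucSp k | R < ‖z.2‖} :=
    isOpen_lt continuous_const (by fun_prop)
  have hz1 : ∀ t ∈ Icc 0 T, ∀ z : EucSp k × EucSp k, R < ‖z.2‖ → fderiv ℝ (g t) z = 0 :=
    fun t ht z hz => by
      have : g t =ᶠ[nhds z] fun _ => 0 :=
        Filter.eventually_of_mem (hopen.mem_nhds hz) fun w hw => hsupp t ht w.1 w.2 hw
      rw [this.fderiv_eq]; simp
  have hz2 : ∀ t ∈ Icc 0 T, ∀ z : EucSp k × EucSp k, R < ‖z.2‖ →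
      fderiv ℝ (fderiv ℝ (g t)) z = 0 :=
    fun t ht z hz => by
      have : fderiv ℝ (g t) =ᶠ[nhds z] fun _ => 0 :=
        Filter.eventually_of_mem (hopen.mem_nhds hz) fun w hw => hz1 t ht w hw
      rw [this.fderiv_eq]; simp
  let b : ℝ → EucSp k × EucSp k → EucSp k × EucSp k := fun t z => sympGrad (fderiv ℝ (g t) z)
  let b' : ℝ → EucSp k × EucSp k → EucSp k × EucSp k →L[ℝ] EucSp k × EucSp k :=
    fun t z => (sympGrad (k := k)).comp (fderiv ℝ (fderiv ℝ (g t)) z)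
  have hbc : ContinuousOn (fun q : ℝ × EucSp k × EucSp k => b q.1 q.2) (Icc 0 T ×ˢ univ) :=
    sympGrad.continuous.comp_continuousOn hg1.continuousOn
  have hbc' : ContinuousOn (fun q : ℝ × EucSp k × EucSp k => b' q.1 q.2) (Icc 0 T ×ˢ univ) :=
    continuousOn_const.clm_comp hg2.continuousOn
  have hbz : ∀ t ∈ Icc 0 T, ∀ z : EucSp k × EucSp k, R < ‖z.2‖ → b t z = 0 :=
    fun t ht z hz => by simp [b, hz1 t ht z hz]
  have hbz' : ∀ t ∈ Icc 0 T, ∀ z : EucSp k × EucSp k, R < ‖z.2‖ → b' t z = 0 :=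
    fun t ht z hz => by simp [b', hz2 t ht z hz]
  have hbp : ∀ t ∈ Icc 0 T, ∀ m z, b t (z + (intVec m, 0)) = b t z :=
    fun t ht m z => by simp only [b, hper1 t ht m z]
  have hbp' : ∀ t ∈ Icc 0 T, ∀ m z, b' t (z + (intVec m, 0)) = b' t z :=
    fun t ht m z => by simp only [b', hper2 t ht m z]
  obtain ⟨M₁, hM₁, hb₁⟩ := exists_bound_of_periodic hbc hbp hbz
  obtain ⟨M₂, hM₂, hb₂⟩ := exists_bound_of_periodic hbc' hbp' hbz'
  refine ⟨b, b', max M₁ M₂, ?_⟩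
  exact
    { pos := hT
      symm := hL
      hasFDerivAt := fun t ht z => by
        have h1 : HasFDerivAt (fun z : EucSp k × EucSp k => 1 / 2 * inner ℝ (L z.2) z.2)
            (sympForm (kinField L z)) z := by
          have h2 : HasFDerivAt (fun z : EucSp k × EucSp k => L z.2)
              (L.comp (ContinuousLinearMap.snd ℝ _ _)) z :=
            HasFDerivAt.comp (g := L) z L.hasFDerivAt hasFDerivAt_snd
          have h3 : HasFDerivAt (fun z : EucSp k × EucSp k => z.2)
              (ContinuousLinearMap.snd ℝ _ _) z := hasFDerivAt_snd
          refine ((h2.inner ℝ h3).const_mul (1 / 2)).congr_fderiv ?_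
          refine ContinuousLinearMap.ext fun v => ?_
          simp [sympForm_apply, kinField_apply, fderivInnerCLM_apply, hL]
          rw [real_inner_comm, hL]; ring
        have h4 : HasFDerivAt (g t) (sympForm (b t z)) z := by
          simp only [b, sympForm_sympGrad]
          exact (hd1 t ht z).hasFDerivAt
        have h5 : (fun z : EucSp k × EucSp k => H t z.1 z.2) =
            fun z => 1 / 2 * inner ℝ (L z.2) z.2 + g t z := by
          funext z; exact hform t ht z.1 z.2
        rw [h5]
        refine (h1.add h4).congr_fderiv ?_
        refine ContinuousLinearMap.ext fun v => ?_
        simp [sympForm_apply, inner_add_left]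
        ring
      cont := hreg.continuousOn
      field :=
        { nonneg := hM₁.trans (le_max_left _ _)
          hasFDerivAt := fun t ht z =>
            sympGrad.hasFDerivAt.comp z ((hd2 t ht z).hasFDerivAt)
          bound := fun t ht z => (hb₂ t ht z).trans (le_max_right _ _)
          cont := hbc
          cont' := hbc'
          unif := uniform_of_periodic hbc' hbp' hbz' }
      bound := fun t ht z => (hb₁ t ht z).trans (le_max_left _ _)
      zero := hbz
      zero' := hbz'
      value := fun t ht x p hp => by rw [hform t ht, hsupp t ht x p hp, add_zero]
      periodic := fun t ht m x p => by
        rw [hform t ht, hform t ht]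
        congr 1
        exact congrFun (hper t ht m x) p
      periodic' := hbp }

end HamField

/-! ### Lipschitz perturbations of the identity and fibered diffeomorphisms -/

section InverseFunction

/-- Solving `x + d x = y` is finding the fixed point of the contraction `x ↦ y - d x`. -/
theorem bijective_id_add_of_lipschitz {F : Type*} [NormedAddCommGroup F] [CompleteSpace F]
    {d : F → F} (hd : ∀ x y, ‖d x - d y‖ ≤ 1 / 2 * ‖x - y‖) :
    Function.Bijective fun x => x + d x := by
  refine ⟨fun x y hxy => ?_, fun y => ?_⟩
  · have h1 : x - y = -(d x - d y) := by
      have : x + d x = y + d y := hxy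
      rw [neg_sub, sub_eq_sub_iff_add_eq_add, this, add_comm]
    have h2 := hd x y
    rw [← norm_neg (d x - d y), ← h1] at h2
    exact sub_eq_zero.1 (norm_eq_zero.1 (by linarith [norm_nonneg (x - y)]))
  · have hc : ContractingWith (1 / 2) fun x => y - d x := by
      refine ⟨by rw [← NNReal.coe_lt_coe]; norm_num, LipschitzWith.of_dist_le_mul fun a b => ?_⟩
      rw [dist_eq_norm, dist_eq_norm, sub_sub_sub_cancel_left, norm_sub_rev]
      simpa using hd a b
    exact ⟨hc.fixedPoint, by
      have := hc.fixedPoint_isFixedPt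
      rw [Function.IsFixedPt] at this
      simp only
      nth_rw 1 [← this]
      abel⟩

/-- The expansion passes to difference quotients along a line and then to the limit. For `c > 0` it
makes the derivative injective. -/
theorem HasFDerivAt.le_norm_of_expanding {F G : Type*} [NormedAddCommGroup F] [NormedSpace ℝ F]
    [NormedAddCommGroup G] [NormedSpace ℝ G] {g : F → G} {A : F →L[ℝ] G} {y : F}
    (h : HasFDerivAt g A y) {c : ℝ} (hc : ∀ y y', c * ‖y - y'‖ ≤ ‖g y - g y'‖) (w : F) :
    c * ‖w‖ ≤ ‖A w‖ := by
  have h1 : HasDerivAt (fun t : ℝ => g (y + t • w)) (A w) 0 := h.hasLineDerivAt w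
  refine ge_of_tendsto h1.tendsto_slope_zero.norm ?_
  filter_upwards [self_mem_nhdsWithin] with t ht
  have h2 := hc (y + (0 + t) • w) (y + (0 : ℝ) • w)
  have ht0 : 0 < |t| := abs_pos.2 ht
  rw [norm_smul, norm_inv, Real.norm_eq_abs, inv_mul_eq_div, le_div_iff₀ ht0]
  refine le_trans (le_of_eq ?_) h2
  simp [norm_smul]
  ring

variable {E F : Type*} [NormedAddCommGroup E] [NormedSpace ℝ E] [FiniteDimensional ℝ E]
  [NormedAddCommGroup F] [NormedSpace ℝ F] [FiniteDimensional ℝ F]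

/-- In finite dimension an injective endomorphism is invertible, so the inverse function theorem
makes the bijection open, hence a homeomorphism, and its inverse is then as smooth as the map. -/
theorem Equiv.contDiff_symm_of_injective_fderiv (e : E ≃ E) (he : ContDiff ℝ 1 e)
    (hinj : ∀ z, Function.Injective (fderiv ℝ e z)) : ContDiff ℝ 1 e.symm := by
  have : CompleteSpace E := FiniteDimensional.complete ℝ E
  let D : E → E ≃L[ℝ] E := fun z =>
    (LinearEquiv.ofInjectiveEndo (fderiv ℝ e z : E →ₗ[ℝ] E) (hinj z)).toContinuousLinearEquiv
  have hD : ∀ z, (D z : E →L[ℝ] E) = fderiv ℝ e z := fun z => by ext; rfl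
  have hs : ∀ z, HasStrictFDerivAt e (D z : E →L[ℝ] E) z := fun z => by
    rw [hD]; exact he.contDiffAt.hasStrictFDerivAt (by simp)
  have ho : IsOpenMap e := isOpenMap_of_hasStrictFDerivAt_equiv hs
  exact (e.toHomeomorphOfIsInducing
    (Topology.IsOpenEmbedding.of_continuous_injective_isOpenMap he.continuous e.injective
      ho).isInducing).contDiff_symm
    (fun z => (hs z).hasFDerivAt) he

/-- The derivative of `(x, y) ↦ (x, g (x, y))` is block triangular with the identity in one corner;
expansion in `y` makes the other diagonal block injective. The expansion constant may depend on `x`,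
because only pointwise injectivity is needed. -/
theorem exists_fibered_equiv {g : E × F → F} (hg : ContDiff ℝ 1 g)
    (hbij : ∀ x, Function.Bijective fun y => g (x, y))
    (hexp : ∀ x, ∃ c > 0, ∀ y y', c * ‖y - y'‖ ≤ ‖g (x, y) - g (x, y')‖) :
    ∃ e : E × F ≃ E × F, (∀ z, e z = (z.1, g z)) ∧ ContDiff ℝ 1 e ∧ ContDiff ℝ 1 e.symm := by
  have hb : Function.Bijective fun z : E × F => (z.1, g z) := by
    refine ⟨fun z w h => ?_, fun z => ?_⟩
    · obtain ⟨x, y⟩ := z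
      obtain ⟨x', y'⟩ := w
      obtain ⟨h1, h2⟩ := Prod.ext_iff.1 h
      obtain rfl : x = x' := h1
      rw [(hbij x).1 h2]
    · obtain ⟨y, hy⟩ := (hbij z.1).2 z.2
      exact ⟨(z.1, y), Prod.ext rfl hy⟩
  have hc : ContDiff ℝ 1 (Equiv.ofBijective _ hb) := contDiff_fst.prodMk hg
  refine ⟨Equiv.ofBijective _ hb, fun _ => rfl, hc,
    Equiv.contDiff_symm_of_injective_fderiv _ hc fun z => ?_⟩
  have hgz : HasFDerivAt g (fderiv ℝ g z) z := (hg.differentiable (by simp) z).hasFDerivAt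
  have hd : HasFDerivAt (Equiv.ofBijective _ hb)
      ((ContinuousLinearMap.fst ℝ E F).prod (fderiv ℝ g z)) z := hasFDerivAt_fst.prodMk hgz
  rw [hd.fderiv, injective_iff_map_eq_zero]
  rintro ⟨v, w⟩ hvw
  obtain ⟨h1, h2⟩ := Prod.ext_iff.1 hvw
  obtain rfl : v = 0 := h1
  obtain ⟨c, hc0, hc⟩ := hexp z.1
  have h3 : HasFDerivAt (fun y => g (z.1, y))
      ((fderiv ℝ g z).comp (ContinuousLinearMap.inr ℝ E F)) z.2 :=
    HasFDerivAt.comp (f := fun y => (z.1, y)) z.2 hgz (hasFDerivAt_prodMk_right z.1 z.2)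
  have h4 := h3.le_norm_of_expanding hc w
  have h5 : ((fderiv ℝ g z).comp (ContinuousLinearMap.inr ℝ E F)) w = 0 := h2
  rw [h5, norm_zero] at h4
  have : ‖w‖ = 0 := le_antisymm (by nlinarith [norm_nonneg w]) (norm_nonneg w)
  rw [norm_eq_zero.1 this]; rfl

end InverseFunction

/-! ### The Hamiltonian flow and the short-time twist property -/

section HamFlow

variable {k : ℕ} {L : EucSp k →L[ℝ] EucSp k} {H : ℝ → EucSp k → EucSp k → ℝ}
  {b : ℝ → EucSp k × EucSp k → EucSp k × EucSp k}
  {b' : ℝ → EucSp k × EucSp k → EucSp k × EucSp k →L[ℝ] EucSp k × EucSp k}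
  {T R M : ℝ}

namespace IsKineticHam

variable (h : IsKineticHam L H b b' T R M)
include h

theorem nonneg : 0 ≤ M := h.field.nonneg

theorem hamField_eq {t : ℝ} (ht : t ∈ Icc 0 T) (z : EucSp k × EucSp k) :
    hamField H t z = kinField L z + b t z :=
  (hamField_eq_sympGrad (h.hasFDerivAt t ht z)).trans (sympGrad_sympForm _)

theorem isC1Field :
    IsC1Field (hamField H) (fun t z => kinField L + b' t z) T (‖kinField L‖ + M) where
  nonneg := add_nonneg (norm_nonneg _) h.nonneg
  hasFDerivAt t ht z := by
    have : hamField H t = fun z => kinField L z + b t z := funext fun z => h.hamField_eq ht z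
    rw [this]
    exact (kinField L).hasFDerivAt.add (h.field.hasFDerivAt t ht z)
  bound t ht z := (norm_add_le _ _).trans (add_le_add le_rfl (h.field.bound t ht z))
  cont := by
    have h1 : ContinuousOn (fun q : ℝ × EucSp k × EucSp k => kinField L q.2) (Icc 0 T ×ˢ univ) :=
      ((kinField L).continuous.comp continuous_snd).continuousOn
    have h2 := h1.add h.field.cont
    exact h2.congr fun q hq => h.hamField_eq hq.1 q.2
  cont' := continuousOn_const.add h.field.cont'
  unif ε hε := by
    obtain ⟨δ, hδ, hu⟩ := h.field.unif ε hε
    exact ⟨δ, hδ, fun t ht t' ht' htt z w hzw => by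
      simpa using hu t ht t' ht' htt z w hzw⟩

theorem hamComplete : HamComplete H T := fun _ hs z =>
  ⟨h.isC1Field.exists_curve hs z, fun _ _ h₁ h₂ e₁ e₂ =>
    h.isC1Field.eqOn hs h₁ h₂ (e₁.trans e₂.symm)⟩

theorem isFlowOn : IsFlowOn (hamFlow H T) (hamField H) T := by
  have key : ∀ s ∈ Icc 0 T, ∀ z, ∃ γ, (fun t => hamFlow H T t s z) = γ ∧
      IsIntegralCurveOn γ (hamField H) (Icc 0 T) ∧ γ s = z := by
    intro s hs z
    have hex : ∃ γ, IsHamTrajectory H T γ ∧ γ s = z := h.isC1Field.exists_curve hs z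
    -- The curve chosen in `hamFlow` depends on `s` and `z` but not on `t`, so the flow is this
    -- single curve for all times.
    exact ⟨hex.choose, by funext t; simp only [hamFlow, dif_pos hex], hex.choose_spec⟩
  constructor
  · intro s hs z
    obtain ⟨γ, e, h1, -⟩ := key s hs z
    rw [e]; exact h1
  · intro s hs z
    obtain ⟨γ, e, -, h2⟩ := key s hs z
    exact (congrFun e s).trans h2

theorem hamFlow_eq {γ : ℝ → EucSp k × EucSp k} {s t : ℝ} (hs : s ∈ Icc 0 T) (ht : t ∈ Icc 0 T)
    (hγ : IsIntegralCurveOn γ (hamField H) (Icc 0 T)) : hamFlow H T t s (γ s) = γ t :=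
  h.isC1Field.eqOn hs (h.isFlowOn.curve s hs _) hγ (h.isFlowOn.self s hs _) ht

/-- A translate of a trajectory by an integer vector is again a trajectory, and trajectories are
unique. -/
theorem hamFlow_add_intVec {s t : ℝ} (hs : s ∈ Icc 0 T) (ht : t ∈ Icc 0 T) (m : Fin k → ℤ)
    (z : EucSp k × EucSp k) :
    hamFlow H T t s (z + (intVec m, 0)) = hamFlow H T t s z + (intVec m, 0) := by
  have h1 : IsIntegralCurveOn (fun τ => hamFlow H T τ s z + (intVec m, 0)) (hamField H)
      (Icc 0 T) := by
    intro τ hτ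
    have h2 := h.isFlowOn.curve s hs z τ hτ
    rw [h.hamField_eq hτ] at h2 ⊢
    rw [h.periodic' τ hτ]
    have h3 : kinField L (hamFlow H T τ s z + (intVec m, 0)) = kinField L (hamFlow H T τ s z) := by
      simp [kinField_apply]
    rw [h3]
    exact h2.add_const _
  have h4 := h.hamFlow_eq hs ht h1
  simp only [h.isFlowOn.self s hs] at h4
  exact h4

/-- The free motion keeps its momentum, so it never enters the region where `V` acts and is a
trajectory on the whole interval. -/
theorem hamFlow_of_lt {s t : ℝ} (hs : s ∈ Icc 0 T) (ht : t ∈ Icc 0 T) {z : EucSp k × EucSp k}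
    (hz : R < ‖z.2‖) : hamFlow H T t s z = (z.1 + (t - s) • L z.2, z.2) := by
  have h1 : IsIntegralCurveOn (fun τ => (z.1 + (τ - s) • L z.2, z.2)) (hamField H)
      (Icc 0 T) := by
    intro τ hτ
    have h0 := h.zero τ hτ (z.1 + (τ - s) • L z.2, z.2) hz
    rw [h.hamField_eq hτ, h0, add_zero, kinField_apply]
    refine HasDerivAt.hasDerivWithinAt (HasDerivAt.prodMk ?_ (hasDerivAt_const _ _))
    simpa using (((hasDerivAt_id τ).sub_const s).smul_const (L z.2)).const_add z.1
  have h2 := h.hamFlow_eq hs ht h1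
  simpa using h2

/-- The kinetic part has no momentum component, so the momentum is driven by `b` alone; this is why
the bound does not depend on the size of `z`. -/
theorem norm_momentum_sub_le {s t : ℝ} (hs : s ∈ Icc 0 T) (ht : t ∈ Icc s T)
    (z : EucSp k × EucSp k) : ‖(hamFlow H T t s z).2 - z.2‖ ≤ M * (t - s) := by
  have hsub : Icc s T ⊆ Icc 0 T := Icc_subset_Icc_left hs.1
  have := norm_image_sub_le_of_norm_deriv_le_segment' (f := fun τ => (hamFlow H T τ s z).2)
    (f' := fun τ => (hamField H τ (hamFlow H T τ s z)).2) (C := M)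
    (fun τ hτ => (((h.isFlowOn.curve s hs z).mono hsub) τ hτ).snd)
    (fun τ hτ => by
      have hτ' := hsub (Ico_subset_Icc_self hτ)
      rw [h.hamField_eq hτ']
      simpa [kinField_apply] using (norm_snd_le _).trans (h.bound τ hτ' (hamFlow H T τ s z)))
    t ht
  simpa [h.isFlowOn.self s hs] using this

theorem norm_hamFlow_sub_le {s t : ℝ} (hs : s ∈ Icc 0 T) (ht : t ∈ Icc s T)
    (z : EucSp k × EucSp k) :
    ‖hamFlow H T t s z - z‖ ≤ (‖L‖ * (‖z.2‖ + M * T) + M) * (t - s) := by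
  have hsub : Icc s T ⊆ Icc 0 T := Icc_subset_Icc_left hs.1
  have hM := h.nonneg
  have := norm_image_sub_le_of_norm_deriv_le_segment' (f := fun τ => hamFlow H T τ s z)
    (f' := fun τ => hamField H τ (hamFlow H T τ s z)) (C := ‖L‖ * (‖z.2‖ + M * T) + M)
    (fun τ hτ => ((h.isFlowOn.curve s hs z).mono hsub) τ hτ)
    (fun τ hτ => by
      have hτ1 := Ico_subset_Icc_self hτ
      have hτ' := hsub hτ1
      rw [h.hamField_eq hτ']
      refine (norm_add_le _ _).trans (add_le_add ?_ (h.bound τ hτ' _))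
      have h1 : ‖(hamFlow H T τ s z).2‖ ≤ ‖z.2‖ + M * T := by
        have h2 := h.norm_momentum_sub_le hs hτ1 z
        have h3 := norm_sub_norm_le (hamFlow H T τ s z).2 z.2
        have h4 : M * (τ - s) ≤ M * T := by gcongr; linarith [hτ1.2, hs.1]
        linarith
      have h5 : ‖kinField L (hamFlow H T τ s z)‖ = ‖L (hamFlow H T τ s z).2‖ := by
        simp [kinField_apply, Prod.norm_def]
      rw [h5]
      exact (L.le_opNorm _).trans (by gcongr))
    t ht
  simpa [h.isFlowOn.self s hs] using this

/-- Uniformity in `z` is the point, since speeds are unbounded. A fast trajectory has `b' = 0`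
throughout; a slow one moves by at most `C (t - s)`, with `C` depending only on `R`, and uniform
continuity of `b'` applies. -/
theorem exists_norm_deriv_along_sub_le {η : ℝ} (hη : 0 < η) :
    ∃ ε₀ > 0, ∀ s ∈ Icc 0 T, ∀ t ∈ Icc s T, t - s ≤ ε₀ → ∀ z,
      ‖b' t (hamFlow H T t s z) - b' s z‖ ≤ η := by
  obtain ⟨δ, hδ, hu⟩ := h.field.unif η hη
  have hM := h.nonneg
  have hT := h.pos
  set C := ‖L‖ * (max R 0 + M * T) + M with hC
  have hC0 : 0 ≤ C := by positivity
  refine ⟨δ / (2 * (C + 1)), by positivity, fun s hs t ht hts z => ?_⟩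
  have ht' : t ∈ Icc 0 T := ⟨hs.1.trans ht.1, ht.2⟩
  have h0 : 0 ≤ t - s := by linarith [ht.1]
  rw [le_div_iff₀ (by positivity)] at hts
  rcases lt_or_ge R ‖z.2‖ with hz | hz
  · have h1 : b' t (z.1 + (t - s) • L z.2, z.2) = 0 := h.zero' t ht' _ hz
    rw [h.zero' s hs z hz, h.hamFlow_of_lt hs ht' hz, h1]
    simpa using hη.le
  · refine hu t ht' s hs ?_ _ _ ?_
    · rw [abs_of_nonneg h0]; nlinarith
    · refine (h.norm_hamFlow_sub_le hs ht z).trans_lt ?_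
      have : ‖L‖ * (‖z.2‖ + M * T) + M ≤ C := by
        rw [hC]; gcongr; exact hz.trans (le_max_left _ _)
      nlinarith [mul_le_mul_of_nonneg_right this h0]

/-- First-order expansion of the linearized flow, uniform in `s` and `z`. The derivative of the
remainder has two parts, the variation of `b'` along the trajectory and the distance of `D` from the
identity, and each is at most `η / 2` for short times. -/
theorem exists_norm_linearized_sub_le
    {D : ℝ → ℝ → EucSp k × EucSp k → EucSp k × EucSp k →L[ℝ] EucSp k × EucSp k}
    (hD : IsLinearizedFlow D (hamFlow H T) (fun t z => kinField L + b' t z) T)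
    {η : ℝ} (hη : 0 < η) :
    ∃ ε₀ > 0, ∀ s ∈ Icc 0 T, ∀ t ∈ Icc s T, t - s ≤ ε₀ → ∀ z,
      ‖D t s z - ContinuousLinearMap.id ℝ _ - (t - s) • (kinField L + b' s z)‖ ≤ η * (t - s) := by
  set N := ‖kinField L‖ + M with hN
  have hN0 : 0 ≤ N := h.isC1Field.nonneg
  set C := Real.exp (N * T) with hC
  have hC0 : 0 < C := Real.exp_pos _
  obtain ⟨ε₁, hε₁, he⟩ := h.exists_norm_deriv_along_sub_le (η := η / (2 * C)) (by positivity)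
  refine ⟨min ε₁ (η / (2 * (N * (N * C) + 1))), by positivity, fun s hs t ht hts z => ?_⟩
  have hsub : Icc s t ⊆ Icc 0 T := Icc_subset_Icc hs.1 ht.2
  have hsub' : Icc s t ⊆ Icc s T := Icc_subset_Icc_right ht.2
  have hC' : ∀ τ ∈ Icc s t, ‖D τ s z‖ ≤ C := fun τ hτ =>
    hD.norm_le h.isC1Field hs (hsub' hτ) z
  have hN' : ∀ τ ∈ Icc 0 T, ∀ w, ‖kinField L + b' τ w‖ ≤ N := fun τ hτ w =>
    h.isC1Field.bound τ hτ w
  have hcomp : ∀ A B : EucSp k × EucSp k →L[ℝ] EucSp k × EucSp k, ‖A.comp B‖ ≤ ‖A‖ * ‖B‖ :=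
    ContinuousLinearMap.opNorm_comp_le
  have hid : ∀ τ ∈ Icc s t, ‖D τ s z - ContinuousLinearMap.id ℝ _‖ ≤ N * C * (τ - s) := by
    intro τ hτ
    have := norm_image_sub_le_of_norm_deriv_le_segment' (f := fun τ => D τ s z) (a := s) (b := t)
      (C := N * C)
      (fun τ hτ => (hD.deriv s hs z τ (hsub hτ)).mono hsub)
      (fun τ hτ => (hcomp _ _).trans (mul_le_mul (hN' τ (hsub (Ico_subset_Icc_self hτ)) _)
        (hC' τ (Ico_subset_Icc_self hτ)) (norm_nonneg _) hN0)) τ hτ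
    simpa [hD.self s hs] using this
  have hmain := norm_image_sub_le_of_norm_deriv_le_segment' (a := s) (b := t) (C := η)
    (f := fun τ => D τ s z - (τ - s) • (kinField L + b' s z))
    (f' := fun τ => (kinField L + b' τ (hamFlow H T τ s z)).comp (D τ s z) -
      (kinField L + b' s z))
    (fun τ hτ => by
      refine ((hD.deriv s hs z τ (hsub hτ)).mono hsub).sub ?_
      simpa using (((hasDerivAt_id τ).sub_const s).smul_const
        (kinField L + b' s z)).hasDerivWithinAt)
    (fun τ hτ => by
      have hτ := Ico_subset_Icc_self hτ
      have e1 : (kinField L + b' τ (hamFlow H T τ s z)).comp (D τ s z) - (kinField L + b' s z) =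
          (b' τ (hamFlow H T τ s z) - b' s z).comp (D τ s z) +
          (kinField L + b' s z).comp (D τ s z - ContinuousLinearMap.id ℝ _) := by
        simp only [ContinuousLinearMap.comp_sub, ContinuousLinearMap.sub_comp,
          ContinuousLinearMap.add_comp, ContinuousLinearMap.comp_id]
        abel
      rw [e1]
      have hle : τ - s ≤ t - s := by linarith [hτ.2]
      have h0 : 0 ≤ τ - s := by linarith [hτ.1]
      have b1 := (hcomp (b' τ (hamFlow H T τ s z) - b' s z) (D τ s z)).trans
        (mul_le_mul (he s hs τ (hsub' hτ) ((hle.trans hts).trans (min_le_left _ _)) z)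
          (hC' τ hτ) (norm_nonneg _) (by positivity))
      have b2 := (hcomp (kinField L + b' s z) (D τ s z - ContinuousLinearMap.id ℝ _)).trans
        (mul_le_mul (hN' s hs z) (hid τ hτ) (norm_nonneg _) hN0)
      have b3 : η / (2 * C) * C = η / 2 := by field_simp
      have b4 : τ - s ≤ η / (2 * (N * (N * C) + 1)) := (hle.trans hts).trans (min_le_right _ _)
      rw [le_div_iff₀ (by positivity)] at b4
      have b5 : N * (N * C * (τ - s)) ≤ η / 2 := by nlinarith
      refine (norm_add_le _ _).trans ?_
      linarith)
    t ⟨ht.1, le_rfl⟩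
  rw [hD.self s hs, sub_self, zero_smul ℝ (kinField L + b' s z), sub_zero] at hmain
  rwa [sub_right_comm] at hmain

end IsKineticHam

/-- After division by `t - s`, the position displacement is `P ↦ D_pH(s,X,P)` plus an error `ψ`,
whose derivative in `P` is the remainder of the uniform expansion of the linearized flow. Composed
with the inverse map from `(⋆)`, the error is a contraction. -/
theorem StarCondition.exists_twist_equiv (hstar : StarCondition H T)
    (h : IsKineticHam L H b b' T R M) :
    ∃ ε₀ > 0, ∀ s ∈ Icc 0 T, ∀ t ∈ Icc s T, s < t → t - s ≤ ε₀ →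
      ∃ e : EucSp k × EucSp k ≃ EucSp k × EucSp k,
        (∀ z, e z = twistMap H T t s z) ∧ ContDiff ℝ 1 e ∧ ContDiff ℝ 1 e.symm := by
  obtain ⟨K, hK⟩ := hstar
  obtain ⟨D, hD⟩ := h.isFlowOn.exists_linearized h.isC1Field
  -- A positive Lipschitz constant for the inverse; with `ψ` of constant `1 / (2κ)`, the composition
  -- of `ψ` with the inverse has constant `1 / 2`.
  set κ : ℝ := K + 1 with hκ
  have hκ0 : 0 < κ := by positivity
  obtain ⟨ε₀, hε₀, hε⟩ := h.exists_norm_linearized_sub_le hD (η := 1 / (2 * κ)) (by positivity)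
  refine ⟨ε₀, hε₀, fun s hs t ht hst hts => ?_⟩
  have hd : 0 < t - s := by linarith
  have hcd := hD.contDiff h.isFlowOn h.isC1Field hs ht
  set g : EucSp k × EucSp k → EucSp k := fun z => (hamFlow H T t s z).1 with hg
  -- the deviation of `(g - X) / (t - s)` from the map of condition `(⋆)`
  let ψ : EucSp k → EucSp k → EucSp k := fun X P =>
    (t - s)⁻¹ • (g (X, P) - X) - (hamField H s (X, P)).1
  have hψ : ∀ X P P', ‖ψ X P - ψ X P'‖ ≤ 1 / (2 * κ) * ‖P - P'‖ := by
    intro X P P'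
    refine convex_univ.norm_image_sub_le_of_norm_hasFDerivWithin_le (𝕜 := ℝ)
      (f' := fun P => (t - s)⁻¹ • (ContinuousLinearMap.fst ℝ _ _).comp
        ((D t s (X, P) - ContinuousLinearMap.id ℝ _ - (t - s) • (kinField L + b' s (X, P))).comp
          (ContinuousLinearMap.inr ℝ _ _)))
      (fun Q _ => HasFDerivAt.hasFDerivWithinAt ?_) (fun Q _ => ?_) (mem_univ P') (mem_univ P)
    · have i1 : HasFDerivAt (fun Q : EucSp k => (X, Q)) (ContinuousLinearMap.inr ℝ _ _) Q :=
        hasFDerivAt_prodMk_right X Q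
      have i2 := ((hD.hasFDerivAt h.isFlowOn h.isC1Field hs ht (X, Q)).comp Q i1).fst
      have i3 := ((h.isC1Field.hasFDerivAt s hs (X, Q)).comp Q i1).fst
      refine (((i2.sub_const X).const_smul (t - s)⁻¹).sub i3).congr_fderiv ?_
      refine ContinuousLinearMap.ext fun v => ?_
      simp [smul_sub, smul_smul, inv_mul_cancel₀ hd.ne']
    · have j1 := hε s hs t ht hts (X, Q)
      have j2 : ∀ B : EucSp k × EucSp k →L[ℝ] EucSp k × EucSp k,
          ‖(ContinuousLinearMap.fst ℝ _ _).comp (B.comp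
            (ContinuousLinearMap.inr ℝ (EucSp k) (EucSp k)))‖ ≤ ‖B‖ := fun B =>
        ContinuousLinearMap.opNorm_le_bound _ (norm_nonneg _) fun v => by
          have := B.le_opNorm ((0 : EucSp k), v)
          have h2 : ‖((0 : EucSp k), v)‖ = ‖v‖ := by simp [Prod.norm_def]
          rw [h2] at this
          exact (norm_fst_le _).trans this
      rw [norm_smul, norm_inv, Real.norm_eq_abs, abs_of_pos hd, inv_mul_eq_div, div_le_iff₀ hd]
      exact (j2 _).trans j1
  have hgeq : ∀ X P, g (X, P) = X + (t - s) • ((hamField H s (X, P)).1 + ψ X P) := by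
    intro X P
    simp [ψ, smul_smul, mul_inv_cancel₀ hd.ne']
  refine exists_fibered_equiv (g := g) (contDiff_fst.comp hcd) (fun X => ?_) (fun X => ?_)
  · obtain ⟨e, he, -, -, -, he2⟩ := hK s hs X
    have h1 : Function.Bijective fun y => y + ψ X (e.symm y) := by
      refine bijective_id_add_of_lipschitz fun x y => (hψ X _ _).trans ?_
      have h2 := he2.norm_sub_le x y
      have h3 : ‖e.symm x - e.symm y‖ ≤ κ * ‖x - y‖ :=
        h2.trans (by gcongr; rw [hκ]; linarith)
      calc 1 / (2 * κ) * ‖e.symm x - e.symm y‖ ≤ 1 / (2 * κ) * (κ * ‖x - y‖) := by gcongr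
        _ = 1 / 2 * ‖x - y‖ := by field_simp
    -- Factorization into bijections: `D_pH`, a contractive perturbation of the identity, a
    -- homothety and a translation.
    have h2 : (fun P => g (X, P)) = ((Equiv.addLeft X) ∘
        (fun v => (t - s) • v)) ∘ (fun y => y + ψ X (e.symm y)) ∘ e := by
      funext P
      have : e P = (hamField H s (X, P)).1 := he P
      simp [hgeq, ← this]
    rw [h2]
    refine ((Equiv.bijective _).comp ?_).comp (h1.comp e.bijective)
    exact MulAction.bijective₀ hd.ne'
  · obtain ⟨e, he, -, -, -, he2⟩ := hK s hs X
    -- The map `e` expands by at least `1 / κ`, and the error `ψ` takes away at most half of this.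
    refine ⟨(t - s) * (1 / (2 * κ)), by positivity, fun P P' => ?_⟩
    have h1 : g (X, P) - g (X, P') = (t - s) • ((e P - e P') + (ψ X P - ψ X P')) := by
      have e1 : e P = (hamField H s (X, P)).1 := he P
      have e2 : e P' = (hamField H s (X, P')).1 := he P'
      rw [hgeq, hgeq, ← e1, ← e2, add_sub_add_left_eq_sub, ← smul_sub]
      congr 1; abel
    have h2 := he2.norm_sub_le (e P) (e P')
    simp only [Equiv.symm_apply_apply] at h2
    have h3 : ‖P - P'‖ ≤ κ * ‖e P - e P'‖ := h2.trans (by gcongr; rw [hκ]; linarith)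
    have h4 := hψ X P P'
    have h5 := norm_sub_norm_le (e P - e P') (-(ψ X P - ψ X P'))
    rw [sub_neg_eq_add, norm_neg] at h5
    rw [h1, norm_smul, Real.norm_eq_abs, abs_of_pos hd, mul_assoc]
    gcongr
    have h6 : 1 / κ * ‖P - P'‖ ≤ ‖e P - e P'‖ := by
      rw [one_div, inv_mul_le_iff₀ hκ0]; exact h3
    have h7 : 1 / κ * ‖P - P'‖ = 1 / (2 * κ) * ‖P - P'‖ + 1 / (2 * κ) * ‖P - P'‖ := by
      field_simp; ring
    linarith

end HamFlow

/-! ### The action of a segment as a generating function -/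

section Action

variable {k : ℕ} {L : EucSp k →L[ℝ] EucSp k} {H : ℝ → EucSp k → EucSp k → ℝ}
  {b : ℝ → EucSp k × EucSp k → EucSp k × EucSp k}
  {b' : ℝ → EucSp k × EucSp k → EucSp k × EucSp k →L[ℝ] EucSp k × EucSp k}
  {T R M : ℝ}

theorem contDiff_sympForm {n : WithTop ℕ∞} : ContDiff ℝ n (sympForm (k := k)) := by
  let f : EucSp k × EucSp k →ₗ[ℝ] (EucSp k × EucSp k →L[ℝ] ℝ) :=
    { toFun := sympForm
      map_add' := fun X Y => ContinuousLinearMap.ext fun v => by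
        simp [sympForm_apply, inner_add_left]; ring
      map_smul' := fun c X => ContinuousLinearMap.ext fun v => by
        simp [sympForm_apply, inner_smul_left]; ring }
  exact (LinearMap.toContinuousLinearMap f).contDiff

theorem norm_sympForm_le (X : EucSp k × EucSp k) : ‖sympForm X‖ ≤ 2 * ‖X‖ := by
  refine ContinuousLinearMap.opNorm_le_bound _ (by positivity) fun v => ?_
  rw [sympForm_apply]
  have h1 := abs_real_inner_le_norm X.1 v.2
  have h2 := abs_real_inner_le_norm X.2 v.1
  have h3 : ‖X.1‖ * ‖v.2‖ ≤ ‖X‖ * ‖v‖ := by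
    gcongr
    exacts [norm_fst_le X, norm_snd_le v]
  have h4 : ‖X.2‖ * ‖v.1‖ ≤ ‖X‖ * ‖v‖ := by
    gcongr
    exacts [norm_snd_le X, norm_fst_le v]
  rw [Real.norm_eq_abs]
  refine (abs_sub _ _).trans ?_
  linarith

/-- The integrand `⟨p, D_p H⟩ - H` of the action. -/
noncomputable def lagr (H : ℝ → EucSp k → EucSp k → ℝ) (t : ℝ) (z : EucSp k × EucSp k) : ℝ :=
  inner ℝ z.2 (hamField H t z).1 - H t z.1 z.2

/-- The action on `[s,t]` of the trajectory which starts at `z` at time `s`. -/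
noncomputable def flowAction (H : ℝ → EucSp k → EucSp k → ℝ) (T t s : ℝ)
    (z : EucSp k × EucSp k) : ℝ :=
  ∫ τ in s..t, lagr H τ (hamFlow H T τ s z)

/-- The differential of `lagr` along `X'`, composed with a linear map `D`. -/
noncomputable def lagrForm (p : EucSp k) (X : EucSp k × EucSp k)
    (X' D : EucSp k × EucSp k →L[ℝ] EucSp k × EucSp k) : EucSp k × EucSp k →L[ℝ] ℝ :=
  (innerSL ℝ p).comp ((ContinuousLinearMap.fst ℝ _ _).comp (X'.comp D)) +
    (innerSL ℝ X.2).comp ((ContinuousLinearMap.fst ℝ _ _).comp D)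

theorem lagrForm_apply (p : EucSp k) (X : EucSp k × EucSp k)
    (X' D : EucSp k × EucSp k →L[ℝ] EucSp k × EucSp k) (v : EucSp k × EucSp k) :
    lagrForm p X X' D v = inner ℝ p (X' (D v)).1 + inner ℝ X.2 (D v).1 := rfl

theorem norm_lagrForm_le (p : EucSp k) (X : EucSp k × EucSp k)
    (X' D : EucSp k × EucSp k →L[ℝ] EucSp k × EucSp k) :
    ‖lagrForm p X X' D‖ ≤ (‖p‖ * ‖X'‖ + ‖X.2‖) * ‖D‖ := by
  refine ContinuousLinearMap.opNorm_le_bound _ (by positivity) fun v => ?_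
  rw [lagrForm_apply, Real.norm_eq_abs]
  have h0 := D.le_opNorm v
  have h1 : ‖(X' (D v)).1‖ ≤ ‖X'‖ * (‖D‖ * ‖v‖) :=
    (norm_fst_le _).trans ((X'.le_opNorm _).trans (by gcongr))
  have h2 : ‖(D v).1‖ ≤ ‖D‖ * ‖v‖ := (norm_fst_le _).trans h0
  have h3 := (abs_real_inner_le_norm p (X' (D v)).1).trans
    (mul_le_mul_of_nonneg_left h1 (norm_nonneg p))
  have h4 := (abs_real_inner_le_norm X.2 (D v).1).trans
    (mul_le_mul_of_nonneg_left h2 (norm_nonneg X.2))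
  refine (abs_add_le _ _).trans ?_
  nlinarith

namespace IsKineticHam

variable (h : IsKineticHam L H b b' T R M)
include h

theorem continuousOn_lagr {s : ℝ} (hs : s ∈ Icc 0 T) (z : EucSp k × EucSp k) :
    ContinuousOn (fun τ => lagr H τ (hamFlow H T τ s z)) (Icc 0 T) := by
  have h1 : ContinuousOn (fun τ : ℝ => (τ, hamFlow H T τ s z)) (Icc 0 T) :=
    continuousOn_id.prodMk (h.isFlowOn.curve s hs z).continuousOn
  have hm : MapsTo (fun τ : ℝ => (τ, hamFlow H T τ s z)) (Icc 0 T) (Icc 0 T ×ˢ univ) :=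
    fun τ hτ => ⟨hτ, mem_univ _⟩
  exact ((h.isFlowOn.curve s hs z).continuousOn.snd.inner
    (h.isC1Field.cont.comp h1 hm).fst).sub (h.cont.comp h1 hm)

/-- In the differential of `⟨p, D_pH⟩ - H` the terms `⟨dp, D_pH⟩` cancel; what remains is `⟨p,
d(D_pH)⟩ - ⟨D_xH, dx⟩`. -/
theorem hasFDerivAt_lagr {t : ℝ} (ht : t ∈ Icc 0 T) (z : EucSp k × EucSp k) :
    HasFDerivAt (lagr H t) (lagrForm z.2 (hamField H t z) (kinField L + b' t z)
      (ContinuousLinearMap.id ℝ _)) z := by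
  have h1 : HasFDerivAt (fun z : EucSp k × EucSp k => z.2) (ContinuousLinearMap.snd ℝ _ _) z :=
    hasFDerivAt_snd
  have h2 := (h.isC1Field.hasFDerivAt t ht z).fst
  refine ((h1.inner ℝ h2).sub (h.hasFDerivAt t ht z)).congr_fderiv ?_
  refine ContinuousLinearMap.ext fun v => ?_
  rw [← h.hamField_eq ht]
  simp only [sub_apply, sympForm_apply, lagrForm_apply,
    ContinuousLinearMap.comp_apply, fderivInnerCLM_apply, ContinuousLinearMap.prod_apply,
    ContinuousLinearMap.coe_fst', ContinuousLinearMap.coe_snd', ContinuousLinearMap.id_apply]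
  rw [real_inner_comm v.2]
  ring

/-- First variation formula. Differentiation under the integral sign, with the variation carried by
`D`, gives an integrand which by Hamilton's equations is the time derivative of `⟨p, (D v).1⟩`; only
the boundary terms survive. -/
theorem hasFDerivAt_flowAction
    {D : ℝ → ℝ → EucSp k × EucSp k → EucSp k × EucSp k →L[ℝ] EucSp k × EucSp k}
    (hD : IsLinearizedFlow D (hamFlow H T) (fun t z => kinField L + b' t z) T)
    {s t : ℝ} (hs : s ∈ Icc 0 T) (ht : t ∈ Icc s T) (z : EucSp k × EucSp k) :
    HasFDerivAt (flowAction H T t s)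
      ((innerSL ℝ (hamFlow H T t s z).2).comp ((ContinuousLinearMap.fst ℝ _ _).comp (D t s z)) -
        (innerSL ℝ z.2).comp (ContinuousLinearMap.fst ℝ _ _)) z := by
  have hsub : Icc s t ⊆ Icc 0 T := Icc_subset_Icc hs.1 ht.2
  have hsub' : Icc s t ⊆ Icc s T := Icc_subset_Icc_right ht.2
  have hIoc : Ioc s t ⊆ Icc s t := Ioc_subset_Icc_self
  have hu : uIcc s t = Icc s t := uIcc_of_le ht.1
  have hM := h.nonneg
  have hT := h.pos
  let F' : EucSp k × EucSp k → ℝ → EucSp k × EucSp k →L[ℝ] ℝ := fun w τ =>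
    lagrForm (hamFlow H T τ s w).2 (hamField H τ (hamFlow H T τ s w))
      (kinField L + b' τ (hamFlow H T τ s w)) (D τ s w)
  have hflow : ∀ w, ContinuousOn (fun τ => hamFlow H T τ s w) (Icc s t) := fun w =>
    ((h.isFlowOn.curve s hs w).mono hsub).continuousOn
  have hDc : ∀ w, ContinuousOn (fun τ => D τ s w) (Icc s t) := fun w τ hτ =>
    ((hD.deriv s hs w τ (hsub hτ)).mono hsub).continuousWithinAt
  have hF'c : ∀ w, ContinuousOn (F' w) (Icc s t) := by
    intro w
    have h1 : ContinuousOn (fun τ : ℝ => (τ, hamFlow H T τ s w)) (Icc s t) :=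
      continuousOn_id.prodMk (hflow w)
    have hm : MapsTo (fun τ : ℝ => (τ, hamFlow H T τ s w)) (Icc s t) (Icc 0 T ×ˢ univ) :=
      fun τ hτ => ⟨hsub hτ, mem_univ _⟩
    have c1 : ContinuousOn (fun τ => innerSL ℝ (hamFlow H T τ s w).2) (Icc s t) :=
      (innerSL ℝ).continuous.comp_continuousOn (hflow w).snd
    have c2 : ContinuousOn (fun τ => innerSL ℝ (hamField H τ (hamFlow H T τ s w)).2) (Icc s t) :=
      (innerSL ℝ).continuous.comp_continuousOn (h.isC1Field.cont.comp h1 hm).snd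
    have c3 : ContinuousOn (fun τ => kinField L + b' τ (hamFlow H T τ s w)) (Icc s t) :=
      h.isC1Field.cont'.comp h1 hm
    exact (c1.clm_comp (continuousOn_const.clm_comp (c3.clm_comp (hDc w)))).add
      (c2.clm_comp (continuousOn_const.clm_comp (hDc w)))
  have hFc : ∀ w, ContinuousOn (fun τ => lagr H τ (hamFlow H T τ s w)) (Icc s t) := fun w =>
    (h.continuousOn_lagr hs w).mono hsub
  have main := intervalIntegral.hasFDerivAt_integral_of_dominated_of_fderiv_le
    (μ := MeasureTheory.volume) (F := fun w τ => lagr H τ (hamFlow H T τ s w)) (F' := F')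
    (x₀ := z) (a := s) (b := t) (s := Metric.ball z 1)
    -- On the unit ball around `z` momenta stay below `‖z.2‖ + 1 + M * T`, the force is at most `M`,
    -- and the exponential bounds the linearized flow.
    (bound := fun _ => ((‖z.2‖ + 1 + M * T) * (‖kinField L‖ + M) + M) *
      Real.exp ((‖kinField L‖ + M) * T)) (Metric.ball_mem_nhds z one_pos)
    (Filter.Eventually.of_forall fun w => by
      rw [uIoc_of_le ht.1]
      exact ((hFc w).mono hIoc).aestronglyMeasurable measurableSet_Ioc)
    (ContinuousOn.intervalIntegrable (by rw [hu]; exact hFc z))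
    (by
      rw [uIoc_of_le ht.1]
      exact ((hF'c z).mono hIoc).aestronglyMeasurable measurableSet_Ioc)
    (Filter.Eventually.of_forall fun τ hτ w hw => by
      rw [uIoc_of_le ht.1] at hτ
      have hτ1 := hIoc hτ
      rw [Metric.mem_ball, dist_eq_norm] at hw
      refine (norm_lagrForm_le _ _ _ _).trans ?_
      have e1 : ‖(hamFlow H T τ s w).2‖ ≤ ‖z.2‖ + 1 + M * T := by
        have i1 := h.norm_momentum_sub_le hs (hsub' hτ1) w
        have i2 := norm_sub_norm_le (hamFlow H T τ s w).2 w.2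
        have i3 := norm_sub_norm_le w.2 z.2
        have i4 : ‖w.2 - z.2‖ ≤ ‖w - z‖ := norm_snd_le (w - z)
        have i5 : M * (τ - s) ≤ M * T := by
          gcongr; linarith [(hsub' hτ1).2, hs.1]
        linarith
      have e2 : ‖(hamField H τ (hamFlow H T τ s w)).2‖ ≤ M := by
        rw [h.hamField_eq (hsub hτ1)]
        simpa [kinField_apply] using (norm_snd_le _).trans (h.bound τ (hsub hτ1) _)
      have e3 : ‖kinField L + b' τ (hamFlow H T τ s w)‖ ≤ ‖kinField L‖ + M :=
        h.isC1Field.bound τ (hsub hτ1) _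
      have e4 : ‖D τ s w‖ ≤ Real.exp ((‖kinField L‖ + M) * T) :=
        hD.norm_le h.isC1Field hs (hsub' hτ1) w
      gcongr)
    intervalIntegrable_const
    (Filter.Eventually.of_forall fun τ hτ w _ => by
      rw [uIoc_of_le ht.1] at hτ
      have hτ1 := hIoc hτ
      refine ((h.hasFDerivAt_lagr (hsub hτ1) _).comp w
        (hD.hasFDerivAt h.isFlowOn h.isC1Field hs (hsub' hτ1) w)).congr_fderiv ?_
      exact ContinuousLinearMap.ext fun v => rfl)
  refine main.congr_fderiv (ContinuousLinearMap.ext fun v => ?_)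
  have hint : IntervalIntegrable (F' z) MeasureTheory.volume s t :=
    ContinuousOn.intervalIntegrable (by rw [hu]; exact hF'c z)
  rw [ContinuousLinearMap.intervalIntegral_apply hint]
  have ftc := intervalIntegral.integral_eq_sub_of_hasDerivAt_of_le ht.1
    (f := fun τ => inner ℝ (hamFlow H T τ s z).2 (D τ s z v).1) (f' := fun τ => F' z τ v)
    ((hflow z).snd.inner ((hDc z).clm_apply continuousOn_const).fst)
    (fun τ hτ => by
      have hτ1 := Ioo_subset_Icc_self hτ
      have hn : Icc 0 T ∈ nhds τ :=
        Icc_mem_nhds (hs.1.trans_lt hτ.1) (hτ.2.trans_le ht.2)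
      have d1 : HasDerivAt (fun τ => (hamFlow H T τ s z).2)
          (hamField H τ (hamFlow H T τ s z)).2 τ :=
        ((h.isFlowOn.curve s hs z τ (hsub hτ1)).hasDerivAt hn).snd
      have d2 : HasDerivAt (fun τ => (D τ s z v).1)
          ((kinField L + b' τ (hamFlow H T τ s z)) (D τ s z v)).1 τ := by
        have d3 : HasDerivAt (fun τ => D τ s z v)
            ((kinField L + b' τ (hamFlow H T τ s z)) (D τ s z v)) τ := by
          simpa using
            ((hD.deriv s hs z τ (hsub hτ1)).hasDerivAt hn).clm_apply (hasDerivAt_const τ v)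
        exact d3.fst
      refine (d1.inner ℝ d2).congr_deriv ?_
      simp [F', lagrForm_apply])
    (ContinuousOn.intervalIntegrable (by
      rw [hu]; exact (hF'c z).clm_apply continuousOn_const))
  rw [ftc, h.isFlowOn.self s hs, hD.self s hs]
  rfl

theorem lagr_add_intVec {t : ℝ} (ht : t ∈ Icc 0 T) (m : Fin k → ℤ) (z : EucSp k × EucSp k) :
    lagr H t (z + (intVec m, 0)) = lagr H t z := by
  have h1 : hamField H t (z + (intVec m, 0)) = hamField H t z := by
    rw [h.hamField_eq ht, h.hamField_eq ht, h.periodic' t ht]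
    simp [kinField_apply]
  rw [lagr, lagr, h1]
  simp [h.periodic t ht]

theorem flowAction_add_intVec {s t : ℝ} (hs : s ∈ Icc 0 T) (ht : t ∈ Icc s T) (m : Fin k → ℤ)
    (z : EucSp k × EucSp k) :
    flowAction H T t s (z + (intVec m, 0)) = flowAction H T t s z := by
  refine intervalIntegral.integral_congr fun τ hτ => ?_
  rw [uIcc_of_le ht.1] at hτ
  have hτ' : τ ∈ Icc 0 T := ⟨hs.1.trans hτ.1, hτ.2.trans ht.2⟩
  simp only [h.hamFlow_add_intVec hs hτ', h.lagr_add_intVec hτ']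

/-- Along a free trajectory the integrand is the constant `⟨p, L p⟩ - ½⟨L p, p⟩`. -/
theorem flowAction_of_lt {s t : ℝ} (hs : s ∈ Icc 0 T) (ht : t ∈ Icc s T)
    {z : EucSp k × EucSp k} (hz : R < ‖z.2‖) :
    flowAction H T t s z = (t - s) / 2 * inner ℝ (L z.2) z.2 := by
  have : EqOn (fun τ => lagr H τ (hamFlow H T τ s z)) (fun _ => 1 / 2 * inner ℝ (L z.2) z.2)
      (uIcc s t) := by
    intro τ hτ
    rw [uIcc_of_le ht.1] at hτ
    have hτ' : τ ∈ Icc 0 T := ⟨hs.1.trans hτ.1, hτ.2.trans ht.2⟩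
    have h0 : b τ (z.1 + (τ - s) • L z.2, z.2) = 0 := h.zero τ hτ' _ hz
    simp only [h.hamFlow_of_lt hs hτ' hz, lagr, h.hamField_eq hτ', h0, h.value τ hτ' _ _ hz,
      kinField_apply, add_zero]
    rw [real_inner_comm]; ring
  rw [flowAction, intervalIntegral.integral_congr this, intervalIntegral.integral_const,
    smul_eq_mul]
  ring

end IsKineticHam

/-- `S` is a `C^2` generating function, without parameters, of the twist map `φ`: the trajectory
from `X` to `Y` has initial momentum `P (X,Y)` and final momentum `p (X,Y)`, and
`dS = p dY - P dX`. -/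
structure IsTwistGF (S : EucSp k → EucSp k → ℝ) (φ : EucSp k × EucSp k → EucSp k × EucSp k)
    (P p : EucSp k × EucSp k → EucSp k) : Prop where
  contDiff_start : ContDiff ℝ 1 P
  contDiff_end : ContDiff ℝ 1 p
  flow_iff : ∀ X Y Q q, φ (X, Q) = (Y, q) ↔ Q = P (X, Y) ∧ q = p (X, Y)
  hasFDerivAt : ∀ w, HasFDerivAt (fun w : EucSp k × EucSp k => S w.1 w.2)
    (sympForm (p w, P w)) w

theorem IsTwistGF.contDiff {S : EucSp k → EucSp k → ℝ}
    {φ : EucSp k × EucSp k → EucSp k × EucSp k} {P p : EucSp k × EucSp k → EucSp k}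
    (hS : IsTwistGF S φ P p) : ContDiff ℝ 2 (fun w : EucSp k × EucSp k => S w.1 w.2) := by
  have : ContDiff ℝ ((1 : ℕ) + 1) (fun w : EucSp k × EucSp k => S w.1 w.2) :=
    contDiff_succ_iff_hasFDerivAt.2 ⟨fun w => sympForm (p w, P w),
      contDiff_sympForm.comp (hS.contDiff_end.prodMk hS.contDiff_start), hS.hasFDerivAt⟩
  rwa [Nat.cast_one, one_add_one_eq_two] at this

namespace IsKineticHam

variable (h : IsKineticHam L H b b' T R M)
include h

theorem segmentAction_eq {s t : ℝ} (hs : s ∈ Icc 0 T) (ht : t ∈ Icc s T)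
    {e : EucSp k × EucSp k ≃ EucSp k × EucSp k} (he : ∀ z, e z = twistMap H T t s z)
    (X Y : EucSp k) : segmentAction H T t s X Y = flowAction H T t s (e.symm (X, Y)) := by
  have h1 : twistMap H T t s (e.symm (X, Y)) = (X, Y) := by rw [← he, e.apply_symm_apply]
  obtain ⟨h2, h3⟩ := Prod.ext_iff.1 h1
  simp only [twistMap] at h2 h3
  have hinj : Function.Injective fun P => (hamFlow H T t s (X, P)).1 := by
    intro P P' hP
    have : e (X, P) = e (X, P') := by rw [he, he]; exact Prod.ext rfl hP
    exact (Prod.ext_iff.1 (e.injective this)).2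
  have hz : (X, startMomentum H T t s X Y) = e.symm (X, Y) := by
    refine Prod.ext h2.symm ?_
    have h4 : (fun P => (hamFlow H T t s (X, P)).1) (e.symm (X, Y)).2 = Y := by
      have h5 : (X, (e.symm (X, Y)).2) = e.symm (X, Y) := Prod.ext h2.symm rfl
      simp only [h5, h3]
    simp only [startMomentum]
    nth_rw 1 [← h4]
    exact Function.leftInverse_invFun hinj _
  rw [segmentAction, flowAction]
  simp only [hz]
  -- Two-sided differentiability of the trajectory is known only inside the time interval, so
  -- `deriv` is identified off the endpoints, a null set.
  refine intervalIntegral.integral_congr_Ioo_of_le ht.1 fun τ hτ => ?_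
  have hτ1 : τ ∈ Icc 0 T := ⟨hs.1.trans hτ.1.le, hτ.2.le.trans ht.2⟩
  have hn : Icc 0 T ∈ nhds τ := Icc_mem_nhds (hs.1.trans_lt hτ.1) (hτ.2.trans_le ht.2)
  have d1 : HasDerivAt (fun τ => (hamFlow H T τ s (e.symm (X, Y))).1)
      (hamField H τ (hamFlow H T τ s (e.symm (X, Y)))).1 τ :=
    ((h.isFlowOn.curve s hs (e.symm (X, Y)) τ hτ1).hasDerivAt hn).fst
  simp only [lagr]
  rw [d1.deriv]

/-- The segment action is `flowAction` composed with the inverse of the twist map, and the first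
variation formula is pulled back by this inverse. No derivative is lost, because the coefficients
`p` and `P` are themselves `C^1`. -/
theorem exists_isTwistGF {s t : ℝ} (hs : s ∈ Icc 0 T) (ht : t ∈ Icc s T)
    {e : EucSp k × EucSp k ≃ EucSp k × EucSp k} (he : ∀ z, e z = twistMap H T t s z)
    (hec' : ContDiff ℝ 1 e.symm) :
    IsTwistGF (segmentAction H T t s) (hamFlow H T t s) (fun w => (e.symm w).2)
      (fun w => (hamFlow H T t s (e.symm w)).2) := by
  obtain ⟨D, hD⟩ := h.isFlowOn.exists_linearized h.isC1Field
  have hφ := hD.contDiff h.isFlowOn h.isC1Field hs ht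
  have hse : ∀ w, (e.symm w).1 = w.1 ∧ (hamFlow H T t s (e.symm w)).1 = w.2 := fun w => by
    have h1 : twistMap H T t s (e.symm w) = w := by rw [← he, e.apply_symm_apply]
    exact Prod.ext_iff.1 h1
  refine ⟨contDiff_snd.comp hec', contDiff_snd.comp (hφ.comp hec'), fun X Y Q q => ?_, fun w => ?_⟩
  · constructor
    · intro hf
      have h1 : e.symm (X, Y) = (X, Q) := by
        rw [Equiv.symm_apply_eq, he, twistMap, hf]
      simp only [h1, hf, and_self]
    · rintro ⟨rfl, rfl⟩
      have h1 : (X, (e.symm (X, Y)).2) = e.symm (X, Y) := Prod.ext (hse (X, Y)).1.symm rfl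
      rw [h1]
      exact Prod.ext (hse (X, Y)).2 rfl
  · have h1 : (fun w : EucSp k × EucSp k => segmentAction H T t s w.1 w.2) =
        flowAction H T t s ∘ e.symm := funext fun w => h.segmentAction_eq hs ht he w.1 w.2
    have h2 : HasFDerivAt e.symm (fderiv ℝ e.symm w) w :=
      (hec'.differentiable (by simp) w).hasFDerivAt
    rw [h1]
    refine ((h.hasFDerivAt_flowAction hD hs ht _).comp w h2).congr_fderiv ?_
    have h3 : HasFDerivAt (fun w => (e.symm w).1)
        ((ContinuousLinearMap.fst ℝ _ _).comp (fderiv ℝ e.symm w)) w := h2.fst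
    have h4 : HasFDerivAt (fun w => (hamFlow H T t s (e.symm w)).1)
        ((ContinuousLinearMap.fst ℝ _ _).comp ((D t s (e.symm w)).comp (fderiv ℝ e.symm w))) w :=
      ((hD.hasFDerivAt h.isFlowOn h.isC1Field hs ht _).comp w h2).fst
    have h5 : (fun w => (e.symm w).1) = Prod.fst := funext fun w => (hse w).1
    have h6 : (fun w => (hamFlow H T t s (e.symm w)).1) = Prod.snd := funext fun w => (hse w).2
    -- The initial and the final position, as functions of `(X, Y)`, are the two coordinate
    -- projections, so their differentials are known without differentiating the inverse twist map
    -- explicitly.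
    rw [h5] at h3
    rw [h6] at h4
    have h7 := h3.unique hasFDerivAt_fst
    have h8 := h4.unique hasFDerivAt_snd
    refine ContinuousLinearMap.ext fun v => ?_
    have h7v := DFunLike.congr_fun h7 v
    have h8v := DFunLike.congr_fun h8 v
    simp only [ContinuousLinearMap.comp_apply, ContinuousLinearMap.coe_fst',
      ContinuousLinearMap.coe_snd'] at h7v h8v
    simp [sympForm_apply, h7v, h8v]

theorem segmentAction_add_intVec {s t : ℝ} (hs : s ∈ Icc 0 T) (ht : t ∈ Icc s T)
    {e : EucSp k × EucSp k ≃ EucSp k × EucSp k} (he : ∀ z, e z = twistMap H T t s z)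
    (m : Fin k → ℤ) (X Y : EucSp k) :
    segmentAction H T t s (X + intVec m) (Y + intVec m) = segmentAction H T t s X Y := by
  have ht' : t ∈ Icc 0 T := ⟨hs.1.trans ht.1, ht.2⟩
  have h1 : e.symm (X + intVec m, Y + intVec m) = e.symm (X, Y) + (intVec m, 0) := by
    rw [Equiv.symm_apply_eq, he, twistMap, h.hamFlow_add_intVec hs ht']
    have h2 : twistMap H T t s (e.symm (X, Y)) = (X, Y) := by rw [← he, e.apply_symm_apply]
    obtain ⟨h3, h4⟩ := Prod.ext_iff.1 h2
    simp only [twistMap] at h3 h4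
    simp [h3, h4]
  rw [h.segmentAction_eq hs ht he, h1, h.flowAction_add_intVec hs ht,
    h.segmentAction_eq hs ht he]

/-- The comparison function is the free action. The difference `W` is bounded because, in the
coordinates `(X, P)`, it is periodic and vanishes for `|P| > R`. Its differential pairs `dY` and
`dX` with the final and initial momenta minus the mean momentum `L'(Y - X)/(t - s)`, and momenta
drift by at most `M T`. -/
theorem exists_bound_segmentAction_sub {s t : ℝ} (hs : s ∈ Icc 0 T) (ht : t ∈ Icc s T)
    (hst : s < t) {e : EucSp k × EucSp k ≃ EucSp k × EucSp k}
    (he : ∀ z, e z = twistMap H T t s z)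
    (hec : ContDiff ℝ 1 e) (hec' : ContDiff ℝ 1 e.symm) {L' : EucSp k →L[ℝ] EucSp k}
    (hL : ∀ v, L' (L v) = v) (hL' : ∀ v, L (L' v) = v) :
    ∃ C, 0 ≤ C ∧
      (∀ X Y, |segmentAction H T t s X Y - 1 / (2 * (t - s)) * inner ℝ (L' (Y - X)) (Y - X)| ≤ C) ∧
      ∀ w w' : EucSp k × EucSp k,
        |(segmentAction H T t s w.1 w.2 - 1 / (2 * (t - s)) * inner ℝ (L' (w.2 - w.1)) (w.2 - w.1))
          - (segmentAction H T t s w'.1 w'.2 -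
            1 / (2 * (t - s)) * inner ℝ (L' (w'.2 - w'.1)) (w'.2 - w'.1))| ≤ C * ‖w - w'‖ := by
  have ht' : t ∈ Icc 0 T := ⟨hs.1.trans ht.1, ht.2⟩
  have hd : 0 < t - s := by linarith
  have hM := h.nonneg
  have hT := h.pos
  have hgf := h.exists_isTwistGF hs ht he hec'
  set W : EucSp k × EucSp k → ℝ := fun w => segmentAction H T t s w.1 w.2 -
    1 / (2 * (t - s)) * inner ℝ (L' (w.2 - w.1)) (w.2 - w.1) with hW
  have hse : ∀ w, (e.symm w).1 = w.1 ∧ (hamFlow H T t s (e.symm w)).1 = w.2 := fun w => by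
    have h1 : twistMap H T t s (e.symm w) = w := by rw [← he, e.apply_symm_apply]
    exact Prod.ext_iff.1 h1
  have hLs : ∀ x y, inner ℝ (L' x) y = inner ℝ x (L' y) := fun x y => by
    rw [← hL' y, ← h.symm, hL', hL']
  -- the derivative of `W`
  have hWd : ∀ w, HasFDerivAt W (sympForm ((hamFlow H T t s (e.symm w)).2 -
      (t - s)⁻¹ • L' (w.2 - w.1), (e.symm w).2 - (t - s)⁻¹ • L' (w.2 - w.1))) w := by
    intro w
    have d1 : HasFDerivAt (fun w : EucSp k × EucSp k => w.2 - w.1)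
        (ContinuousLinearMap.snd ℝ _ _ - ContinuousLinearMap.fst ℝ _ _) w :=
      hasFDerivAt_snd.sub hasFDerivAt_fst
    have d2 : HasFDerivAt (fun w : EucSp k × EucSp k => L' (w.2 - w.1)) _ w :=
      L'.hasFDerivAt.comp w d1
    refine ((hgf.hasFDerivAt w).sub ((d2.inner ℝ d1).const_mul (1 / (2 * (t - s))))).congr_fderiv ?_
    refine ContinuousLinearMap.ext fun v => ?_
    have e1 : inner ℝ (L' (v.2 - v.1)) (w.2 - w.1) = inner ℝ (L' (w.2 - w.1)) (v.2 - v.1) := by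
      rw [hLs, real_inner_comm]
    simp only [sub_apply, sympForm_apply, smul_apply,
      ContinuousLinearMap.comp_apply, fderivInnerCLM_apply, ContinuousLinearMap.prod_apply,
      ContinuousLinearMap.coe_fst', ContinuousLinearMap.coe_snd', e1, inner_sub_left,
      inner_smul_left, smul_eq_mul]
    simp only [inner_sub_right, conj_trivial]
    field_simp
    ring
  -- `W` vanishes on fast trajectories
  have hcont : Continuous W := continuous_iff_continuousAt.2 fun w => (hWd w).continuousAt
  -- The function is taken constant in time in order to apply the bound for time-dependent periodic
  -- functions; the variable `z` is the starting point `(X, P)`.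
  obtain ⟨C₁, hC₁, hb⟩ := exists_bound_of_periodic (g := fun _ z => W (e z)) (T := T) (R := R)
    ((hcont.comp (hec.continuous.comp continuous_snd)).continuousOn)
    (fun _ _ m z => by
      have e1 : e (z + (intVec m, 0)) = ((e z).1 + intVec m, (e z).2 + intVec m) := by
        rw [he, he, twistMap, twistMap, h.hamFlow_add_intVec hs ht']
        rfl
      simp only [e1, hW, h.segmentAction_add_intVec hs ht he, add_sub_add_right_eq_sub])
    (fun _ _ z hz => by
      have e1 : (e z).2 - (e z).1 = (t - s) • L z.2 := by
        rw [he, twistMap, h.hamFlow_of_lt hs ht' hz]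
        simp
      simp only [hW, e1, h.segmentAction_eq hs ht he, Prod.mk.eta, e.symm_apply_apply,
        h.flowAction_of_lt hs ht hz, map_smul, hL, inner_smul_left, inner_smul_right,
        conj_trivial]
      rw [real_inner_comm]
      field_simp
      ring)
  have hb' : ∀ w, |W w| ≤ C₁ := fun w => by
    simpa using hb 0 ⟨le_rfl, hT.le⟩ (e.symm w)
  -- The first summand bounds the momentum drift, the second the distance from the initial momentum
  -- to the mean momentum; the factor `2` used with `B` is the one in `norm_sympForm_le`.
  set B := M * T + ‖L'‖ * (‖L‖ * (M * T) + M) with hB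
  have hB0 : 0 ≤ B := by positivity
  refine ⟨max C₁ (2 * B), le_max_of_le_left hC₁, fun X Y => (hb' (X, Y)).trans (le_max_left _ _),
    fun w w' => ?_⟩
  have hfin : ‖W w - W w'‖ ≤ (2 * B) * ‖w - w'‖ := by
    refine convex_univ.norm_image_sub_le_of_norm_hasFDerivWithin_le
      (fun w _ => (hWd w).hasFDerivWithinAt) (fun w _ => ?_) (mem_univ w') (mem_univ w)
    refine (norm_sympForm_le _).trans (mul_le_mul_of_nonneg_left ?_ two_pos.le)
    set z := e.symm w with hz
    obtain ⟨z1, z2⟩ := hse w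
    rw [← hz] at z1 z2
    have hp : ‖(hamFlow H T t s z).2 - z.2‖ ≤ M * T := by
      refine (h.norm_momentum_sub_le hs ht z).trans ?_
      gcongr; linarith [hs.1, ht.2]
    have hx : ‖(hamFlow H T t s z).1 - z.1 - (t - s) • L z.2‖ ≤
        (‖L‖ * (M * T) + M) * (t - s) := by
      have hsub : Icc s t ⊆ Icc 0 T := Icc_subset_Icc hs.1 ht.2
      have := norm_image_sub_le_of_norm_deriv_le_segment' (a := s) (b := t)
        (f := fun τ => (hamFlow H T τ s z).1 - (τ - s) • L z.2)
        (f' := fun τ => (hamField H τ (hamFlow H T τ s z)).1 - L z.2) (C := ‖L‖ * (M * T) + M)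
        (fun τ hτ => by
          have i1 : HasDerivWithinAt (fun τ => (hamFlow H T τ s z).1)
              (hamField H τ (hamFlow H T τ s z)).1 (Icc s t) τ :=
            (((h.isFlowOn.curve s hs z).mono hsub) τ hτ).fst
          refine i1.sub ?_
          simpa using (((hasDerivAt_id τ).sub_const s).smul_const (L z.2)).hasDerivWithinAt)
        (fun τ hτ => by
          have hτ1 := Ico_subset_Icc_self hτ
          rw [h.hamField_eq (hsub hτ1)]
          have i1 : (kinField L (hamFlow H T τ s z) + b τ (hamFlow H T τ s z)).1 - L z.2 =
              L ((hamFlow H T τ s z).2 - z.2) + (b τ (hamFlow H T τ s z)).1 := by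
            simp only [kinField_apply, Prod.fst_add, map_sub]; abel
          rw [i1]
          refine (norm_add_le _ _).trans (add_le_add ((L.le_opNorm _).trans ?_)
            ((norm_fst_le _).trans (h.bound τ (hsub hτ1) _)))
          gcongr
          refine (h.norm_momentum_sub_le hs ⟨hτ1.1, hτ1.2.trans ht.2⟩ z).trans ?_
          gcongr; linarith [hs.1, hτ1.2, ht.2])
        t ⟨ht.1, le_rfl⟩
      simp only [h.isFlowOn.self s hs, sub_self, zero_smul, sub_zero] at this
      rwa [sub_right_comm] at this
    have hv : ‖z.2 - (t - s)⁻¹ • L' (w.2 - w.1)‖ ≤ ‖L'‖ * (‖L‖ * (M * T) + M) := by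
      have i1 : z.2 - (t - s)⁻¹ • L' (w.2 - w.1) =
          -((t - s)⁻¹ • L' ((hamFlow H T t s z).1 - z.1 - (t - s) • L z.2)) := by
        rw [z1, z2, map_sub L' (w.2 - w.1), map_smul, hL, smul_sub, smul_smul,
          inv_mul_cancel₀ hd.ne', one_smul, neg_sub]
      rw [i1, norm_neg, norm_smul, norm_inv, Real.norm_eq_abs, abs_of_pos hd, inv_mul_le_iff₀ hd]
      refine (L'.le_opNorm _).trans ?_
      calc ‖L'‖ * ‖(hamFlow H T t s z).1 - z.1 - (t - s) • L z.2‖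
          ≤ ‖L'‖ * ((‖L‖ * (M * T) + M) * (t - s)) := by gcongr
        _ = (t - s) * (‖L'‖ * (‖L‖ * (M * T) + M)) := by ring
    rw [Prod.norm_def]
    refine max_le ?_ ?_
    · have i2 : (hamFlow H T t s z).2 - (t - s)⁻¹ • L' (w.2 - w.1) =
          ((hamFlow H T t s z).2 - z.2) + (z.2 - (t - s)⁻¹ • L' (w.2 - w.1)) := by abel
      simp only [i2]
      exact (norm_add_le _ _).trans (add_le_add hp hv)
    · refine hv.trans ?_
      rw [hB]
      have : 0 ≤ M * T := by positivity
      linarith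
  exact hfin.trans (by gcongr; exact le_max_right _ _)

end IsKineticHam

end Action

/-! ### Broken geodesics: critical points, generation and regularity -/

section BrokenPath

variable {k N : ℕ}

@[simp] theorem brokenPath_zero (X : EucSp k) (U : Fin N → EucSp k) (x : EucSp k) :
    brokenPath X U x 0 = X := rfl

@[simp] theorem brokenPath_last (X : EucSp k) (U : Fin N → EucSp k) (x : EucSp k) :
    brokenPath X U x (Fin.last (N + 1)) = x := by
  rw [← Fin.succ_last, brokenPath, Fin.cons_succ, Fin.snoc_last]

@[simp] theorem brokenPath_castSucc_succ (X : EucSp k) (U : Fin N → EucSp k) (x : EucSp k)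
    (i : Fin N) : brokenPath X U x i.castSucc.succ = U i := by
  rw [brokenPath, Fin.cons_succ, Fin.snoc_castSucc]

@[simp] theorem brokenPath_succ_castSucc (X : EucSp k) (U : Fin N → EucSp k) (x : EucSp k)
    (i : Fin N) : brokenPath X U x i.succ.castSucc = U i := by
  rw [← Fin.succ_castSucc, brokenPath_castSucc_succ]

theorem forall_fin_path {p : Fin (N + 2) → Prop} (h0 : p 0) (hi : ∀ i : Fin N, p i.castSucc.succ)
    (hl : p (Fin.last (N + 1))) (j : Fin (N + 2)) : p j := by
  refine Fin.cases h0 (fun j => ?_) j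
  exact Fin.lastCases (by rwa [Fin.succ_last]) hi j

theorem brokenPath_eta (Z : Fin (N + 2) → EucSp k) :
    brokenPath (Z 0) (fun i => Z i.castSucc.succ) (Z (Fin.last (N + 1))) = Z :=
  funext <| forall_fin_path (by simp) (by simp) (by simp)

/-- The vertices of a broken geodesic as a linear function of `(x, (ξ, U))`. -/
noncomputable def pathCLM (k N : ℕ) :
    EucSp k × (EucSp k × (Fin N → EucSp k)) →L[ℝ] (Fin (N + 2) → EucSp k) :=
  LinearMap.toContinuousLinearMap
    { toFun := fun w => brokenPath w.2.1 w.2.2 w.1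
      map_add' := fun v w => funext <| forall_fin_path (by simp) (by simp) (by simp)
      map_smul' := fun c w => funext <| forall_fin_path (by simp) (by simp) (by simp) }

/-- The `j`-th edge of a broken geodesic as a linear function of `(x, (ξ, U))`. -/
noncomputable def edgeCLM (k N : ℕ) (j : Fin (N + 1)) :
    EucSp k × (EucSp k × (Fin N → EucSp k)) →L[ℝ] EucSp k × EucSp k :=
  ((ContinuousLinearMap.proj j.castSucc).comp (pathCLM k N)).prod
    ((ContinuousLinearMap.proj j.succ).comp (pathCLM k N))

theorem edgeCLM_apply (j : Fin (N + 1)) (w : EucSp k × (EucSp k × (Fin N → EucSp k))) :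
    edgeCLM k N j w =
      (brokenPath w.2.1 w.2.2 w.1 j.castSucc, brokenPath w.2.1 w.2.2 w.1 j.succ) := rfl

/-- The sum of the functions `S j` over the edges of a broken geodesic. -/
noncomputable def pathSum (S : Fin (N + 1) → EucSp k → EucSp k → ℝ)
    (w : EucSp k × (EucSp k × (Fin N → EucSp k))) : ℝ :=
  ∑ j, S j (edgeCLM k N j w).1 (edgeCLM k N j w).2

theorem gradient_eq_of_hasFDerivAt {f : EucSp k → ℝ} {D : EucSp k →L[ℝ] ℝ} {x g : EucSp k}
    (h : HasFDerivAt f D x) (hD : ∀ v, D v = inner ℝ g v) : gradient f x = g := by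
  have : D = InnerProductSpace.toDual ℝ _ g := ContinuousLinearMap.ext fun v => by
    rw [hD]; rfl
  rw [this] at h
  exact HasGradientAt.gradient h

/-- The linear form `(a, u) ↦ ⟨c₀, a⟩ + ∑ ⟨c i, u i⟩`. -/
noncomputable def paramForm (c₀ : EucSp k) (c : Fin N → EucSp k) :
    EucSp k × (Fin N → EucSp k) →L[ℝ] ℝ :=
  (innerSL ℝ c₀).comp (ContinuousLinearMap.fst ℝ _ _) +
    ∑ i, (innerSL ℝ (c i)).comp
      ((ContinuousLinearMap.proj i).comp (ContinuousLinearMap.snd ℝ _ _))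

theorem paramForm_apply (c₀ : EucSp k) (c : Fin N → EucSp k)
    (v : EucSp k × (Fin N → EucSp k)) :
    paramForm c₀ c v = inner ℝ c₀ v.1 + ∑ i, inner ℝ (c i) (v.2 i) := by
  simp [paramForm]

theorem paramForm_eq_zero_iff {c₀ : EucSp k} {c : Fin N → EucSp k} :
    paramForm c₀ c = 0 ↔ c₀ = 0 ∧ ∀ i, c i = 0 := by
  constructor
  · intro h
    have h1 := DFunLike.congr_fun h (c₀, c)
    rw [paramForm_apply] at h1
    simp only [zero_apply] at h1
    have h2 : ∀ i ∈ Finset.univ, 0 ≤ inner ℝ (c i) (c i) := fun i _ => real_inner_self_nonneg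
    have h3 := Finset.sum_nonneg h2
    have h4 : 0 ≤ inner ℝ c₀ c₀ := real_inner_self_nonneg
    have h5 : ∑ i, inner ℝ (c i) (c i) = 0 := by linarith
    refine ⟨inner_self_eq_zero.1 (by linarith : inner ℝ c₀ c₀ = 0), fun i => ?_⟩
    exact inner_self_eq_zero.1 ((Finset.sum_eq_zero_iff_of_nonneg h2).1 h5 i (Finset.mem_univ i))
  · rintro ⟨rfl, h⟩
    refine ContinuousLinearMap.ext fun v => ?_
    simp [paramForm_apply, h]

theorem exists_eq_paramForm (ℓ : EucSp k × (Fin N → EucSp k) →L[ℝ] ℝ) :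
    ∃ c₀ c, ℓ = paramForm c₀ c := by
  refine ⟨(InnerProductSpace.toDual ℝ _).symm (ℓ.comp (ContinuousLinearMap.inl ℝ _ _)),
    fun i => (InnerProductSpace.toDual ℝ _).symm ((ℓ.comp (ContinuousLinearMap.inr ℝ _ _)).comp
      (ContinuousLinearMap.single ℝ (fun _ : Fin N => EucSp k) i)), ContinuousLinearMap.ext fun v => ?_⟩
  rw [paramForm_apply]
  simp only [InnerProductSpace.toDual_symm_apply]
  simp only [ContinuousLinearMap.comp_apply, ContinuousLinearMap.inl_apply]
  have h1 : ∑ i, ℓ (ContinuousLinearMap.inr ℝ (EucSp k) (Fin N → EucSp k)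
      (ContinuousLinearMap.single ℝ (fun _ : Fin N => EucSp k) i (v.2 i))) = ℓ (0, v.2) := by
    rw [← map_sum, ← map_sum]
    exact congrArg (fun u => ℓ (0, u)) (Finset.univ_sum_single v.2)
  rw [h1, ← map_add]
  simp

variable {S : Fin (N + 1) → EucSp k → EucSp k → ℝ}
  {φ : Fin (N + 1) → EucSp k × EucSp k → EucSp k × EucSp k}
  {P p : Fin (N + 1) → EucSp k × EucSp k → EucSp k}
  (hS : ∀ j, IsTwistGF (S j) (φ j) (P j) (p j))
include hS

theorem contDiff_pathSum : ContDiff ℝ 2 (pathSum S) :=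
  ContDiff.sum fun j _ => (hS j).contDiff.comp (edgeCLM k N j).contDiff

/-- Collecting the forms `p dY - P dX` of the edges vertex by vertex: an inner vertex receives the
arriving momentum minus the departing one, the two end vertices a single term each. -/
theorem hasFDerivAt_pathSum (w : EucSp k × (EucSp k × (Fin N → EucSp k))) :
    HasFDerivAt (pathSum S)
      ((innerSL ℝ (p (Fin.last N) (edgeCLM k N (Fin.last N) w))).comp
        (ContinuousLinearMap.fst ℝ _ _) +
      (paramForm (-(P 0 (edgeCLM k N 0 w))) (fun i =>
        p i.castSucc (edgeCLM k N i.castSucc w) - P i.succ (edgeCLM k N i.succ w))).comp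
        (ContinuousLinearMap.snd ℝ _ _)) w := by
  have h1 : HasFDerivAt (pathSum S) (∑ j, (sympForm (p j (edgeCLM k N j w),
      P j (edgeCLM k N j w))).comp (edgeCLM k N j)) w :=
    HasFDerivAt.fun_sum fun j _ => ((hS j).hasFDerivAt _).comp w (edgeCLM k N j).hasFDerivAt
  refine h1.congr_fderiv (ContinuousLinearMap.ext fun v => ?_)
  have hv : ∀ j, edgeCLM k N j v = _ := fun j => edgeCLM_apply j v
  simp only [sum_apply, ContinuousLinearMap.comp_apply, sympForm_apply, hv, add_apply, paramForm_apply,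
    ContinuousLinearMap.coe_fst', ContinuousLinearMap.coe_snd', innerSL_apply_apply]
  -- The sum of final momenta splits off the last edge, that of initial momenta the first, so that
  -- both remaining sums run over the inner vertices.
  rw [Finset.sum_sub_distrib, Fin.sum_univ_castSucc]
  conv_lhs => rw [Fin.sum_univ_succ (n := N)]
  simp only [brokenPath_castSucc_succ, brokenPath_succ_castSucc, Fin.succ_last, brokenPath_last,
    Fin.castSucc_zero, brokenPath_zero, inner_sub_left, Finset.sum_sub_distrib, inner_neg_left]
  ring

variable {Φ : Fin (N + 2) → EucSp k × EucSp k → EucSp k × EucSp k}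
  (hΦ0 : ∀ z, Φ 0 z = z) (hΦ : ∀ j z, Φ (Fin.succ j) z = φ j (Φ j.castSucc z))

/-- Following the trajectory along a broken geodesic without corners; `c` are impulses, which
are added to the momenta at the vertices. -/
theorem eq_edge_of_no_corner {w : EucSp k × (EucSp k × (Fin N → EucSp k))}
    (hc : ∀ i : Fin N, p i.castSucc (edgeCLM k N i.castSucc w) = P i.succ (edgeCLM k N i.succ w))
    {z : Fin (N + 2) → EucSp k × EucSp k} (h0 : z 0 = (w.2.1, P 0 (edgeCLM k N 0 w)))
    (hz : ∀ j, z (Fin.succ j) = φ j (z j.castSucc)) :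
    (∀ j : Fin (N + 1), z j.castSucc = ((edgeCLM k N j w).1, P j (edgeCLM k N j w))) ∧
      z (Fin.last (N + 1)) = (w.1, p (Fin.last N) (edgeCLM k N (Fin.last N) w)) := by
  have hstep : ∀ j : Fin (N + 1), φ j ((edgeCLM k N j w).1, P j (edgeCLM k N j w)) =
      ((edgeCLM k N j w).2, p j (edgeCLM k N j w)) := fun j =>
    ((hS j).flow_iff _ _ _ _).2 ⟨rfl, rfl⟩
  have h1 : ∀ j : Fin (N + 1), z j.castSucc = ((edgeCLM k N j w).1, P j (edgeCLM k N j w)) := by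
    intro j
    induction j using Fin.induction with
    | zero => simpa [edgeCLM_apply] using h0
    | succ i ih =>
      rw [← Fin.succ_castSucc, hz, ih, hstep, hc]
      refine Prod.ext ?_ rfl
      simp [edgeCLM_apply]
  refine ⟨h1, ?_⟩
  rw [← Fin.succ_last, hz, h1, hstep]
  refine Prod.ext ?_ rfl
  simp [edgeCLM_apply]

include hΦ0 hΦ

/-- A trajectory is cut at the nodes into segments whose momenta match; conversely, segments with
matching momenta join to a trajectory. -/
theorem exists_no_corner_iff (X Q x q : EucSp k) : Φ (Fin.last (N + 1)) (X, Q) = (x, q) ↔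
    ∃ U : Fin N → EucSp k,
      (∀ i : Fin N, p i.castSucc (edgeCLM k N i.castSucc (x, X, U)) =
        P i.succ (edgeCLM k N i.succ (x, X, U))) ∧
      Q = P 0 (edgeCLM k N 0 (x, X, U)) ∧
      q = p (Fin.last N) (edgeCLM k N (Fin.last N) (x, X, U)) := by
  constructor
  · intro h
    set Z : Fin (N + 2) → EucSp k := fun j => (Φ j (X, Q)).1 with hZ
    have hX : Z 0 = X := by simp [hZ, hΦ0]
    have hx : Z (Fin.last (N + 1)) = x := by simp [hZ, h]
    have he : ∀ j : Fin (N + 1), edgeCLM k N j (x, X, fun i => Z i.castSucc.succ) =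
        (Z j.castSucc, Z j.succ) := fun j => by
      rw [edgeCLM_apply]
      simp only [← hX, ← hx, brokenPath_eta]
    have hm : ∀ j : Fin (N + 1), (Φ j.castSucc (X, Q)).2 = P j (Z j.castSucc, Z j.succ) ∧
        (Φ j.succ (X, Q)).2 = p j (Z j.castSucc, Z j.succ) := fun j =>
      ((hS j).flow_iff _ _ _ _).1 (by rw [hZ]; simp only [Prod.mk.eta]; rw [hΦ])
    refine ⟨fun i => Z i.castSucc.succ, fun i => ?_, ?_, ?_⟩
    · rw [he, he, ← (hm _).2, ← (hm _).1, Fin.succ_castSucc]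
    · rw [he, ← (hm _).1]; simp [hΦ0]
    · rw [he, ← (hm _).2, Fin.succ_last, h]
  · rintro ⟨U, hc, rfl, rfl⟩
    exact (eq_edge_of_no_corner hS hc (z := fun j => Φ j (X, P 0 (edgeCLM k N 0 (x, X, U))))
      (hΦ0 _) (fun j => hΦ j _)).2

theorem generatesMap_pathSum :
    GeneratesMap (fun X x (U : Fin N → EucSp k) => pathSum S (x, X, U))
      (Φ (Fin.last (N + 1))) := by
  intro X Q x q
  rw [exists_no_corner_iff hS hΦ0 hΦ]
  refine exists_congr fun U => ?_
  have hd := hasFDerivAt_pathSum hS (x, X, U)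
  have i1 : HasFDerivAt (fun V : Fin N → EucSp k => (x, X, V))
      ((ContinuousLinearMap.inr ℝ _ _).comp (ContinuousLinearMap.inr ℝ _ _)) U :=
    (hasFDerivAt_prodMk_right x (X, U)).comp U (hasFDerivAt_prodMk_right X U)
  have i2 : HasFDerivAt (fun X' : EucSp k => (x, X', U))
      ((ContinuousLinearMap.inr ℝ _ _).comp (ContinuousLinearMap.inl ℝ _ _)) X :=
    (hasFDerivAt_prodMk_right x (X, U)).comp X (hasFDerivAt_prodMk_left X U)
  have i3 : HasFDerivAt (fun x' : EucSp k => (x', X, U)) (ContinuousLinearMap.inl ℝ _ _) x :=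
    hasFDerivAt_prodMk_left x (X, U)
  have e1 := hd.comp U i1
  have g2 := gradient_eq_of_hasFDerivAt (g := -(P 0 (edgeCLM k N 0 (x, X, U)))) (hd.comp X i2)
    (fun v => by simp [paramForm_apply])
  have g3 := gradient_eq_of_hasFDerivAt (g := p (Fin.last N) (edgeCLM k N (Fin.last N) (x, X, U)))
    (hd.comp x i3) (fun v => by simp [paramForm_apply])
  have e2 : fderiv ℝ (fun V : Fin N → EucSp k => pathSum S (x, X, V)) U = 0 ↔
      ∀ i : Fin N, p i.castSucc (edgeCLM k N i.castSucc (x, X, U)) =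
        P i.succ (edgeCLM k N i.succ (x, X, U)) := by
    have e3 : fderiv ℝ (fun V : Fin N → EucSp k => pathSum S (x, X, V)) U =
        (paramForm 0 (fun i => p i.castSucc (edgeCLM k N i.castSucc (x, X, U)) -
          P i.succ (edgeCLM k N i.succ (x, X, U)))).comp (ContinuousLinearMap.inr ℝ _ _) := by
      refine e1.fderiv.trans (ContinuousLinearMap.ext fun v => ?_)
      simp [paramForm_apply]
    rw [e3]
    constructor
    · intro h0 i
      have h1 : paramForm 0 (fun i => p i.castSucc (edgeCLM k N i.castSucc (x, X, U)) -
          P i.succ (edgeCLM k N i.succ (x, X, U))) = 0 := by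
        refine ContinuousLinearMap.ext fun v => ?_
        have := DFunLike.congr_fun h0 v.2
        simpa [paramForm_apply] using this
      exact sub_eq_zero.1 ((paramForm_eq_zero_iff.1 h1).2 i)
    · intro h
      have h1 := paramForm_eq_zero_iff.2 ⟨rfl, fun i => sub_eq_zero.2 (h i)⟩
      rw [h1, ContinuousLinearMap.zero_comp]
  rw [e2]
  have g2' : gradient (fun X' => pathSum S (x, X', U)) X = -(P 0 (edgeCLM k N 0 (x, X, U))) := g2
  have g3' : gradient (fun x' => pathSum S (x', X, U)) x =
    p (Fin.last N) (edgeCLM k N (Fin.last N) (x, X, U)) := g3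
  rw [g2', g3', neg_neg]

omit hΦ0 hΦ

theorem fderiv_add_pathSum {σ : EucSp k → ℝ} (hσ : Differentiable ℝ σ)
    (w : EucSp k × (EucSp k × (Fin N → EucSp k))) :
    fderiv ℝ (fun q : EucSp k × (Fin N → EucSp k) => σ q.1 + pathSum S (w.1, q)) w.2 =
      paramForm (gradient σ w.2.1 - P 0 (edgeCLM k N 0 w)) (fun i =>
        p i.castSucc (edgeCLM k N i.castSucc w) - P i.succ (edgeCLM k N i.succ w)) := by
  have i1 : HasFDerivAt (fun q : EucSp k × (Fin N → EucSp k) => (w.1, q))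
      (ContinuousLinearMap.inr ℝ _ _) w.2 := hasFDerivAt_prodMk_right w.1 w.2
  have d1 := HasFDerivAt.comp w.2 (hasFDerivAt_pathSum hS w) i1
  have d2 : HasFDerivAt (fun q : EucSp k × (Fin N → EucSp k) => σ q.1) _ w.2 :=
    (hσ w.2.1).hasFDerivAt.comp w.2 hasFDerivAt_fst
  refine (d2.add d1).fderiv.trans (ContinuousLinearMap.ext fun v => ?_)
  simp [paramForm_apply, inner_sub_left]
  ring

include hΦ0 hΦ in
theorem generatesSet_add_pathSum {σ : EucSp k → ℝ} (hσ : Differentiable ℝ σ) :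
    GeneratesSet (fun x (q : EucSp k × (Fin N → EucSp k)) => σ q.1 + pathSum S (x, q))
      (Φ (Fin.last (N + 1)) '' range fun ξ => (ξ, gradient σ ξ)) := by
  ext ⟨x, q⟩
  have hgrad : ∀ w : EucSp k × (Fin N → EucSp k),
      gradient (fun x' => σ w.1 + pathSum S (x', w)) x =
        p (Fin.last N) (edgeCLM k N (Fin.last N) (x, w)) := fun w => by
    have i3 : HasFDerivAt (fun x' : EucSp k => (x', w)) (ContinuousLinearMap.inl ℝ _ _) x :=
      hasFDerivAt_prodMk_left x w
    have d := (HasFDerivAt.comp x (hasFDerivAt_pathSum hS (x, w)) i3).const_add (σ w.1)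
    exact gradient_eq_of_hasFDerivAt d (fun v => by simp)
  have hcrit : ∀ w : EucSp k × (Fin N → EucSp k),
      fderiv ℝ (fun q : EucSp k × (Fin N → EucSp k) => σ q.1 + pathSum S (x, q)) w = 0 ↔
        gradient σ w.1 = P 0 (edgeCLM k N 0 (x, w)) ∧
          ∀ i : Fin N, p i.castSucc (edgeCLM k N i.castSucc (x, w)) =
            P i.succ (edgeCLM k N i.succ (x, w)) := fun w => by
    have := fderiv_add_pathSum hS hσ (x, w)
    simp only at this
    rw [this, paramForm_eq_zero_iff]
    simp only [sub_eq_zero]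
  simp only [mem_image, mem_range, exists_exists_eq_and, mem_ofPred_eq, hcrit,
    exists_no_corner_iff hS hΦ0 hΦ, Prod.exists]
  refine exists_congr fun ξ => exists_congr fun U => ?_
  have hg := hgrad (ξ, U)
  simp only at hg
  rw [hg]
  tauto

/-- Given a covector `(c₀, c)`, follow from `ξ` the trajectory with initial momentum `dσ(ξ) - l c₀`
and subtract `l c i` from the momentum at the `i`-th inner vertex, with no impulse at the last one.
The resulting curve of broken geodesics starts at the critical point, and along it the parameter
derivative equals `l (c₀, c)`, so its velocity is the preimage sought. -/
theorem zeroIsRegularValue_add_pathSum (hφ : ∀ j, ContDiff ℝ 1 (φ j)) {σ : EucSp k → ℝ}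
    (hσ : ContDiff ℝ 2 σ) :
    ZeroIsRegularValue (fun x (q : EucSp k × (Fin N → EucSp k)) => σ q.1 + pathSum S (x, q)) := by
  intro w hw ℓ
  have hσd : Differentiable ℝ σ := hσ.differentiable (by simp)
  obtain ⟨c₀, c, rfl⟩ := exists_eq_paramForm ℓ
  simp only [fderiv_add_pathSum hS hσd] at hw ⊢
  obtain ⟨h0, hc⟩ := paramForm_eq_zero_iff.1 hw
  simp only [sub_eq_zero] at h0 hc
  set F : EucSp k × (EucSp k × (Fin N → EucSp k)) → (EucSp k × (Fin N → EucSp k) →L[ℝ] ℝ) :=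
    fun w => paramForm (gradient σ w.2.1 - P 0 (edgeCLM k N 0 w)) (fun i =>
        p i.castSucc (edgeCLM k N i.castSucc w) - P i.succ (edgeCLM k N i.succ w)) with hF
  -- `F` is the restriction to the parameter directions of the total derivative of a `C^2` function.
  have hFd : DifferentiableAt ℝ F w := by
    have hG : ContDiff ℝ (1 + 1) (fun w : EucSp k × (EucSp k × (Fin N → EucSp k)) =>
        σ w.2.1 + pathSum S w) := by
      rw [one_add_one_eq_two]
      exact (hσ.comp (contDiff_fst.comp contDiff_snd)).add (contDiff_pathSum hS)
    have hG1 : Differentiable ℝ (fderiv ℝ (fun w : EucSp k × (EucSp k × (Fin N → EucSp k)) =>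
        σ w.2.1 + pathSum S w)) := (hG.fderiv_right le_rfl).differentiable (by simp)
    have hFe : F = fun w => (fderiv ℝ (fun w : EucSp k × (EucSp k × (Fin N → EucSp k)) =>
        σ w.2.1 + pathSum S w) w).comp (ContinuousLinearMap.inr ℝ _ _) := by
      funext v
      exact (fderiv_add_pathSum hS hσd v).symm.trans (HasFDerivAt.comp (f := fun q => (v.1, q)) v.2
        ((hG.differentiable (by simp) v).hasFDerivAt)
        (hasFDerivAt_prodMk_right v.1 v.2)).fderiv
    rw [hFe]
    exact (hG1 w).clm_comp (differentiableAt_const _)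
  -- trajectories with small impulses at the vertices
  let c' : Fin (N + 1) → EucSp k := Fin.snoc (α := fun _ => EucSp k) c 0
  let z : Fin (N + 2) → ℝ → EucSp k × EucSp k := fun j l =>
    Fin.induction (motive := fun _ => EucSp k × EucSp k) (w.2.1, gradient σ w.2.1 - l • c₀)
      (fun j y => φ j y - (0, l • c' j)) j
  have hz0 : ∀ l, z 0 l = (w.2.1, gradient σ w.2.1 - l • c₀) := fun l => rfl
  have hzs : ∀ j l, z (Fin.succ j) l = φ j (z j.castSucc l) - (0, l • c' j) := fun j l => by
    simp only [z, Fin.induction_succ]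
  have hzd : ∀ j, ContDiff ℝ 1 (z j) := by
    intro j
    induction j using Fin.induction with
    | zero =>
      have : z 0 = fun l => (w.2.1, gradient σ w.2.1 - l • c₀) := funext hz0
      rw [this]
      fun_prop
    | succ j ih =>
      have : z j.succ = fun l => φ j (z j.castSucc l) - (0, l • c' j) := funext (hzs j)
      rw [this]
      have h1 : ContDiff ℝ 1 (fun l : ℝ => ((0 : EucSp k), l • c' j)) := by fun_prop
      exact ((hφ j).comp ih).sub h1
  let s : ℝ → EucSp k × (EucSp k × (Fin N → EucSp k)) := fun l =>
    ((z (Fin.last (N + 1)) l).1, (z 0 l).1, fun i => (z i.castSucc.succ l).1)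
  have hsd : DifferentiableAt ℝ s 0 := by
    have h1 : ContDiff ℝ 1 s :=
      (contDiff_fst.comp (hzd _)).prodMk ((contDiff_fst.comp (hzd _)).prodMk
        (contDiff_pi.2 fun i => contDiff_fst.comp (hzd _)))
    exact h1.differentiable (by simp) 0
  have he : ∀ l j, edgeCLM k N j (s l) = ((z j.castSucc l).1, (z j.succ l).1) := fun l j => by
    have := brokenPath_eta fun j => (z j l).1
    simp only [edgeCLM_apply, s, this]
  -- Adding the impulse back gives the momentum with which the segment arrives, which is what the
  -- generating function sees.
  have hm : ∀ l j, (z (Fin.castSucc j) l).2 = P j (edgeCLM k N j (s l)) ∧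
      (z (Fin.succ j) l).2 + l • c' j = p j (edgeCLM k N j (s l)) := fun l j => by
    rw [he]
    refine ((hS j).flow_iff _ _ _ _).1 ?_
    rw [hzs]
    refine Prod.ext ?_ ?_ <;> simp
  have hFs : ∀ l, F (s l) = l • paramForm c₀ c := by
    intro l
    refine ContinuousLinearMap.ext fun v => ?_
    have e1 : gradient σ (s l).2.1 - P 0 (edgeCLM k N 0 (s l)) = l • c₀ := by
      rw [← (hm l 0).1]
      simp [s, hz0]
    have e2 : ∀ i : Fin N, p i.castSucc (edgeCLM k N i.castSucc (s l)) -
        P i.succ (edgeCLM k N i.succ (s l)) = l • c i := fun i => by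
      rw [← (hm l _).2, ← (hm l _).1, Fin.succ_castSucc]
      simp [c']
    simp only [hF, e1, e2, paramForm_apply, inner_smul_left, smul_apply,
      smul_eq_mul, mul_add, Finset.mul_sum, conj_trivial]
  have hs0 : s 0 = w := by
    obtain ⟨h1, h2⟩ := eq_edge_of_no_corner hS hc (z := fun j => z j 0) (by simp [hz0, h0])
      (fun j => by simp [hzs])
    refine Prod.ext ?_ (Prod.ext ?_ (funext fun i => ?_))
    · simp [s, h2]
    · simp [s, hz0]
    · simp only [s]
      rw [Fin.succ_castSucc, h1]
      simp [edgeCLM_apply]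
  refine ⟨deriv s 0, ?_⟩
  have d1 : HasDerivAt (fun l => F (s l)) (fderiv ℝ F w (deriv s 0)) 0 := by
    have h3 : HasFDerivAt F (fderiv ℝ F w) (s 0) := by rw [hs0]; exact hFd.hasFDerivAt
    exact h3.comp_hasDerivAt 0 hsd.hasDerivAt
  have d2 : HasDerivAt (fun l => F (s l)) (paramForm c₀ c) 0 := by
    simp only [hFs]
    simpa using (hasDerivAt_id (0 : ℝ)).smul_const (paramForm c₀ c)
  exact d1.unique d2

end BrokenPath

/-! ### Bounded Lipschitz perturbations of a quadratic form -/

section NormalForm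

/-- A smooth function on `ℝ` which vanishes for `y ≤ 1` and is `1 / y` for `2 ≤ y`. -/
noncomputable def cutInv (y : ℝ) : ℝ := Real.smoothTransition (y - 1) * y⁻¹

theorem cutInv_of_le {y : ℝ} (h : y ≤ 1) : cutInv y = 0 := by
  rw [cutInv, Real.smoothTransition.zero_of_nonpos (by linarith), zero_mul]

theorem cutInv_of_ge {y : ℝ} (h : 2 ≤ y) : cutInv y = y⁻¹ := by
  rw [cutInv, Real.smoothTransition.one_of_one_le (by linarith), one_mul]

theorem abs_cutInv_le {y : ℝ} (hy : 0 < y) : |cutInv y| ≤ y⁻¹ := by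
  rw [cutInv, abs_mul, abs_of_nonneg (Real.smoothTransition.nonneg _), abs_of_pos (inv_pos.2 hy)]
  exact mul_le_of_le_one_left (inv_pos.2 hy).le (Real.smoothTransition.le_one _)

theorem contDiff_cutInv : ContDiff ℝ 1 cutInv := by
  rw [contDiff_iff_contDiffAt]
  intro y
  rcases eq_or_ne y 0 with rfl | hy
  · have : cutInv =ᶠ[nhds 0] fun _ => 0 := by
      filter_upwards [Iio_mem_nhds (zero_lt_one' ℝ)] with y hy
      exact cutInv_of_le hy.le
    exact contDiffAt_const.congr_of_eventuallyEq this
  · exact (Real.smoothTransition.contDiff.comp (contDiff_id.sub contDiff_const)).contDiffAt.mul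
      (contDiffAt_inv ℝ hy)

/-- For large `y` the expression is `-1 / y`. It is needed because the derivative of `cutInv (η ⬝ᵥ
η) • η` contains `cutInv'` multiplied by two factors of size `‖η‖`. -/
theorem exists_bound_mul_deriv_cutInv : ∃ B, 0 ≤ B ∧ ∀ y, 0 ≤ y → |y * deriv cutInv y| ≤ B := by
  have hc : Continuous fun y => y * deriv cutInv y :=
    continuous_id.mul (contDiff_cutInv.continuous_deriv (by simp))
  obtain ⟨C, hC⟩ := (isCompact_Icc (a := (0 : ℝ)) (b := 2)).exists_bound_of_continuousOn
    hc.continuousOn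
  refine ⟨max C 1, le_max_of_le_right zero_le_one, fun y hy => ?_⟩
  rcases le_or_gt y 2 with h | h
  · exact (hC y ⟨hy, h⟩).trans (le_max_left _ _)
  · have h1 : cutInv =ᶠ[nhds y] fun y => y⁻¹ := by
      filter_upwards [Ioi_mem_nhds h] with x hx
      exact cutInv_of_ge (le_of_lt hx)
    rw [h1.deriv_eq, deriv_inv]
    refine le_trans ?_ (le_max_right _ _)
    have h2 : y * -(y ^ 2)⁻¹ = -y⁻¹ := by field_simp
    rw [h2, abs_neg, abs_of_pos (by positivity)]
    exact inv_le_one_of_one_le₀ (by linarith)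

variable {ι : Type*} [Fintype ι]

theorem sq_norm_le_dotProduct (η : ι → ℝ) : ‖η‖ ^ 2 ≤ η ⬝ᵥ η := by
  have h0 : 0 ≤ η ⬝ᵥ η := Finset.sum_nonneg fun i _ => mul_self_nonneg _
  have h1 : ‖η‖ ≤ Real.sqrt (η ⬝ᵥ η) := by
    refine (pi_norm_le_iff_of_nonneg (Real.sqrt_nonneg _)).2 fun i => ?_
    rw [Real.norm_eq_abs]
    refine Real.abs_le_sqrt ?_
    rw [sq]
    exact Finset.single_le_sum (f := fun i => η i * η i) (fun i _ => mul_self_nonneg _)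
      (Finset.mem_univ i)
  calc ‖η‖ ^ 2 ≤ Real.sqrt (η ⬝ᵥ η) ^ 2 := by gcongr
    _ = η ⬝ᵥ η := Real.sq_sqrt h0

theorem abs_dotProduct_le (a b : ι → ℝ) : |a ⬝ᵥ b| ≤ Fintype.card ι * ‖a‖ * ‖b‖ := by
  refine (Finset.abs_sum_le_sum_abs _ _).trans ?_
  have : ∀ i ∈ Finset.univ, |a i * b i| ≤ ‖a‖ * ‖b‖ := fun i _ => by
    rw [abs_mul]
    exact mul_le_mul (norm_le_pi_norm a i) (norm_le_pi_norm b i) (abs_nonneg _) (norm_nonneg _)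
  refine (Finset.sum_le_sum this).trans ?_
  simp [mul_assoc]

theorem contDiff_dotProduct {E : Type*} [NormedAddCommGroup E] [NormedSpace ℝ E]
    {n : WithTop ℕ∞} {a b : E → ι → ℝ} (ha : ContDiff ℝ n a) (hb : ContDiff ℝ n b) :
    ContDiff ℝ n fun x => a x ⬝ᵥ b x :=
  ContDiff.sum fun i _ => (contDiff_pi.1 ha i).mul (contDiff_pi.1 hb i)

/-- A cut-off version of the inversion `η ↦ η / |η|²`. The norm of `ι → ℝ` is the sup norm, so `η ⬝ᵥ
η` serves as the smooth square of the length. -/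
theorem exists_cut_inversion_lipschitz (ι : Type*) [Fintype ι] :
    ∃ (v : (ι → ℝ) → ι → ℝ) (B : ℝ), 0 ≤ B ∧ ContDiff ℝ 1 v ∧ (∀ η, ‖v η‖ ≤ 1) ∧
      (∀ η η', ‖v η - v η'‖ ≤ B * ‖η - η'‖) ∧ ∀ η, 2 ≤ ‖η‖ → v η = (η ⬝ᵥ η)⁻¹ • η := by
  obtain ⟨B, hB, hb⟩ := exists_bound_mul_deriv_cutInv
  have hn : ContDiff ℝ 1 fun η : ι → ℝ => η ⬝ᵥ η := contDiff_dotProduct contDiff_id contDiff_id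
  have hn0 : ∀ η : ι → ℝ, 0 ≤ η ⬝ᵥ η := fun η => Finset.sum_nonneg fun i _ => mul_self_nonneg _
  have hk1 : ∀ y, 0 ≤ y → |cutInv y| ≤ 1 := fun y _ => by
    rcases le_or_gt y 1 with h | h
    · simp [cutInv_of_le h]
    · exact (abs_cutInv_le (by linarith)).trans (inv_le_one_of_one_le₀ h.le)
  refine ⟨fun η => cutInv (η ⬝ᵥ η) • η, 2 * Fintype.card ι * B + 1, by positivity,
    (contDiff_cutInv.comp hn).smul contDiff_id, fun η => ?_, fun η η' => ?_, fun η hη => ?_⟩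
  · rw [norm_smul, Real.norm_eq_abs]
    rcases le_or_gt (η ⬝ᵥ η) 1 with h | h
    · simp [cutInv_of_le h]
    · have h1 := abs_cutInv_le (zero_lt_one.trans h)
      have h2 := sq_norm_le_dotProduct η
      have h3 : ‖η‖ ≤ η ⬝ᵥ η := by nlinarith [norm_nonneg η, sq_nonneg (‖η‖ - 1)]
      calc |cutInv (η ⬝ᵥ η)| * ‖η‖ ≤ (η ⬝ᵥ η)⁻¹ * (η ⬝ᵥ η) := by gcongr
        _ = 1 := inv_mul_cancel₀ (by linarith)
  · let dn : (ι → ℝ) → (ι → ℝ) →L[ℝ] ℝ := fun η =>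
      ∑ i, (2 * η i) • ContinuousLinearMap.proj (R := ℝ) (φ := fun _ : ι => ℝ) i
    have hdn : ∀ η v, dn η v = 2 * (η ⬝ᵥ v) := fun η v => by
      simp [dn, dotProduct, Finset.mul_sum, mul_assoc]
    have hnd : ∀ η : ι → ℝ, HasFDerivAt (fun η : ι → ℝ => η ⬝ᵥ η) (dn η) η := fun η => by
      have h1 : HasFDerivAt (fun η : ι → ℝ => η ⬝ᵥ η) (∑ i,
          (η i • ContinuousLinearMap.proj (R := ℝ) (φ := fun _ : ι => ℝ) i +
            η i • ContinuousLinearMap.proj i)) η :=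
        HasFDerivAt.fun_sum fun i _ => (hasFDerivAt_apply i η).mul (hasFDerivAt_apply i η)
      refine h1.congr_fderiv (Finset.sum_congr rfl fun i _ => ?_)
      rw [← add_smul, two_mul]
    have hd : ∀ η : ι → ℝ, HasFDerivAt (fun η : ι → ℝ => cutInv (η ⬝ᵥ η) • η)
        (cutInv (η ⬝ᵥ η) • ContinuousLinearMap.id ℝ _ +
          (deriv cutInv (η ⬝ᵥ η) • dn η).smulRight η) η := fun η =>
      (((contDiff_cutInv.differentiable (by simp) _).hasDerivAt).comp_hasFDerivAt η (hnd η)).smul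
        (hasFDerivAt_id η)
    refine convex_univ.norm_image_sub_le_of_norm_hasFDerivWithin_le
      (fun w _ => (hd w).hasFDerivWithinAt) (fun w _ => ?_) (mem_univ η') (mem_univ η)
    refine ContinuousLinearMap.opNorm_le_bound _ (by positivity) fun u => ?_
    simp only [add_apply, smul_apply, ContinuousLinearMap.id_apply,
      ContinuousLinearMap.smulRight_apply, hdn, smul_eq_mul]
    refine (norm_add_le _ _).trans ?_
    rw [norm_smul, norm_smul, Real.norm_eq_abs, Real.norm_eq_abs, abs_mul, abs_mul, abs_two]
    have h1 := abs_dotProduct_le w u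
    have h2 := hb _ (hn0 w)
    rw [abs_mul, abs_of_nonneg (hn0 w)] at h2
    have h3 := sq_norm_le_dotProduct w
    have h4 : |cutInv (w ⬝ᵥ w)| * ‖u‖ ≤ 1 * ‖u‖ := by gcongr; exact hk1 _ (hn0 w)
    have h5 : |deriv cutInv (w ⬝ᵥ w)| * (2 * |w ⬝ᵥ u|) * ‖w‖ ≤
        2 * Fintype.card ι * B * ‖u‖ := by
      calc |deriv cutInv (w ⬝ᵥ w)| * (2 * |w ⬝ᵥ u|) * ‖w‖
          ≤ |deriv cutInv (w ⬝ᵥ w)| * (2 * (Fintype.card ι * ‖w‖ * ‖u‖)) * ‖w‖ := by gcongr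
        _ = 2 * Fintype.card ι * (‖w‖ ^ 2 * |deriv cutInv (w ⬝ᵥ w)|) * ‖u‖ := by ring
        _ ≤ 2 * Fintype.card ι * (w ⬝ᵥ w * |deriv cutInv (w ⬝ᵥ w)|) * ‖u‖ := by gcongr
        _ ≤ 2 * Fintype.card ι * B * ‖u‖ := by gcongr
    linarith
  · have h2 := sq_norm_le_dotProduct η
    simp only
    rw [cutInv_of_ge (by nlinarith)]

/-- Inversion is homogeneous of degree `-1`, so `l • v (l • η)` is again the inversion far out,
while its size is multiplied by `l` and its Lipschitz constant by `l²`; only the cutoff radius `2 /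
l` grows. -/
theorem exists_cut_inversion (ι : Type*) [Fintype ι] {δ : ℝ} (hδ : 0 < δ) :
    ∃ (v : (ι → ℝ) → ι → ℝ) (C : ℝ), 0 < C ∧ ContDiff ℝ 1 v ∧ (∀ η, ‖v η‖ ≤ δ) ∧
      (∀ η η', ‖v η - v η'‖ ≤ δ * ‖η - η'‖) ∧ ∀ η, C ≤ ‖η‖ → v η = (η ⬝ᵥ η)⁻¹ • η := by
  obtain ⟨v, B, hB, hv, h1, h2, h3⟩ := exists_cut_inversion_lipschitz ι
  set l := min δ (min 1 (δ / (B + 1))) with hl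
  have hl0 : 0 < l := by positivity
  have hl1 : l ≤ 1 := (min_le_right _ _).trans (min_le_left _ _)
  have hl2 : l * (B + 1) ≤ δ := by
    rw [← le_div_iff₀ (by positivity)]
    exact (min_le_right _ _).trans (min_le_right _ _)
  refine ⟨fun η => l • v (l • η), 2 / l, by positivity,
    (hv.comp (contDiff_id.const_smul l)).const_smul l, fun η => ?_, fun η η' => ?_, fun η hη => ?_⟩
  · rw [norm_smul, Real.norm_eq_abs, abs_of_pos hl0]
    calc l * ‖v (l • η)‖ ≤ l * 1 := by gcongr; exact h1 _
      _ ≤ δ := by rw [mul_one]; exact min_le_left _ _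
  · rw [← smul_sub, norm_smul, Real.norm_eq_abs, abs_of_pos hl0]
    have h4 := h2 (l • η) (l • η')
    rw [← smul_sub, norm_smul, Real.norm_eq_abs, abs_of_pos hl0] at h4
    calc l * ‖v (l • η) - v (l • η')‖ ≤ l * (B * (1 * ‖η - η'‖)) := by
          gcongr
          exact h4.trans (by gcongr)
      _ = l * B * ‖η - η'‖ := by ring
      _ ≤ δ * ‖η - η'‖ := by gcongr; nlinarith
  · have h4 : 2 ≤ ‖l • η‖ := by
      rw [norm_smul, Real.norm_eq_abs, abs_of_pos hl0]
      rwa [div_le_iff₀ hl0, mul_comm] at hη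
    simp only
    rw [h3 _ h4, smul_smul, smul_smul, smul_dotProduct, dotProduct_smul, smul_eq_mul, smul_eq_mul]
    congr 1
    field_simp

/-- The root `u` of `u + ½ y u² = 1` which is `1` at `y = 0`. -/
noncomputable def quadRoot (y : ℝ) : ℝ := 2 / (1 + Real.sqrt (1 + 2 * y))

theorem quadRoot_eq {y : ℝ} (hy : |y| ≤ 1 / 4) : quadRoot y + 1 / 2 * y * quadRoot y ^ 2 = 1 := by
  have h0 := (abs_le.1 hy).1
  have h1 : Real.sqrt (1 + 2 * y) ^ 2 = 1 + 2 * y := Real.sq_sqrt (by linarith)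
  have h2 : 0 < 1 + Real.sqrt (1 + 2 * y) := by positivity
  have h3 : y = (Real.sqrt (1 + 2 * y) ^ 2 - 1) / 2 := by rw [h1]; ring
  rw [quadRoot]
  set a := Real.sqrt (1 + 2 * y)
  rw [h3]
  field_simp
  ring

theorem abs_quadRoot_le (y : ℝ) : |quadRoot y| ≤ 2 := by
  have h2 := Real.sqrt_nonneg (1 + 2 * y)
  rw [quadRoot, abs_of_nonneg (by positivity), div_le_iff₀ (by positivity)]
  linarith

theorem abs_quadRoot_sub_le {y z : ℝ} (hy : |y| ≤ 1 / 4) (hz : |z| ≤ 1 / 4) :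
    |quadRoot y - quadRoot z| ≤ 4 * |y - z| := by
  have key : ∀ y : ℝ, |y| ≤ 1 / 4 → 1 / 2 ≤ Real.sqrt (1 + 2 * y) ∧
      Real.sqrt (1 + 2 * y) ^ 2 = 1 + 2 * y := fun y hy => by
    have h0 := (abs_le.1 hy).1
    exact ⟨Real.le_sqrt_of_sq_le (by norm_num; linarith), Real.sq_sqrt (by linarith)⟩
  obtain ⟨h1, h2⟩ := key y hy
  obtain ⟨h3, h4⟩ := key z hz
  rw [quadRoot, quadRoot]
  set a := Real.sqrt (1 + 2 * y)
  set c := Real.sqrt (1 + 2 * z)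
  have h5 : |a - c| ≤ 2 * |y - z| := by
    have h6 : (a - c) * (a + c) = 2 * (y - z) := by nlinarith
    have h7 : |a - c| * (a + c) = 2 * |y - z| := by
      rw [← abs_of_pos (by linarith : 0 < a + c), ← abs_mul, h6, abs_mul, abs_two]
    nlinarith [abs_nonneg (a - c)]
  have h8 : 2 / (1 + a) - 2 / (1 + c) = 2 * (c - a) / ((1 + a) * (1 + c)) := by
    field_simp
    ring
  rw [h8, abs_div, abs_mul, abs_two, abs_sub_comm c a,
    abs_of_pos (by positivity : 0 < (1 + a) * (1 + c)), div_le_iff₀ (by positivity)]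
  nlinarith [abs_nonneg (y - z), mul_nonneg (abs_nonneg (y - z)) (by nlinarith : 0 ≤ (1 + a) * (1 + c) - 1)]

/-- Write `Q(η) = ½ η·Bη` and `G = B⁻¹`. With `d = (r / |ζ|²) Gζ` one computes `Q(ζ + d) = Q(ζ) + r
+ ½ m r²`, where `m = ζ·Gζ / |ζ|⁴`, so `Q(ζ + d) = Q(ζ) + f` becomes a scalar quadratic equation,
solved by `r = f · quadRoot (f m)`. Replacing `ζ / |ζ|²` by a cut-off inversion with small bound and
small Lipschitz constant defines `d` everywhere with Lipschitz constant `1/2`. Then `ζ ↦ ζ + d` is a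
fibered diffeomorphism and `Ψ` is its inverse. No decay of `df` is needed, since the factor `1 /
|ζ|` supplies the smallness. -/
theorem exists_fibered_normal_form [DecidableEq ι] {k : ℕ} {B : Matrix ι ι ℝ} (hB : B.IsSymm)
    (hdet : IsUnit B.det) {f : EucSp k → (ι → ℝ) → ℝ}
    (hf : ContDiff ℝ 1 fun w : EucSp k × (ι → ℝ) => f w.1 w.2) (hper : ZPeriodic f) {M : ℝ}
    (hM : 0 ≤ M) (hbound : ∀ x η, |f x η| ≤ M)
    (hlip : ∀ x η η', |f x η - f x η'| ≤ M * ‖η - η'‖) :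
    ∃ Ψ : EucSp k → (ι → ℝ) → (ι → ℝ), IsFiberedDiffeo Ψ ∧ (∀ x η, ‖Ψ x η - η‖ ≤ 1) ∧
      ∃ C, 0 < C ∧ ∀ x η, C < ‖η‖ →
        1 / 2 * (Ψ x η ⬝ᵥ B.mulVec (Ψ x η)) + f x (Ψ x η) = 1 / 2 * (η ⬝ᵥ B.mulVec η) := by
  let G : (ι → ℝ) →L[ℝ] (ι → ℝ) := LinearMap.toContinuousLinearMap B⁻¹.mulVecLin
  have hG : ∀ η, G η = B⁻¹.mulVec η := fun η => rfl
  have hBG : ∀ η, B.mulVec (G η) = η := fun η => by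
    rw [hG, Matrix.mulVec_mulVec, Matrix.mul_nonsing_inv _ hdet, Matrix.one_mulVec]
  have hsymm : ∀ a c : ι → ℝ, a ⬝ᵥ B.mulVec c = B.mulVec a ⬝ᵥ c := fun a c => by
    rw [Matrix.dotProduct_mulVec, ← Matrix.mulVec_transpose, hB.eq]
  set c : ℝ := Fintype.card ι * ‖G‖ with hc
  have hc0 : 0 ≤ c := by positivity
  -- Two requirements fix `δ`: `7 M‖G‖δ ≤ 1/2` makes `d` a `1/2`-contraction (`7 = 2 + 5` from the
  -- bound and the Lipschitz constant of `r`), and `M c δ² ≤ 1/4` keeps `f m` where `quadRoot` is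
  -- controlled.
  set δ : ℝ := 1 / (14 * (M * ‖G‖) + 4 * (M * c) + 1) with hδ
  have hMG : 0 ≤ M * ‖G‖ := by positivity
  have hMc : 0 ≤ M * c := by positivity
  have hδ0 : 0 < δ := by positivity
  have hδe : (14 * (M * ‖G‖) + 4 * (M * c) + 1) * δ = 1 := by
    rw [hδ]; field_simp
  have hδ1 : δ ≤ 1 := by nlinarith [mul_nonneg hMG hδ0.le, mul_nonneg hMc hδ0.le]
  have hδ2 : 7 * (M * ‖G‖ * δ) ≤ 1 / 2 := by
    nlinarith [mul_nonneg hMG hδ0.le, mul_nonneg hMc hδ0.le]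
  have hδ3 : M * (c * δ * δ) ≤ 1 / 4 := by
    nlinarith [mul_nonneg hMG hδ0.le, mul_nonneg hMc hδ0.le]
  obtain ⟨v, C, hC, hv, hv1, hv2, hv3⟩ := exists_cut_inversion ι hδ0
  set m : (ι → ℝ) → ℝ := fun η => v η ⬝ᵥ G (v η) with hm
  have hGv1 : ∀ η, ‖G (v η)‖ ≤ ‖G‖ * δ := fun η =>
    (G.le_opNorm _).trans (by gcongr; exact hv1 η)
  have hGv2 : ∀ η η', ‖G (v η) - G (v η')‖ ≤ ‖G‖ * δ * ‖η - η'‖ := fun η η' => by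
    rw [← map_sub, mul_assoc]
    exact (G.le_opNorm _).trans (by gcongr; exact hv2 η η')
  have hm1 : ∀ η, |m η| ≤ c * δ * δ := fun η => by
    refine (abs_dotProduct_le _ _).trans ?_
    calc Fintype.card ι * ‖v η‖ * ‖G (v η)‖ ≤ Fintype.card ι * δ * (‖G‖ * δ) := by
          gcongr
          exacts [hv1 η, hGv1 η]
      _ = c * δ * δ := by rw [hc]; ring
  have hm2 : ∀ η η', |m η - m η'| ≤ 2 * (c * δ * δ) * ‖η - η'‖ := fun η η' => by
    have e1 : m η - m η' = (v η - v η') ⬝ᵥ G (v η) + v η' ⬝ᵥ (G (v η) - G (v η')) := by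
      simp only [hm, sub_dotProduct, dotProduct_sub]; ring
    rw [e1]
    refine (abs_add_le _ _).trans ?_
    have e2 : |(v η - v η') ⬝ᵥ G (v η)| ≤ Fintype.card ι * (δ * ‖η - η'‖) * (‖G‖ * δ) := by
      refine (abs_dotProduct_le _ _).trans ?_
      gcongr
      exacts [hv2 η η', hGv1 η]
    have e3 : |v η' ⬝ᵥ (G (v η) - G (v η'))| ≤
        Fintype.card ι * δ * (‖G‖ * δ * ‖η - η'‖) := by
      refine (abs_dotProduct_le _ _).trans ?_
      gcongr
      exacts [hv1 η', hGv2 η η']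
    rw [hc]
    linarith
  -- the displacement
  set r : EucSp k → (ι → ℝ) → ℝ := fun x η => f x η * quadRoot (f x η * m η) with hr
  have hy1 : ∀ x η, |f x η * m η| ≤ 1 / 4 := fun x η => by
    rw [abs_mul]
    exact (mul_le_mul (hbound x η) (hm1 η) (abs_nonneg _) hM).trans hδ3
  have hy2 : ∀ x η η', |f x η * m η - f x η' * m η'| ≤ 3 / 4 * ‖η - η'‖ := fun x η η' => by
    have e1 : f x η * m η - f x η' * m η' =
        f x η * (m η - m η') + (f x η - f x η') * m η' := by ring
    rw [e1]
    refine (abs_add_le _ _).trans ?_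
    rw [abs_mul, abs_mul]
    have e2 : |f x η| * |m η - m η'| ≤ M * (2 * (c * δ * δ) * ‖η - η'‖) :=
      mul_le_mul (hbound x η) (hm2 η η') (abs_nonneg _) hM
    have e3 : |f x η - f x η'| * |m η'| ≤ M * ‖η - η'‖ * (c * δ * δ) :=
      mul_le_mul (hlip x η η') (hm1 η') (abs_nonneg _) (by positivity)
    nlinarith [mul_le_mul_of_nonneg_right hδ3 (norm_nonneg (η - η'))]
  have hr1 : ∀ x η, |r x η| ≤ 2 * M := fun x η => by
    rw [hr]
    simp only [abs_mul]
    nlinarith [hbound x η, abs_quadRoot_le (f x η * m η), abs_nonneg (f x η),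
      abs_nonneg (quadRoot (f x η * m η))]
  have hr2 : ∀ x η η', |r x η - r x η'| ≤ 5 * M * ‖η - η'‖ := fun x η η' => by
    have e1 : r x η - r x η' = f x η * (quadRoot (f x η * m η) - quadRoot (f x η' * m η')) +
        (f x η - f x η') * quadRoot (f x η' * m η') := by simp only [hr]; ring
    rw [e1]
    refine (abs_add_le _ _).trans ?_
    rw [abs_mul, abs_mul]
    have e2 : |f x η| * |quadRoot (f x η * m η) - quadRoot (f x η' * m η')| ≤
        M * (4 * (3 / 4 * ‖η - η'‖)) :=
      mul_le_mul (hbound x η) ((abs_quadRoot_sub_le (hy1 x η) (hy1 x η')).trans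
        (by gcongr; exact hy2 x η η')) (abs_nonneg _) hM
    have e3 : |f x η - f x η'| * |quadRoot (f x η' * m η')| ≤ M * ‖η - η'‖ * 2 :=
      mul_le_mul (hlip x η η') (abs_quadRoot_le _) (abs_nonneg _) (by positivity)
    linarith
  set d : EucSp k → (ι → ℝ) → ι → ℝ := fun x η => r x η • G (v η) with hd
  have hd1 : ∀ x η, ‖d x η‖ ≤ 1 := fun x η => by
    rw [hd]
    simp only [norm_smul, Real.norm_eq_abs]
    have : |r x η| * ‖G (v η)‖ ≤ 2 * M * (‖G‖ * δ) :=
      mul_le_mul (hr1 x η) (hGv1 η) (norm_nonneg _) (by positivity)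
    linarith [mul_nonneg hMG hδ0.le]
  have hd2 : ∀ x η η', ‖d x η - d x η'‖ ≤ 1 / 2 * ‖η - η'‖ := fun x η η' => by
    have e1 : d x η - d x η' = r x η • (G (v η) - G (v η')) + (r x η - r x η') • G (v η') := by
      simp only [hd, smul_sub, sub_smul]; abel
    rw [e1]
    refine (norm_add_le _ _).trans ?_
    rw [norm_smul, norm_smul, Real.norm_eq_abs, Real.norm_eq_abs]
    have e2 : |r x η| * ‖G (v η) - G (v η')‖ ≤ 2 * M * (‖G‖ * δ * ‖η - η'‖) :=
      mul_le_mul (hr1 x η) (hGv2 η η') (norm_nonneg _) (by positivity)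
    have e3 : |r x η - r x η'| * ‖G (v η')‖ ≤ 5 * M * ‖η - η'‖ * (‖G‖ * δ) :=
      mul_le_mul (hr2 x η η') (hGv1 η') (norm_nonneg _) (by positivity)
    nlinarith [mul_le_mul_of_nonneg_right hδ2 (norm_nonneg (η - η'))]
  have hdc : ContDiff ℝ 1 fun w : EucSp k × (ι → ℝ) => d w.1 w.2 := by
    have c1 : ContDiff ℝ 1 fun w : EucSp k × (ι → ℝ) => G (v w.2) :=
      G.contDiff.comp (hv.comp contDiff_snd)
    have c2 : ContDiff ℝ 1 fun w : EucSp k × (ι → ℝ) => m w.2 :=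
      contDiff_dotProduct (hv.comp contDiff_snd) c1
    have c3 : ContDiff ℝ 1 fun w : EucSp k × (ι → ℝ) => quadRoot (f w.1 w.2 * m w.2) := by
      refine contDiff_const.div (contDiff_const.add (ContDiff.sqrt
        (contDiff_const.add (contDiff_const.mul (hf.mul c2))) fun w => ?_)) fun w => ?_
      · have := (abs_le.1 (hy1 w.1 w.2)).1
        exact (by linarith : 0 < 1 + 2 * (f w.1 w.2 * m w.2)).ne'
      · positivity
    exact (hf.mul c3).smul c1
  obtain ⟨e, he, hec, hec'⟩ := exists_fibered_equiv
    (g := fun w : EucSp k × (ι → ℝ) => w.2 + d w.1 w.2) (contDiff_snd.add hdc)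
    (fun x => bijective_id_add_of_lipschitz (hd2 x))
    (fun x => ⟨1 / 2, by norm_num, fun y y' => by
      have h1 : y + d x y - (y' + d x y') = (y - y') - (d x y' - d x y) := by abel
      have h2 := norm_sub_norm_le (y - y') (d x y' - d x y)
      have h3 := hd2 x y' y
      rw [norm_sub_rev y' y] at h3
      simp only [h1]
      linarith⟩)
  have hs1 : ∀ x η, e.symm (x, η) = (x, (e.symm (x, η)).2) := fun x η => by
    refine Prod.ext ?_ rfl
    have := congrArg Prod.fst (he (e.symm (x, η)))
    rw [e.apply_symm_apply] at this
    exact this.symm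
  have hs2 : ∀ x η, (e.symm (x, η)).2 + d x (e.symm (x, η)).2 = η := fun x η => by
    have := congrArg Prod.snd (he (e.symm (x, η)))
    rw [e.apply_symm_apply, hs1] at this
    exact this.symm
  have hdper : ∀ m x η, d (x + intVec m) η = d x η := fun m x η => by
    simp only [hd, hr, hper m x]
  refine ⟨fun x η => (e.symm (x, η)).2, ⟨fun n x => ?_, contDiff_snd.comp hec', fun x => ?_⟩,
    -- The displacement is at most `1`, so `‖η‖ > C + 1` places the preimage `ζ` where the cut-off
    -- inversion is exact.
    fun x η => ?_, C + 1, by positivity, fun x η hη => ?_⟩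
  · funext η
    have h1 : e.symm (x + intVec n, η) = (x + intVec n, (e.symm (x, η)).2) := by
      rw [Equiv.symm_apply_eq, he]
      simp only [hdper, hs2]
    simp only [h1]
  · have c1 : ContDiff ℝ 1 fun η : ι → ℝ => ((x, η) : EucSp k × (ι → ℝ)) :=
      contDiff_const.prodMk contDiff_id
    refine ⟨⟨fun η => (e.symm (x, η)).2, fun η => (e (x, η)).2, fun η => ?_, fun η => ?_⟩,
      fun _ => rfl, contDiff_snd.comp (hec'.comp c1), contDiff_snd.comp (hec.comp c1)⟩
    · simp only
      rw [← hs1, e.apply_symm_apply]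
    · simp only
      have h1 : (x, (e (x, η)).2) = e (x, η) := Prod.ext (by rw [he]) rfl
      rw [h1, e.symm_apply_apply]
  · have h1 := hs2 x η
    have h2 : (e.symm (x, η)).2 - η = -d x (e.symm (x, η)).2 := by
      nth_rw 2 [← h1]; abel
    rw [h2, norm_neg]
    exact hd1 _ _
  · simp only
    have h1 := hs2 x η
    set ζ := (e.symm (x, η)).2 with hζ
    have h2 : C ≤ ‖ζ‖ := by
      have h3 := norm_add_le ζ (d x ζ)
      rw [h1] at h3
      linarith [hd1 x ζ]
    have h4 : 0 < ζ ⬝ᵥ ζ := (pow_pos (hC.trans_le h2) 2).trans_le (sq_norm_le_dotProduct ζ)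
    have hvz := hv3 ζ h2
    have hGz : G (v ζ) = (ζ ⬝ᵥ ζ)⁻¹ • G ζ := by rw [hvz, map_smul]
    have hmz : m ζ = (ζ ⬝ᵥ G ζ) / (ζ ⬝ᵥ ζ) ^ 2 := by
      simp only [hm, hGz]
      rw [hvz, smul_dotProduct, dotProduct_smul, smul_eq_mul, smul_eq_mul]
      field_simp
    have hdz : d x ζ = (r x ζ / (ζ ⬝ᵥ ζ)) • G ζ := by
      simp only [hd, hGz, smul_smul]
      rfl
    -- The equation of `quadRoot` at `y = f m`, multiplied by `f`.
    have key : r x ζ + 1 / 2 * m ζ * r x ζ ^ 2 = f x ζ := by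
      have := quadRoot_eq (hy1 x ζ)
      simp only [hr]
      linear_combination f x ζ * this
    have e1 : ζ ⬝ᵥ B.mulVec (G ζ) = ζ ⬝ᵥ ζ := by rw [hBG]
    have e2 : G ζ ⬝ᵥ B.mulVec ζ = ζ ⬝ᵥ ζ := by rw [hsymm, hBG]
    have e3 : G ζ ⬝ᵥ B.mulVec (G ζ) = ζ ⬝ᵥ G ζ := by rw [hBG, dotProduct_comm]
    rw [← h1, hdz, Matrix.mulVec_add, Matrix.mulVec_smul, add_dotProduct, dotProduct_add,
      dotProduct_add, smul_dotProduct, smul_dotProduct, dotProduct_smul, dotProduct_smul, e1, e2,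
      e3, ← key, hmz]
    simp only [smul_eq_mul]
    field_simp
    ring

end NormalForm

/-! ### Invariance of the generated set under fibered changes of variables -/

section Fibered

variable {k : ℕ} {F F' : Type*} [NormedAddCommGroup F] [NormedSpace ℝ F] [NormedAddCommGroup F']
  [NormedSpace ℝ F']

/-- Surjectivity of the fibre derivative makes the critical conditions equivalent. At a critical
point the vertical derivative of `S` vanishes, so the dependence of `Φ x η` on `x` does not
contribute to the gradient. -/
theorem GeneratesSet.comp_fibered {S : EucSp k → F → ℝ} {Λ : Set (EucSp k × EucSp k)}
    (h : GeneratesSet S Λ) (hS : Differentiable ℝ fun w : EucSp k × F => S w.1 w.2)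
    {Φ : EucSp k → F' → F} (hΦ : Differentiable ℝ fun w : EucSp k × F' => Φ w.1 w.2)
    (hsurj : ∀ x, Function.Surjective (Φ x))
    (hd : ∀ x η, Function.Surjective (fderiv ℝ (Φ x) η)) :
    GeneratesSet (fun x η => S x (Φ x η)) Λ := by
  have key : ∀ x η, (fderiv ℝ (fun η => S x (Φ x η)) η = 0 ↔ fderiv ℝ (S x) (Φ x η) = 0) ∧
      (fderiv ℝ (S x) (Φ x η) = 0 →
        gradient (fun y => S y (Φ y η)) x = gradient (fun y => S y (Φ x η)) x) := by
    intro x η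
    have h1 := (hS (x, Φ x η)).hasFDerivAt
    set D := fderiv ℝ (fun w : EucSp k × F => S w.1 w.2) (x, Φ x η)
    have h2 := (hΦ (x, η)).hasFDerivAt
    set G := fderiv ℝ (fun w : EucSp k × F' => Φ w.1 w.2) (x, η)
    have hξ : HasFDerivAt (S x) (D.comp (ContinuousLinearMap.inr ℝ _ _)) (Φ x η) :=
      h1.comp (Φ x η) (hasFDerivAt_prodMk_right x (Φ x η))
    have hη : HasFDerivAt (Φ x) (G.comp (ContinuousLinearMap.inr ℝ _ _)) η :=
      h2.comp η (hasFDerivAt_prodMk_right x η)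
    have hx : HasFDerivAt (fun y => Φ y η) (G.comp (ContinuousLinearMap.inl ℝ _ _)) x :=
      HasFDerivAt.comp (f := fun y => (y, η)) x h2 (hasFDerivAt_prodMk_left x η)
    have hc := hξ.comp η hη
    have hs := hd x η
    rw [hη.fderiv] at hs
    constructor
    · change fderiv ℝ (S x ∘ Φ x) η = 0 ↔ _
      rw [hc.fderiv, hξ.fderiv]
      constructor
      · intro h0
        refine ContinuousLinearMap.ext fun v => ?_
        obtain ⟨u, rfl⟩ := hs v
        exact DFunLike.congr_fun h0 u
      · intro h0
        rw [h0, ContinuousLinearMap.zero_comp]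
    · intro h0
      rw [hξ.fderiv] at h0
      have hy : HasFDerivAt (fun y => S y (Φ y η)) _ x :=
        HasFDerivAt.comp (f := fun y => (y, Φ y η)) x h1 ((hasFDerivAt_id x).prodMk hx)
      have hy' : HasFDerivAt (fun y => S y (Φ x η)) _ x :=
        HasFDerivAt.comp (f := fun y => (y, Φ x η)) x h1 (hasFDerivAt_prodMk_left x (Φ x η))
      rw [gradient, gradient, hy.fderiv, hy'.fderiv]
      congr 1
      refine ContinuousLinearMap.ext fun v => ?_
      have h3 : D (0, G (v, 0)) = 0 := DFunLike.congr_fun h0 (G (v, 0))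
      change D (v, G (v, 0)) = D (v, 0)
      rw [← sub_eq_zero, ← map_sub, Prod.mk_sub_mk, sub_self, sub_zero, h3]
  rw [GeneratesSet] at h ⊢
  rw [h]
  ext z
  constructor
  · rintro ⟨ξ, h0, hz⟩
    obtain ⟨η, rfl⟩ := hsurj z.1 ξ
    exact ⟨η, (key z.1 η).1.2 h0, hz.trans ((key z.1 η).2 h0).symm⟩
  · rintro ⟨η, h0, hz⟩
    have h0' := (key z.1 η).1.1 h0
    exact ⟨Φ z.1 η, h0', hz.trans ((key z.1 η).2 h0')⟩

theorem IsC1Diffeo.surjective {f : F → F'} (h : IsC1Diffeo f) : Function.Surjective f := by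
  obtain ⟨e, he, -⟩ := h
  intro y
  exact ⟨e.symm y, by rw [← he, e.apply_symm_apply]⟩

theorem IsC1Diffeo.surjective_fderiv {f : F → F'} (h : IsC1Diffeo f) (z : F) :
    Function.Surjective (fderiv ℝ f z) := by
  obtain ⟨e, he, h1, h2⟩ := h
  obtain rfl : (e : F → F') = f := funext he
  intro v
  have d1 := ((h1.differentiable one_ne_zero) z).hasFDerivAt
  have d2 := ((h2.differentiable one_ne_zero) (e z)).hasFDerivAt
  have d3 : HasFDerivAt (e ∘ e.symm) _ (e z) :=
    HasFDerivAt.comp (e z) (by rw [e.symm_apply_apply]; exact d1) d2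
  rw [show (e ∘ e.symm : F' → F') = id from funext fun y => e.apply_symm_apply y] at d3
  exact ⟨_, DFunLike.congr_fun (d3.unique (hasFDerivAt_id _)) v⟩

end Fibered

/-! ### The increment variables and the block-diagonal form -/

section Increments

variable {k N : ℕ}

/-- `incrToParam` as a continuous linear function of `(x, η)`. -/
noncomputable def incrCLM (N : ℕ) (A : Matrix (Fin k) (Fin k) ℝ) :
    EucSp k × IncrSp k N →L[ℝ] EucSp k × (Fin N → EucSp k) :=
  have hv : ∀ j, IsLinearMap ℝ fun w : EucSp k × IncrSp k N => vertexOf A w.1 w.2 j := fun j =>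
    { map_add := fun v w => by
        ext i
        simp [vertexOf, Matrix.mulVec, dotProduct, mul_add, Finset.sum_add_distrib]
        ring
      map_smul := fun c w => by
        ext i
        simp [vertexOf, Matrix.mulVec, dotProduct, mul_sub, Finset.mul_sum, mul_left_comm] }
  LinearMap.toContinuousLinearMap
    { toFun := fun w => incrToParam A w.1 w.2
      map_add' := fun v w => Prod.ext ((hv 0).map_add v w) (funext fun l => (hv l.succ).map_add v w)
      map_smul' := fun c w =>
        Prod.ext ((hv 0).map_smul c w) (funext fun l => (hv l.succ).map_smul c w) }

theorem brokenPath_incrToParam_castSucc (A : Matrix (Fin k) (Fin k) ℝ) (x : EucSp k)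
    (η : IncrSp k N) (j : Fin (N + 1)) :
    brokenPath (incrToParam A x η).1 (incrToParam A x η).2 x j.castSucc = vertexOf A x η j := by
  refine Fin.cases rfl (fun i => ?_) j
  rw [brokenPath_succ_castSucc]
  rfl

theorem brokenPath_incrToParam_sub (A : Matrix (Fin k) (Fin k) ℝ) (x : EucSp k)
    (η : IncrSp k N) (j : Fin (N + 1)) :
    brokenPath (incrToParam A x η).1 (incrToParam A x η).2 x j.succ -
      brokenPath (incrToParam A x η).1 (incrToParam A x η).2 x j.castSucc =
      WithLp.toLp 2 (A.mulVec fun l => η (l, j)) := by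
  rw [brokenPath_incrToParam_castSucc]
  refine Fin.lastCases ?_ (fun i => ?_) j
  · rw [Fin.succ_last, brokenPath_last, vertexOf,
      show Finset.Ici (Fin.last N) = {Fin.last N} from Finset.Ici_top, Finset.sum_singleton,
      sub_sub_cancel]
  · rw [brokenPath_castSucc_succ]
    change vertexOf A x η i.succ - _ = _
    have h : Finset.Ici i.castSucc = insert i.castSucc (Finset.Ici i.succ) := by
      ext l
      simp only [Finset.mem_Ici, Finset.mem_insert, Fin.le_def, Fin.ext_iff, Fin.val_castSucc,
        Fin.val_succ]
      lia
    rw [vertexOf, vertexOf, h, Finset.sum_insert (by simp [Fin.le_def])]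
    abel

theorem incrToParam_add_left (A : Matrix (Fin k) (Fin k) ℝ) (x y : EucSp k) (η : IncrSp k N) :
    incrToParam A (x + y) η = ((incrToParam A x η).1 + y, (incrToParam A x η).2 + fun _ => y) := by
  refine Prod.ext ?_ (funext fun l => ?_) <;> simp [incrToParam, vertexOf] <;> abel

/-- Both spaces have dimension `(N + 1) k`, and `η` can be read off from the edges because `A` is
injective. -/
theorem surjective_incrToParam_zero {A : Matrix (Fin k) (Fin k) ℝ} (hA : A.det ≠ 0) :
    Function.Surjective (incrToParam (N := N) A 0) := by
  set g : IncrSp k N →ₗ[ℝ] EucSp k × (Fin N → EucSp k) :=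
    ((incrCLM N A).comp (ContinuousLinearMap.inr ℝ _ _)).toLinearMap
  have hdim : Module.finrank ℝ (IncrSp k N) = Module.finrank ℝ (EucSp k × (Fin N → EucSp k)) := by
    simp [Module.finrank_pi_fintype]
    ring
  suffices Function.Injective g from
    (LinearMap.injective_iff_surjective_of_finrank_eq_finrank hdim).1 this
  intro η η' h
  have hA' : Function.Injective A.mulVec :=
    Matrix.mulVec_injective_iff_isUnit.2 ((Matrix.isUnit_iff_isUnit_det A).2 hA.isUnit)
  have h' : incrToParam A 0 η = incrToParam A 0 η' := h
  funext ⟨l, j⟩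
  have h1 := brokenPath_incrToParam_sub A 0 η j
  rw [h', brokenPath_incrToParam_sub] at h1
  exact (congr_fun (hA' (WithLp.toLp_injective 2 h1)) l).symm

theorem surjective_incrToParam {A : Matrix (Fin k) (Fin k) ℝ} (hA : A.det ≠ 0) (x : EucSp k) :
    Function.Surjective (incrToParam (N := N) A x) := by
  intro q
  obtain ⟨η, hη⟩ := surjective_incrToParam_zero hA (q - ((0 : EucSp k) + x, fun _ => x))
  refine ⟨η, ?_⟩
  rw [← zero_add x, incrToParam_add_left, hη]
  simp

theorem surjective_fderiv_incrToParam {A : Matrix (Fin k) (Fin k) ℝ} (hA : A.det ≠ 0)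
    (x : EucSp k) (η : IncrSp k N) : Function.Surjective (fderiv ℝ (incrToParam A x) η) := by
  have h : HasFDerivAt (incrToParam A x) ((incrCLM N A).comp (ContinuousLinearMap.inr ℝ _ _)) η :=
    (incrCLM N A).hasFDerivAt.comp η (hasFDerivAt_prodMk_right x η)
  rw [h.fderiv]
  exact surjective_incrToParam_zero hA

theorem dotProduct_blockDiagonal_mulVec (A : Matrix (Fin k) (Fin k) ℝ) (η ζ : IncrSp k N) :
    η ⬝ᵥ (Matrix.blockDiagonal fun _ : Fin (N + 1) => A).mulVec ζ =
      ∑ j, (fun l => η (l, j)) ⬝ᵥ A.mulVec fun l => ζ (l, j) := by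
  simp [dotProduct, Matrix.mulVec, Fintype.sum_prod_type_right, Matrix.blockDiagonal_apply,
    ite_mul]

theorem blockForm_apply (A : Matrix (Fin k) (Fin k) ℝ) (N : ℕ) (ε : ℝ) (η : IncrSp k N) :
    blockForm A N ε η = 1 / (2 * ε) *
      (η ⬝ᵥ (Matrix.blockDiagonal fun _ : Fin (N + 1) => A).mulVec η) := by
  rw [blockForm, smul_apply, Matrix.toQuadraticForm',
    LinearMap.BilinMap.toQuadraticMap_apply, Matrix.toLinearMap₂'_apply', smul_eq_mul]

theorem nondegenerate_polarBilin_blockForm {A : Matrix (Fin k) (Fin k) ℝ} (hA : A.IsSymm)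
    (hdet : A.det ≠ 0) (N : ℕ) {ε : ℝ} (hε : ε ≠ 0) :
    (QuadraticMap.polarBilin (blockForm A N ε)).Nondegenerate := by
  set B := Matrix.blockDiagonal fun _ : Fin (N + 1) => A
  have hB : B.transpose = B := by
    rw [Matrix.blockDiagonal_transpose]; congr 1; funext _; exact hA
  have hBdet : B.det ≠ 0 := by
    rw [Matrix.det_blockDiagonal]; exact Finset.prod_ne_zero_iff.2 fun _ _ => hdet
  have hcomm : ∀ η ζ : IncrSp k N, ζ ⬝ᵥ B.mulVec η = η ⬝ᵥ B.mulVec ζ := fun η ζ => by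
    rw [Matrix.dotProduct_mulVec, ← Matrix.mulVec_transpose, hB, dotProduct_comm]
  have hp : ∀ η ζ, QuadraticMap.polarBilin (blockForm A N ε) η ζ = 1 / ε * (η ⬝ᵥ B.mulVec ζ) := by
    intro η ζ
    rw [QuadraticMap.polarBilin_apply_apply, QuadraticMap.polar, blockForm_apply, blockForm_apply,
      blockForm_apply, Matrix.mulVec_add, dotProduct_add, add_dotProduct, add_dotProduct,
      hcomm η ζ]
    field_simp
    ring
  have hsep : ∀ ζ, (∀ η, η ⬝ᵥ B.mulVec ζ = 0) → ζ = 0 := fun ζ h => by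
    have h0 : B.mulVec ζ = 0 := by
      have := h (B.mulVec ζ)
      rwa [dotProduct_self_eq_zero] at this
    exact Matrix.eq_zero_of_mulVec_eq_zero hBdet h0
  refine ⟨fun ζ h => hsep ζ fun η => ?_, fun ζ h => hsep ζ fun η => ?_⟩
  · have := h η
    rw [hp, mul_eq_zero, hcomm] at this
    exact this.resolve_left (one_div_ne_zero hε)
  · have := h η
    rw [hp, mul_eq_zero] at this
    exact this.resolve_left (one_div_ne_zero hε)

end Increments

/-! ### Normal form of the broken action in the increment variables -/

section BrokenGeodesicNormalForm

variable {k N : ℕ}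

theorem ZPeriodic.exists_bound {G : Type*} [NormedAddCommGroup G] {g : EucSp k → G}
    (hper : ZPeriodic g) (hg : Continuous g) : ∃ M, 0 ≤ M ∧ ∀ x, ‖g x‖ ≤ M := by
  obtain ⟨ρ, -, hρ⟩ := exists_norm_add_intVec_le k
  obtain ⟨M, hM⟩ := (isCompact_closedBall (0 : EucSp k) ρ).exists_bound_of_continuousOn
    hg.continuousOn
  have hb : ∀ x, ‖g x‖ ≤ M := fun x => by
    obtain ⟨m, hm⟩ := hρ x
    rw [← hper m x]
    exact hM _ (by simpa using hm)
  exact ⟨M, (norm_nonneg _).trans (hb 0), hb⟩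

theorem ZPeriodic.exists_lipschitz {σ : EucSp k → ℝ} (hper : ZPeriodic σ) (hσ : ContDiff ℝ 1 σ) :
    ∃ M, 0 ≤ M ∧ ∀ x y, |σ x - σ y| ≤ M * ‖x - y‖ := by
  have hper' : ZPeriodic (fderiv ℝ σ) := fun m x => by
    rw [← fderiv_comp_add_right, show (fun x => σ (x + intVec m)) = σ from funext (hper m)]
  obtain ⟨M, hM, hb⟩ := hper'.exists_bound (hσ.continuous_fderiv one_ne_zero)
  exact ⟨M, hM, fun x y => convex_univ.norm_image_sub_le_of_norm_fderiv_le
    (fun z _ => hσ.differentiable one_ne_zero z) (fun z _ => hb z) (mem_univ y) (mem_univ x)⟩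

/-- The linear map of a matrix on Euclidean space. -/
noncomputable def matCLM (A : Matrix (Fin k) (Fin k) ℝ) : EucSp k →L[ℝ] EucSp k :=
  LinearMap.toContinuousLinearMap
    { toFun := fun v => WithLp.toLp 2 (A.mulVec fun i => v i)
      map_add' := fun v w => by
        ext i; simp [Matrix.mulVec, dotProduct, mul_add, Finset.sum_add_distrib]
      map_smul' := fun c w => by
        ext i; simp [Matrix.mulVec, dotProduct, Finset.mul_sum, mul_left_comm] }

theorem matCLM_apply (A : Matrix (Fin k) (Fin k) ℝ) (v : EucSp k) :
    matCLM A v = WithLp.toLp 2 (A.mulVec fun i => v i) := rfl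

theorem matCLM_mul_apply (A B : Matrix (Fin k) (Fin k) ℝ) (v : EucSp k) :
    matCLM A (matCLM B v) = matCLM (A * B) v := by
  rw [matCLM_apply, matCLM_apply, matCLM_apply, ← Matrix.mulVec_mulVec]

theorem matCLM_one_apply (v : EucSp k) : matCLM 1 v = v := by
  rw [matCLM_apply, Matrix.one_mulVec]

theorem inner_eq_dotProduct (v w : EucSp k) :
    inner ℝ v w = (fun i => v i) ⬝ᵥ fun i => w i := by
  simp [PiLp.inner_apply, dotProduct, mul_comm]

theorem inner_matCLM {A : Matrix (Fin k) (Fin k) ℝ} (hA : A.IsSymm) (v w : EucSp k) :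
    inner ℝ (matCLM A v) w = inner ℝ v (matCLM A w) := by
  rw [inner_eq_dotProduct, inner_eq_dotProduct, matCLM_apply, matCLM_apply,
    Matrix.dotProduct_mulVec, ← Matrix.mulVec_transpose, hA]

/-- An edge is `A η_j`, so its free action `(1/2ε)⟨A⁻¹(Y - X), Y - X⟩` is `(1/2ε)⟨η_j, A η_j⟩`: the
block form is the total free action. -/
theorem blockForm_eq_sum {A : Matrix (Fin k) (Fin k) ℝ} (hdet : A.det ≠ 0) (ε : ℝ) (x : EucSp k)
    (η : IncrSp k N) :
    blockForm A N ε η = ∑ j, 1 / (2 * ε) * inner ℝ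
      (matCLM A⁻¹ ((edgeCLM k N j (x, incrToParam A x η)).2 -
        (edgeCLM k N j (x, incrToParam A x η)).1))
      ((edgeCLM k N j (x, incrToParam A x η)).2 - (edgeCLM k N j (x, incrToParam A x η)).1) := by
  rw [blockForm_apply, dotProduct_blockDiagonal_mulVec, Finset.mul_sum]
  refine Finset.sum_congr rfl fun j _ => ?_
  rw [edgeCLM_apply, brokenPath_incrToParam_sub,
    show (WithLp.toLp 2 (A.mulVec fun l => η (l, j)) : EucSp k) =
      matCLM A (WithLp.toLp 2 fun l => η (l, j)) from rfl, matCLM_mul_apply,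
    Matrix.nonsing_inv_mul A hdet.isUnit, matCLM_one_apply, inner_eq_dotProduct]
  rfl

theorem edgeCLM_incrToParam_add_intVec (A : Matrix (Fin k) (Fin k) ℝ) (x : EucSp k)
    (η : IncrSp k N) (v : EucSp k) (j : Fin (N + 1)) :
    edgeCLM k N j (x + v, incrToParam A (x + v) η) =
      edgeCLM k N j (x, incrToParam A x η) + (v, v) := by
  have h : ∀ j, brokenPath ((incrToParam A x η).1 + v) ((incrToParam A x η).2 + fun _ => v)
      (x + v) j = brokenPath (incrToParam A x η).1 (incrToParam A x η).2 x j + v :=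
    forall_fin_path (by simp) (by simp) (by simp)
  rw [edgeCLM_apply, edgeCLM_apply, incrToParam_add_left, h, h]
  rfl

/-- With `η` fixed, translating `x` translates every vertex by the same vector. This fails for `(ξ,
U)` held fixed, which is why the increments are the right fibre variables on the torus. -/
theorem zPeriodic_add_pathSum_incrToParam (A : Matrix (Fin k) (Fin k) ℝ)
    {S : Fin (N + 1) → EucSp k → EucSp k → ℝ}
    (hper : ∀ j m X Y, S j (X + intVec m) (Y + intVec m) = S j X Y) {σ : EucSp k → ℝ}
    (hσ : ZPeriodic σ) :
    ZPeriodic fun x (η : IncrSp k N) =>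
      σ (incrToParam A x η).1 + pathSum S (x, incrToParam A x η) := by
  intro m x
  funext η
  refine congr_arg₂ (· + ·) ?_ ?_
  · rw [incrToParam_add_left, hσ]
  · refine Finset.sum_congr rfl fun j _ => ?_
    rw [edgeCLM_incrToParam_add_intVec]
    exact hper j m _ _

/-- The perturbation of the block form is `σ` plus the sum of the edge deviations from the free
action, each bounded and Lipschitz; `σ` is so by periodicity. -/
theorem exists_fibered_normal_form_pathSum {A : Matrix (Fin k) (Fin k) ℝ} (hA : A.IsSymm)
    (hdet : A.det ≠ 0) {S : Fin (N + 1) → EucSp k → EucSp k → ℝ} (hS : ContDiff ℝ 1 (pathSum S))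
    (hper : ∀ j m X Y, S j (X + intVec m) (Y + intVec m) = S j X Y) {ε : ℝ} (hε : ε ≠ 0)
    (hb : ∀ j, ∃ C, 0 ≤ C ∧
      (∀ X Y, |S j X Y - 1 / (2 * ε) * inner ℝ (matCLM A⁻¹ (Y - X)) (Y - X)| ≤ C) ∧
      ∀ w w' : EucSp k × EucSp k,
        |(S j w.1 w.2 - 1 / (2 * ε) * inner ℝ (matCLM A⁻¹ (w.2 - w.1)) (w.2 - w.1))
          - (S j w'.1 w'.2 -
            1 / (2 * ε) * inner ℝ (matCLM A⁻¹ (w'.2 - w'.1)) (w'.2 - w'.1))| ≤ C * ‖w - w'‖)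
    {σ : EucSp k → ℝ} (hσper : ZPeriodic σ) (hσ : ContDiff ℝ 1 σ) :
    ∃ Ψ : EucSp k → IncrSp k N → IncrSp k N, IsFiberedDiffeo Ψ ∧ (∀ x η, ‖Ψ x η - η‖ ≤ 1) ∧
      ∃ C, 0 < C ∧ ∀ x η, C < ‖η‖ →
        σ (incrToParam A x (Ψ x η)).1 + pathSum S (x, incrToParam A x (Ψ x η)) =
          blockForm A N ε η := by
  choose C hC0 hC hClip using hb
  obtain ⟨M₀, hM₀, hσb⟩ := hσper.exists_bound hσ.continuous
  obtain ⟨M₁, hM₁, hσlip⟩ := hσper.exists_lipschitz hσ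
  set Λ : EucSp k × IncrSp k N →L[ℝ] EucSp k × (EucSp k × (Fin N → EucSp k)) :=
    (ContinuousLinearMap.fst ℝ _ _).prod (incrCLM N A) with hΛ
  set K : EucSp k × IncrSp k N →L[ℝ] EucSp k :=
    (ContinuousLinearMap.fst ℝ _ _).comp (incrCLM N A) with hK
  set W : Fin (N + 1) → EucSp k × EucSp k → ℝ := fun j w =>
    S j w.1 w.2 - 1 / (2 * ε) * inner ℝ (matCLM A⁻¹ (w.2 - w.1)) (w.2 - w.1) with hW
  set f : EucSp k → IncrSp k N → ℝ := fun x η =>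
    σ (incrToParam A x η).1 + pathSum S (x, incrToParam A x η) - blockForm A N ε η with hf
  have hfW : ∀ x η, f x η = σ (K (x, η)) + ∑ j, W j (edgeCLM k N j (Λ (x, η))) := by
    intro x η
    change σ _ + ∑ j, _ - _ = σ _ + ∑ j, _
    rw [blockForm_eq_sum hdet ε x η, add_sub_assoc, ← Finset.sum_sub_distrib]
    rfl
  have hfc : ContDiff ℝ 1 fun w : EucSp k × IncrSp k N => f w.1 w.2 := by
    have h1 : ContDiff ℝ 1 fun w : EucSp k × IncrSp k N => σ (K w) := hσ.comp K.contDiff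
    have h2 : ContDiff ℝ 1 fun w : EucSp k × IncrSp k N => pathSum S (Λ w) := hS.comp Λ.contDiff
    have h3 : ContDiff ℝ 1 fun w : EucSp k × IncrSp k N => blockForm A N ε w.2 := by
      simp only [blockForm_apply]
      refine contDiff_const.mul (contDiff_dotProduct contDiff_snd ?_)
      exact (LinearMap.toContinuousLinearMap (Matrix.mulVecLin
        (Matrix.blockDiagonal fun _ : Fin (N + 1) => A))).contDiff.comp contDiff_snd
    exact (h1.add h2).sub h3
  have hfper : ZPeriodic f := fun m x => by
    funext η
    have := congr_fun (zPeriodic_add_pathSum_incrToParam A hper hσper m x) η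
    exact congr_arg (· - blockForm A N ε η) this
  have hM1 : 0 ≤ M₀ + ∑ j, C j := add_nonneg hM₀ (Finset.sum_nonneg fun j _ => hC0 j)
  have hM2 : 0 ≤ M₁ * ‖K‖ + ∑ j, C j * ‖(edgeCLM k N j).comp Λ‖ :=
    add_nonneg (by positivity) (Finset.sum_nonneg fun j _ => mul_nonneg (hC0 j) (norm_nonneg _))
  have hbound : ∀ x η, |f x η| ≤ M₀ + ∑ j, C j := by
    intro x η
    rw [hfW]
    refine (abs_add_le _ _).trans (add_le_add (hσb _) ?_)
    exact (Finset.abs_sum_le_sum_abs _ _).trans (Finset.sum_le_sum fun j _ => hC j _ _)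
  have hlip : ∀ x η η', |f x η - f x η'| ≤
      (M₁ * ‖K‖ + ∑ j, C j * ‖(edgeCLM k N j).comp Λ‖) * ‖η - η'‖ := by
    intro x η η'
    have hd : ‖((x, η) : EucSp k × IncrSp k N) - (x, η')‖ = ‖η - η'‖ := by
      rw [Prod.mk_sub_mk, sub_self, Prod.norm_mk, norm_zero, max_eq_right (norm_nonneg _)]
    rw [hfW, hfW, add_sub_add_comm, ← Finset.sum_sub_distrib, add_mul, Finset.sum_mul]
    refine (abs_add_le _ _).trans (add_le_add ((hσlip _ _).trans ?_) ?_)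
    · rw [← map_sub, mul_assoc, ← hd]
      exact mul_le_mul_of_nonneg_left (K.le_opNorm _) hM₁
    · refine (Finset.abs_sum_le_sum_abs _ _).trans (Finset.sum_le_sum fun j _ => ?_)
      refine (hClip j _ _).trans ?_
      rw [mul_assoc, ← hd]
      refine mul_le_mul_of_nonneg_left ?_ (hC0 j)
      have := ((edgeCLM k N j).comp Λ).le_opNorm ((x, η) - (x, η'))
      rwa [map_sub] at this
  set B := (1 / ε) • Matrix.blockDiagonal fun _ : Fin (N + 1) => A with hB
  have hBs : B.IsSymm := by
    refine Matrix.IsSymm.smul ?_ _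
    rw [Matrix.IsSymm, Matrix.blockDiagonal_transpose]; congr 1; funext _; exact hA
  have hBdet : IsUnit B.det := by
    rw [hB, Matrix.det_smul, Matrix.det_blockDiagonal]
    exact (mul_ne_zero (pow_ne_zero _ (one_div_ne_zero hε))
      (Finset.prod_ne_zero_iff.2 fun _ _ => hdet)).isUnit
  have hBf : ∀ η, 1 / 2 * (η ⬝ᵥ B.mulVec η) = blockForm A N ε η := fun η => by
    rw [blockForm_apply, hB, Matrix.smul_mulVec, dotProduct_smul, smul_eq_mul]
    field_simp
  obtain ⟨Ψ, hΨ, hΨb, R, hR, hΨR⟩ := exists_fibered_normal_form hBs hBdet hfc hfper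
    (add_nonneg hM1 hM2) (fun x η => (hbound x η).trans (le_add_of_nonneg_right hM2))
    (fun x η η' => (hlip x η η').trans
      (mul_le_mul_of_nonneg_right (le_add_of_nonneg_left hM1) (norm_nonneg _)))
  refine ⟨Ψ, hΨ, hΨb, R, hR, fun x η hη => ?_⟩
  have := hΨR x η hη
  rw [hBf, hBf] at this
  rw [← this, hf]
  ring

end BrokenGeodesicNormalForm

/-! ### The subdivision and the assembly of the theorem -/

theorem node_zero (t : ℝ) (N : ℕ) : node t N 0 = 0 := by simp [node]

theorem node_last (t : ℝ) (N : ℕ) : node t N (N + 1) = t := by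
  rw [node]
  push_cast
  field_simp

theorem node_succ_sub (t : ℝ) (N j : ℕ) : node t N (j + 1) - node t N j = t / ((N : ℝ) + 1) := by
  rw [node, node]
  push_cast
  ring

theorem node_mem_Icc {t T : ℝ} (ht : t ∈ Ioc 0 T) {N j : ℕ} (hj : j ≤ N + 1) :
    node t N j ∈ Icc 0 T := by
  have ht0 := ht.1
  refine ⟨by rw [node]; positivity, le_trans ?_ ht.2⟩
  calc node t N j ≤ node t N (N + 1) :=
        mul_le_mul_of_nonneg_right (Nat.cast_le.2 hj) (by positivity)
    _ = t := node_last t N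

theorem theorem6p1 (k : ℕ) (T : ℝ) (hT : 0 < T)
    (A : Matrix (Fin k) (Fin k) ℝ) (hAsymm : A.IsSymm) (hAdet : A.det ≠ 0)
    (H V : ℝ → EucSp k → EucSp k → ℝ)
    (hreg : ContDiffOn ℝ 2 (fun q : ℝ × EucSp k × EucSp k => H q.1 q.2.1 q.2.2)
      (Icc 0 T ×ˢ univ))
    (hform : ∀ t ∈ Icc 0 T, ∀ x p : EucSp k,
      H t x p = 1 / 2 * inner ℝ (WithLp.toLp 2 (A.mulVec (fun i => p i)) : EucSp k) p + V t x p)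
    (hper : ∀ t ∈ Icc 0 T, ZPeriodic (V t))
    (hsupp : ∃ R : ℝ, ∀ t ∈ Icc 0 T, ∀ x p : EucSp k, R < ‖p‖ → V t x p = 0)
    (hstar : StarCondition H T) :
    HamComplete H T ∧
    ∃ N₀ : ℕ, ∀ N : ℕ, N₀ ≤ N → ∀ t ∈ Ioc 0 T,
      (∀ j : Fin (N + 1), IsC1Diffeo (twistMap H T (node t N (j + 1)) (node t N j))) ∧
      GeneratesMap (fun X x (U : Fin N → EucSp k) => brokenAction H T t X x U)
        (hamFlow H T t 0) ∧
      ∀ σ : EucSp k → ℝ, ZPeriodic σ → ContDiff ℝ 1 σ →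
        ContDiff ℝ 1 (fun w : EucSp k × (EucSp k × (Fin N → EucSp k)) =>
          brokenGF H T t N σ w.1 w.2) ∧
        GeneratesSet (brokenGF H T t N σ) (wavefront H T t σ) ∧
        (ContDiff ℝ 2 σ →
          ContDiff ℝ 2 (fun w : EucSp k × (EucSp k × (Fin N → EucSp k)) =>
            brokenGF H T t N σ w.1 w.2) ∧
          ZeroIsRegularValue (brokenGF H T t N σ)) ∧
        ZPeriodic (fun x (η : IncrSp k N) => brokenGF H T t N σ x (incrToParam A x η)) ∧
        ∃ Ψ : EucSp k → IncrSp k N → IncrSp k N,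
          IsFiberedDiffeo Ψ ∧ (∃ B : ℝ, ∀ x η, ‖Ψ x η - η‖ ≤ B) ∧
          IsGFQI (fun x η => brokenGF H T t N σ x (incrToParam A x (Ψ x η)))
            (blockForm A N (t / ((N : ℝ) + 1))) (wavefront H T t σ) := by
  obtain ⟨R, hR⟩ := hsupp
  obtain ⟨b, b', M, h⟩ := exists_isKineticHam (inner_matCLM hAsymm) hT hreg hform hper hR
  refine ⟨h.hamComplete, ?_⟩
  obtain ⟨ε₀, hε₀, htwist⟩ := hstar.exists_twist_equiv h
  -- With `N ≥ T / ε₀` every step `t / (N + 1)`, `t ≤ T`, is at most the twist time `ε₀`; this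
  -- choice depends on neither `t` nor `σ`.
  obtain ⟨N₀, hN₀⟩ := exists_nat_ge (T / ε₀)
  refine ⟨N₀, fun N hN t ht => ?_⟩
  have hε : 0 < t / ((N : ℝ) + 1) := div_pos ht.1 (by positivity)
  have hεle : t / ((N : ℝ) + 1) ≤ ε₀ := by
    rw [div_le_iff₀ (by positivity), mul_comm, ← div_le_iff₀ hε₀]
    have h1 : t / ε₀ ≤ T / ε₀ := div_le_div_of_nonneg_right ht.2 hε₀.le
    have h2 : (N₀ : ℝ) ≤ N := Nat.cast_le.2 hN
    linarith
  have hnode : ∀ j : Fin (N + 1), node t N j ∈ Icc 0 T := fun j => node_mem_Icc ht (by lia)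
  have hsub : ∀ j : Fin (N + 1),
      node t N (j + 1) - node t N j = t / ((N : ℝ) + 1) := fun j => node_succ_sub t N j
  have hlt : ∀ j : Fin (N + 1), node t N j < node t N (j + 1) := fun j => by
    have := hsub j
    linarith
  have hnode' : ∀ j : Fin (N + 1), node t N (j + 1) ∈ Icc (node t N j) T := fun j =>
    ⟨(hlt j).le, (node_mem_Icc ht (by lia)).2⟩
  choose e he hec hec' using fun j => htwist _ (hnode j) _ (hnode' j) (hlt j)
    ((hsub j).trans_le hεle)
  set S : Fin (N + 1) → EucSp k → EucSp k → ℝ := fun j =>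
    segmentAction H T (node t N (j + 1)) (node t N j) with hSdef
  set φ : Fin (N + 1) → EucSp k × EucSp k → EucSp k × EucSp k := fun j =>
    hamFlow H T (node t N (j + 1)) (node t N j)
  have hS : ∀ j, IsTwistGF (S j) (φ j) _ _ := fun j =>
    h.exists_isTwistGF (hnode j) (hnode' j) (he j) (hec' j)
  set Φ : Fin (N + 2) → EucSp k × EucSp k → EucSp k × EucSp k := fun j =>
    hamFlow H T (node t N j) 0
  have h0 : (0 : ℝ) ∈ Icc 0 T := left_mem_Icc.2 hT.le
  have hΦ0 : ∀ z, Φ 0 z = z := fun z => by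
    change hamFlow H T (node t N 0) 0 z = z
    rw [node_zero]
    exact h.isFlowOn.self 0 h0 z
  have hΦ : ∀ j z, Φ (Fin.succ j) z = φ j (Φ j.castSucc z) := fun j z =>
    (h.isFlowOn.comp_apply h.isC1Field h0 (hnode j) (node_mem_Icc ht (by lia)) z).symm
  have hΦl : Φ (Fin.last (N + 1)) = hamFlow H T t 0 := by
    change hamFlow H T (node t N (N + 1)) 0 = _
    rw [node_last]
  have hφ : ∀ j, ContDiff ℝ 1 (φ j) := fun j => by
    obtain ⟨D, hD⟩ := h.isFlowOn.exists_linearized h.isC1Field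
    exact hD.contDiff h.isFlowOn h.isC1Field (hnode j) (hnode' j)
  have hpath := contDiff_pathSum hS
  have hSper : ∀ j m X Y, S j (X + intVec m) (Y + intVec m) = S j X Y := fun j =>
    h.segmentAction_add_intVec (hnode j) (hnode' j) (he j)
  refine ⟨fun j => ⟨e j, he j, hec j, hec' j⟩, ?_, fun σ hσper hσ => ?_⟩
  · rw [← hΦl]
    -- By unfolding, `brokenAction` is `pathSum S` at `(x, X, U)`, so the abstract statement applies
    -- directly.
    exact generatesMap_pathSum hS hΦ0 hΦ
  have hc : ∀ {n : WithTop ℕ∞}, ContDiff ℝ n σ → n ≤ 2 →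
      ContDiff ℝ n (fun w : EucSp k × (EucSp k × (Fin N → EucSp k)) =>
        brokenGF H T t N σ w.1 w.2) := fun hσn hn =>
    (hσn.comp (contDiff_fst.comp contDiff_snd)).add (hpath.of_le hn)
  have hc1 := hc hσ one_le_two
  have hgen : GeneratesSet (brokenGF H T t N σ) (wavefront H T t σ) := by
    rw [wavefront, ← hΦl]
    exact generatesSet_add_pathSum hS hΦ0 hΦ (hσ.differentiable one_ne_zero)
  have hzper : ZPeriodic fun x (η : IncrSp k N) => brokenGF H T t N σ x (incrToParam A x η) :=
    zPeriodic_add_pathSum_incrToParam A hSper hσper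
  refine ⟨hc1, hgen, fun hσ2 => ⟨hc hσ2 le_rfl, zeroIsRegularValue_add_pathSum hS hφ hσ2⟩,
    hzper, ?_⟩
  have hb := fun j => h.exists_bound_segmentAction_sub (hnode j) (hnode' j) (hlt j) (he j) (hec j)
    (hec' j) (L' := matCLM A⁻¹)
    (fun v => by rw [matCLM_mul_apply, Matrix.nonsing_inv_mul A hAdet.isUnit, matCLM_one_apply])
    (fun v => by rw [matCLM_mul_apply, Matrix.mul_nonsing_inv A hAdet.isUnit, matCLM_one_apply])
  simp only [hsub] at hb
  obtain ⟨Ψ, hΨ, hΨb, C, hC, hΨC⟩ := exists_fibered_normal_form_pathSum hAsymm hAdet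
    (hpath.of_le one_le_two) hSper hε.ne' hb hσper hσ
  have hci : ContDiff ℝ 1 fun w : EucSp k × IncrSp k N =>
      brokenGF H T t N σ w.1 (incrToParam A w.1 w.2) :=
    hc1.comp (contDiff_fst.prodMk (incrCLM N A).contDiff)
  refine ⟨Ψ, hΨ, ⟨1, hΨb⟩, ?_, ?_, ?_, nondegenerate_polarBilin_blockForm hAsymm hAdet N hε.ne',
    C, hC, hΨC⟩
  · intro m x
    funext η
    have := congr_fun (hzper m x) (Ψ x η)
    simpa only [hΨ.1 m x] using this
  · exact hci.comp (contDiff_fst.prodMk hΨ.2.1)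
  -- Two fibered changes in turn: the linear passage from `(ξ, U)` to `η`, then `Ψ`.
  · have hgi : GeneratesSet (fun x (η : IncrSp k N) => brokenGF H T t N σ x (incrToParam A x η))
        (wavefront H T t σ) :=
      hgen.comp_fibered (hc1.differentiable one_ne_zero)
        ((incrCLM N A).contDiff.differentiable one_ne_zero) (surjective_incrToParam hAdet)
        (surjective_fderiv_incrToParam hAdet)
    exact hgi.comp_fibered (hci.differentiable one_ne_zero) (hΨ.2.1.differentiable one_ne_zero)
      (fun x => (hΨ.2.2 x).surjective) (fun x => (hΨ.2.2 x).surjective_fderiv)
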